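/- **Proposition 2.2.** Let $\lambda>0$, let $f$ be a probability density on $\mathbb R$, let $N$ be Poisson($\lambda$), let $Y_1,Y_2,\dots$ be i.i.d. with density $f$ and independent of $N$, and let $X=\sum_{j=1}^{N}Y_j$. Let $X_1,X_2,\dots$ be i.i.d. copies of $X$ and let $Z_1,Z_2,\dots$ be the successive nonzero values among them. Write $\phi_u(t)=\int e^{ity}u(y)\,dy$ and $\phi_{\rm emp}(t)=\frac1n\sum_{j=1}^n e^{itZ_j}$. For a kernel $w$, bandwidths $h=h_n>0$ and truncation levels $M_n$ put $$f_{nh}(x)=\frac1{2\pi\lambda}\int_{-1/h}^{1/h}e^{-itx}\,\mathrm{Log}\big((e^\lambda-1)\phi_{\rm emp}(t)\phi_w(ht)+1\big)\,dt$$ if the path $t\mapsto(e^\lambda-1)\phi_{\rm emp}(t)\phi_w(ht)+1$ has no zero, and $f_{nh}(x)=0$ otherwise. Here $\mathrm{Log}$ is the distinguished logarithm, that is, the continuous logarithm along the path whose value at $t=0$ is $\lambda$. Let $\hat f_{nh}(x)=(M_n\wedge f_{nh}(x))\vee(-M_n)$. Let $\beta,L_1,L_2>0$, let $l=\lfloor\beta\rfloor$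 be the integer part of $\beta$, and assume: * **(F)** $f$ has derivatives up to order $l$; for all $x,t$, $|f^{(l)}(x+t)-f^{(l)}(x)|\le L_1|t|^{\beta-l}$; for all $t$, $\big[\int(f^{(l)}(x+t)-f^{(l)}(x))^2dx\big]^{1/2}\le L_2|t|^{\beta-l}$; and $|t|^\beta\phi_f(t)$ and $f',\dots,f^{(l)}$ are integrable. * **(W)** $w:\mathbb R\to\mathbb R$ is bounded and symmetric; $u^jw(u)$ is integrable for $j=0,\dots,l$; $\int w=1$ and $\int u^jw(u)\,du=0$ for $j=1,\dots,l-1$; $\phi_w$ is continuously differentiable and vanishes outside $[-1,1]$; $\int|u|^\beta|w(u)|\,du<\infty$; and $uw(u)\to0$ as $|u|\to\infty$. * **(H)** $h=Cn^{-\gamma}$ for some $C>0$ and $0<\gamma<1$. * **(M)** $M_n=n^\alpha$ for some $\alpha>0$. * $nh^{1+4\beta}\to0$. Then the conditional law of $X$ given $N>0$ has a continuous density $g$; $\hat f_{nh}(x)$ is square integrable for all $n\ge1$ and $x\in\mathbb R$; and, for every $x\in\mathbb R$, as $n\to\infty$, $$\operatorname{Var}\hat f_{nh}(x)=\frac1{nh}\,\frac{(e^\lambda-1)^2}{\lambda^2}\,g(x)\int_{-\infty}^{\infty}w(u)^2\,du+o\Big(\frac1{nh}\Big).$$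 -/

import Mathlib

open MeasureTheory ProbabilityTheory Filter Topology Asymptotics

namespace Decompounding

noncomputable section

/-! ### Smoothness classes and the conditions on the density -/

/-- The Hölder class `H(β, L)`: with `l = ⌊β⌋` the integer part of `β`, the derivatives up to
order `l` exist everywhere and `|φ^(l)(x + t) - φ^(l)(x)| ≤ L |t|^(β - l)` for all `x, t`. -/
structure HolderClass (β L : ℝ) (φ : ℝ → ℝ) : Prop where
  differentiable : ∀ k < ⌊β⌋₊, Differentiable ℝ (iteratedDeriv k φ)
  holder : ∀ x t : ℝ,
    |iteratedDeriv ⌊β⌋₊ φ (x + t) - iteratedDeriv ⌊β⌋₊ φ x| ≤ L * |t| ^ (β - ⌊β⌋₊)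

/-- The Nikol'ski class `N(β, L)`: with `l = ⌊β⌋` the integer part of `β`, the derivatives up to
order `l` exist everywhere and the `L²`-norm of `φ^(l)(· + t) - φ^(l)` is at most
`L |t|^(β - l)` for all `t`. -/
structure NikolskiClass (β L : ℝ) (φ : ℝ → ℝ) : Prop where
  differentiable : ∀ k < ⌊β⌋₊, Differentiable ℝ (iteratedDeriv k φ)
  nikolski : ∀ t : ℝ,
    eLpNorm (fun x => iteratedDeriv ⌊β⌋₊ φ (x + t) - iteratedDeriv ⌊β⌋₊ φ x) 2 volume
      ≤ ENNReal.ofReal (L * |t| ^ (β - ⌊β⌋₊))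

/-- The characteristic function `t ↦ ∫ e^{itu} φ(u) du` of an (integrable) function `φ`. -/
def charFn (φ : ℝ → ℝ) (t : ℝ) : ℂ :=
  ∫ u : ℝ, Complex.exp (Complex.I * t * u) * (φ u : ℂ)

/-- The smoothness condition on the density `f` of the jumps. -/
structure ConditionF (β L₁ L₂ : ℝ) (f : ℝ → ℝ) : Prop where
  holder : HolderClass β L₁ f
  nikolski : NikolskiClass β L₂ f
  integrable_charFn : Integrable (fun t : ℝ => ((|t| ^ β : ℝ) : ℂ) * charFn f t)
  integrable_deriv : ∀ k : ℕ, 1 ≤ k → k ≤ ⌊β⌋₊ → Integrable (iteratedDeriv k f)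

/-! ### Kernels, bandwidths, truncation levels -/

/-- A kernel of order `l`. -/
structure IsKernelOfOrder (l : ℕ) (w : ℝ → ℝ) : Prop where
  integrable : ∀ j : ℕ, j ≤ l → Integrable (fun u : ℝ => u ^ j * w u)
  integral_eq_one : ∫ u : ℝ, w u = 1
  moment_eq_zero : ∀ j : ℕ, 1 ≤ j → j ≤ l - 1 → ∫ u : ℝ, u ^ j * w u = 0

/-- The condition on the kernel `w`. -/
structure ConditionW (β : ℝ) (w : ℝ → ℝ) : Prop where
  bounded : ∃ K : ℝ, ∀ u, |w u| ≤ K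
  symmetric : ∀ u, w (-u) = w u
  kernel : IsKernelOfOrder ⌊β⌋₊ w
  support : Function.support (charFn w) ⊆ Set.Icc (-1) 1
  integrable_rpow : Integrable (fun u : ℝ => |u| ^ β * |w u|)
  decay : Tendsto (fun u : ℝ => |u * w u|) (cocompact ℝ) (𝓝 0)
  contDiff : ContDiff ℝ 1 (charFn w)

/-- The condition on the bandwidth: `h = C n^{-γ}` with `0 < γ < 1` (and `h > 0`). -/
def ConditionH (h : ℕ → ℝ) : Prop :=
  ∃ C γ : ℝ, 0 < C ∧ 0 < γ ∧ γ < 1 ∧ ∀ n : ℕ, 1 ≤ n → h n = C * (n : ℝ) ^ (-γ)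

/-- The condition on the truncating sequence: `M_n = n^α` with `α > 0`. -/
def ConditionM (M : ℕ → ℝ) : Prop :=
  ∃ α : ℝ, 0 < α ∧ ∀ n : ℕ, 1 ≤ n → M n = (n : ℝ) ^ α

/-! ### The distinguished logarithm -/

/-- For a continuous path `ψ : ℝ → ℂ` without zeros there is exactly one continuous `L` with
`exp ∘ L = ψ` that starts, at `0`, from the principal logarithm of `ψ 0`. -/
theorem existsUnique_distinguishedLog {ψ : ℝ → ℂ} (hc : Continuous ψ) (h0 : ∀ t, ψ t ≠ 0) :
    ∃! L : ℝ → ℂ, Continuous L ∧ (∀ t, Complex.exp (L t) = ψ t) ∧ L 0 = Complex.log (ψ 0) := by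
  obtain ⟨F, ⟨hF0, hF⟩, huniq⟩ :=
    Complex.isCoveringMap_exp.existsUnique_continuousMap_lifts
      (⟨fun t => ⟨ψ t, h0 t⟩, by fun_prop⟩ : C(ℝ, {z : ℂ // z ≠ 0})) 0 (Complex.log (ψ 0))
      (Subtype.ext (Complex.exp_log (h0 0)))
  refine ⟨F, ⟨F.continuous, fun t => congrArg Subtype.val (congrFun hF t), hF0⟩, ?_⟩
  rintro L ⟨hLc, hL, hL0⟩
  exact congrArg (fun G : C(ℝ, ℂ) => (G : ℝ → ℂ))
    (huniq ⟨L, hLc⟩ ⟨hL0, funext fun t => Subtype.ext (hL t)⟩)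

open Classical in
/-- The distinguished logarithm of a path `ψ : ℝ → ℂ`: the continuous logarithm of `ψ` along `ℝ`
that equals the principal logarithm of `ψ 0` at `0`. (In the estimator below
`ψ 0 = e^λ > 0`, so the starting value is the real number `λ`.) It is only used for continuous
paths without zeros, where it exists and is unique; the other value is a dummy. -/
def distinguishedLog (ψ : ℝ → ℂ) : ℝ → ℂ :=
  if hL : ∃ L : ℝ → ℂ,
      Continuous L ∧ (∀ t, Complex.exp (L t) = ψ t) ∧ L 0 = Complex.log (ψ 0)
  then hL.choose else 0

/-! ### The estimator -/

/-- The empirical characteristic function of the sample `z 0, …, z (n - 1)`. -/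
def empCharFn (n : ℕ) (z : ℕ → ℝ) (t : ℝ) : ℂ :=
  (1 / (n : ℂ)) * ∑ j ∈ Finset.range n, Complex.exp (Complex.I * t * z j)

/-- The path `t ↦ (e^λ - 1) φ_emp(t) φ_w(ht) + 1`. -/
def path (lam : ℝ) (w : ℝ → ℝ) (h : ℝ) (n : ℕ) (z : ℕ → ℝ) (t : ℝ) : ℂ :=
  ((Real.exp lam - 1 : ℝ) : ℂ) * empCharFn n z t * charFn w (h * t) + 1

open Classical in
/-- The estimator `f_{nh}(x)` before truncation, as a function of the sample. It is
`(2πλ)⁻¹ ∫_{-1/h}^{1/h} e^{-itx} Log((e^λ - 1) φ_emp(t) φ_w(ht) + 1) dt`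
if the path does not vanish and zero otherwise. The integral is real for a symmetric
kernel `w`; the real part turns it into an element of `ℝ`. -/
def fRaw (lam : ℝ) (w : ℝ → ℝ) (h : ℝ) (n : ℕ) (z : ℕ → ℝ) (x : ℝ) : ℝ :=
  if ∀ t : ℝ, path lam w h n z t ≠ 0 then
    1 / (2 * Real.pi * lam) *
      (∫ t in (-(1 / h))..(1 / h),
        Complex.exp (-(Complex.I * t * x)) * distinguishedLog (path lam w h n z) t).re
  else 0

/-- The truncated estimator `(M ∧ f_{nh}(x)) ∨ (-M)`, as a function of the sample. -/
def fHat (lam : ℝ) (w : ℝ → ℝ) (h M : ℝ) (n : ℕ) (z : ℕ → ℝ) (x : ℝ) : ℝ :=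
  max (min M (fRaw lam w h n z x)) (-M)

/-! ### The observation scheme -/

/-- The compound sum `X = ∑_{j=1}^N Y_j` (the jumps are numbered from `0` here). -/
def compoundSum {Ω : Type*} (N : Ω → ℕ) (Y : ℕ → Ω → ℝ) (ω : Ω) : ℝ :=
  ∑ j ∈ Finset.range (N ω), Y j ω

/-- The law of `X = ∑_{j=1}^N Y_j` is compound Poisson: `N` is Poisson with parameter `lam`, the
`Y_j` are i.i.d. with density `f`, and `N` is independent of the sequence `Y`. -/
structure IsPoissonSumModel {Ω : Type*} [MeasurableSpace Ω] (P : Measure Ω)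
    (lam : ℝ) (f : ℝ → ℝ) (N : Ω → ℕ) (Y : ℕ → Ω → ℝ) : Prop where
  measurable_N : Measurable N
  measurable_Y : ∀ j, Measurable (Y j)
  law_N : P.map N = poissonMeasure lam.toNNReal
  density_nonneg : ∀ y, 0 ≤ f y
  law_Y : ∀ j, P.map (Y j) = volume.withDensity (fun y => ENNReal.ofReal (f y))
  indep_Y : iIndepFun Y P
  indep_N_Y : IndepFun N (fun ω j => Y j ω) P

/-- The nonzero observations `Z_1, Z_2, …` (numbered from `0` here): `nonzeroObs X k ω` is the
`k`-th nonzero value among `X 0 ω, X 1 ω, …`. Almost surely there are infinitely many nonzero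
values in the model considered below. -/
def nonzeroObs {Ω : Type*} (X : ℕ → Ω → ℝ) (k : ℕ) (ω : Ω) : ℝ :=
  X (Nat.nth (fun i => X i ω ≠ 0) k) ω

/-- `fHat` evaluated at the first `n` nonzero observations: a random variable for fixed `x`. -/
def estimator {Ω : Type*} (lam : ℝ) (w : ℝ → ℝ) (h M : ℕ → ℝ) (X : ℕ → Ω → ℝ)
    (n : ℕ) (x : ℝ) (ω : Ω) : ℝ :=
  fHat lam w (h n) (M n) n (fun k => nonzeroObs X k ω) x

end

end Decompounding

/-!
Write `μ` for the law of the nonzero observations and `a = e^λ - 1`. The nonzero observations are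
i.i.d. with law `μ` (`iIndepFun_nonzeroObs`, `map_nonzeroObs`), and `μ` is the law of `X` given
`N > 0`. Given `N > 0` the sum `X` is the first jump plus an independent remainder, so `μ` is the
convolution of `f` with a probability measure: it has a bounded continuous density `g`, and
`|φ_μ| ≤ |φ_f|`. The compound Poisson formula reads `a φ_μ + 1 = e^{λ φ_f}`
(`exists_density_nonzero`).

Let `ψ̄(t) = a φ_μ(t) φ_w(ht) + 1` be the mean of the random path `ψ`. For small `h` it stays
uniformly close to `e^{λ φ_f}`, hence away from zero. Where the empirical characteristic function is
uniformly close to `φ_μ` on `[-1/h, 1/h]`, the path `ψ` has no zero either, and its distinguished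
logarithm is that of `ψ̄` plus the principal logarithm of `ψ / ψ̄` (`distinguishedLog_perturb`).
Expanding this logarithm gives
`f_{nh}(x) = c + T + O(∫ |φ_emp - φ_μ|²)` (`exists_abs_fRaw_sub_le`), with `c` deterministic and
bounded and `T` the centred sample mean of a function `v` of the observations
(`linearPart_eq_deviation`). Up to a function that is bounded uniformly in `h`, `v(y)` equals
`(a / λ) h⁻¹ w((x - y) / h)` (`exists_abs_influence_sub_le`), because `∫ |φ_f| < ∞`. Therefore
`n h Var T` tends to `(a / λ)² g(x) ∫ w²` (`influence_asymptotics`).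

It remains to see that `f̂_{nh}(x) - c - T` is `o((n h)^{-1/2})` in mean square
(`tendsto_integral_sq_remainder`). The squared error `∫ |φ_emp - φ_μ|²` over `[-1/h, 1/h]` has a
second moment of order `(n h)⁻²` (`integral_squaredError_sq_le`). Since `M_n` eventually exceeds
`|c| + 1`, the truncation costs at most `T²` (`abs_truncate_sub_le`), and `E T⁴` is of the order
`(n h)⁻²` as well. The event on which the empirical characteristic function is not uniformly close
has exponentially small probability (`exists_uniform_empCharFn_close`, from Hoeffding's inequality
on a grid), while on it everything is bounded by powers of `n`. The Cauchy-Schwarz inequality then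
transfers the variance of `T` to the estimator (`abs_variance_sub_le`).

Measurability of the estimator is not automatic, as the distinguished logarithm is defined by
choice: the samples with zero-free path form an open set on which the estimator is continuous
(`measurable_fRaw`).
-/

namespace Decompounding

/-! ### Fourier inversion -/

section Fourier

open scoped FourierTransform ContDiff

/-- Fourier inversion almost everywhere, without continuity of the function. The two sides agree
against smooth test functions, because the Fourier transform can be moved to the test function,
for which inversion is pointwise. -/
theorem fourierInv_fourier_ae_eq {F : ℝ → ℂ} (hF : Integrable F) (hF' : Integrable (𝓕 F)) :
    𝓕⁻ (𝓕 F) =ᵐ[volume] F := by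
  have e1 : ∀ a : ℝ → ℂ, 𝓕⁻ a = fun x => 𝓕 a (-x) :=
    fun a => funext fun x => Real.fourierInv_eq_fourier_neg a x
  have hcont : Continuous (𝓕⁻ (𝓕 F)) := by
    rw [e1]
    exact Continuous.comp (VectorFourier.fourierIntegral_continuous Real.continuous_fourierChar
      continuous_inner hF') continuous_neg
  refine ae_eq_of_integral_contDiff_smul_eq hcont.locallyIntegrable hF.locallyIntegrable ?_
  intro g hg hgs
  have hgs' : HasCompactSupport (fun x => (g x : ℂ)) :=
    hgs.comp_left (g := fun r : ℝ => (r : ℂ)) rfl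
  have hg' : ContDiff ℝ ∞ (fun x => (g x : ℂ)) := Complex.ofRealCLM.contDiff.comp hg
  set G : SchwartzMap ℝ ℂ := hgs'.toSchwartzMap hg' with hG
  have hGv : ∀ x, G x = g x := fun x => rfl
  have flip : ∀ a b : ℝ → ℂ, Integrable a → Integrable b → ∫ x, 𝓕 a x * b x = ∫ x, a x * 𝓕 b x :=
    fun a b ha hb => by
      have := VectorFourier.integral_fourierIntegral_smul_eq_flip (L := innerₗ ℝ) (μ := volume)
        (ν := volume) (f := a) (g := b) Real.continuous_fourierChar continuous_inner ha hb
      rw [flip_innerₗ] at this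
      exact this
  have hGi : Integrable (fun x => 𝓕⁻ (G : ℝ → ℂ) x) := by
    rw [← SchwartzMap.fourierInv_coe]
    exact (𝓕⁻ G).integrable
  have hkey : ∫ x, (G x) * 𝓕⁻ (𝓕 F) x = ∫ x, G x * F x := by
    calc ∫ x, G x * 𝓕⁻ (𝓕 F) x = ∫ x, G (-x) * 𝓕 (𝓕 F) x := by
          rw [← integral_neg_eq_self (fun x => G x * 𝓕⁻ (𝓕 F) x)]
          simp only [e1, neg_neg]
      _ = ∫ x, 𝓕 (fun x => G (-x)) x * 𝓕 F x := (flip _ _ G.integrable.comp_neg hF').symm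
      _ = ∫ x, 𝓕 F x * 𝓕⁻ (G : ℝ → ℂ) x := by
          rw [Real.fourierInv_eq_fourier_comp_neg]
          simp only [mul_comm]
      _ = ∫ x, F x * 𝓕 (𝓕⁻ (G : ℝ → ℂ)) x := flip _ _ hF hGi
      _ = ∫ x, G x * F x := by
          have := Continuous.fourier_fourierInv_eq G.continuous G.integrable (by
            rw [← SchwartzMap.fourier_coe]; exact (𝓕 G).integrable)
          rw [this]
          simp only [mul_comm]
  simpa [hGv, Complex.real_smul] using hkey

theorem charFn_eq_fourier (φ : ℝ → ℝ) (t : ℝ) :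
    charFn φ t = 𝓕 (fun u => (φ u : ℂ)) (-t / (2 * Real.pi)) := by
  rw [Real.fourier_eq', charFn]
  refine integral_congr_ae (Eventually.of_forall fun u => ?_)
  have hpi : (Real.pi : ℂ) ≠ 0 := by exact_mod_cast Real.pi_ne_zero
  simp only [smul_eq_mul, RCLike.inner_apply, conj_trivial]
  congr 2
  push_cast
  field_simp

theorem continuous_charFn {φ : ℝ → ℝ} (hφ : Integrable φ) : Continuous (charFn φ) := by
  have h : Continuous (𝓕 (fun u => (φ u : ℂ))) :=
    VectorFourier.fourierIntegral_continuous Real.continuous_fourierChar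
      continuous_inner hφ.ofReal
  rw [funext (charFn_eq_fourier φ)]
  exact h.comp (by fun_prop)

theorem tendsto_charFn_cocompact (φ : ℝ → ℝ) : Tendsto (charFn φ) (cocompact ℝ) (𝓝 0) := by
  rw [funext (charFn_eq_fourier φ)]
  refine (Real.zero_at_infty_fourier (fun u => (φ u : ℂ))).comp ?_
  have hpi : (-(2 * Real.pi)⁻¹ : ℝ) ≠ 0 := by simp [Real.pi_ne_zero]
  have := (Homeomorph.mulLeft₀ _ hpi).isClosedEmbedding.tendsto_cocompact
  refine this.congr fun t => ?_
  simp only [Homeomorph.coe_mulLeft₀]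
  ring

theorem norm_charFn_le (φ : ℝ → ℝ) (t : ℝ) : ‖charFn φ t‖ ≤ ∫ u, |φ u| := by
  refine (norm_integral_le_integral_norm _).trans_eq ?_
  refine integral_congr_ae (Eventually.of_forall fun u => ?_)
  have : Complex.I * t * u = ((t * u : ℝ) : ℂ) * Complex.I := by push_cast; ring
  simp only [norm_mul, this, Complex.norm_exp_ofReal_mul_I, one_mul, Complex.norm_real,
    Real.norm_eq_abs]

theorem charFn_zero (φ : ℝ → ℝ) : charFn φ 0 = ((∫ u, φ u : ℝ) : ℂ) := by
  simp [charFn, integral_complex_ofReal]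

theorem fourierInv_fourier_eq_charFn (φ : ℝ → ℝ) (x : ℝ) :
    𝓕⁻ (𝓕 (fun u => (φ u : ℂ))) x =
      (2 * Real.pi)⁻¹ * ∫ t : ℝ, Complex.exp (-(Complex.I * t * x)) * charFn φ t := by
  have hpi : (Real.pi : ℂ) ≠ 0 := by exact_mod_cast Real.pi_ne_zero
  rw [Real.fourierInv_eq']
  set H : ℝ → ℂ := fun t => Complex.exp (-(Complex.I * t * x)) * charFn φ t
  have h := Measure.integral_comp_mul_left H (-(2 * Real.pi))
  have e : ∀ v : ℝ, Complex.exp (((2 * Real.pi * inner ℝ v x : ℝ) : ℂ) * Complex.I) •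
      𝓕 (fun u => (φ u : ℂ)) v = H (-(2 * Real.pi) * v) := fun v => by
    simp only [H, charFn_eq_fourier, smul_eq_mul, RCLike.inner_apply, conj_trivial]
    congr 2
    · push_cast; ring
    · field_simp
  rw [integral_congr_ae (Eventually.of_forall e), h]
  have : |(-(2 * Real.pi))⁻¹| = (2 * Real.pi)⁻¹ := by
    rw [abs_inv, abs_neg, abs_of_pos (by positivity)]
  rw [this, Complex.real_smul]

theorem integrable_fourier_of_charFn {φ : ℝ → ℝ} (h : Integrable (charFn φ)) :
    Integrable (𝓕 (fun u => (φ u : ℂ))) := by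
  have hpi : (-(2 * Real.pi) : ℝ) ≠ 0 := by simp [Real.pi_ne_zero]
  have := h.comp_mul_left' hpi
  refine this.congr (Eventually.of_forall fun v => ?_)
  simp only [charFn_eq_fourier]
  field_simp

theorem ae_eq_integral_charFn {φ : ℝ → ℝ} (hφ : Integrable φ) (h : Integrable (charFn φ)) :
    ∀ᵐ x : ℝ, ((2 * Real.pi)⁻¹ * ∫ t : ℝ, Complex.exp (-(Complex.I * t * x)) * charFn φ t)
      = (φ x : ℂ) := by
  filter_upwards [fourierInv_fourier_ae_eq hφ.ofReal (integrable_fourier_of_charFn h)] with x hx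
  exact (fourierInv_fourier_eq_charFn φ x).symm.trans hx

/-- A continuous function with integrable characteristic function is bounded. -/
theorem exists_abs_le_of_integrable_charFn {φ : ℝ → ℝ} (hc : Continuous φ) (hφ : Integrable φ)
    (h : Integrable (charFn φ)) : ∃ K, ∀ x, |φ x| ≤ K := by
  refine ⟨(2 * Real.pi)⁻¹ * ∫ t, ‖charFn φ t‖, fun x => ?_⟩
  have := congrFun (Continuous.fourierInv_fourier_eq (f := fun u => (φ u : ℂ)) (by fun_prop)
    hφ.ofReal (integrable_fourier_of_charFn h)) x
  rw [fourierInv_fourier_eq_charFn] at this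
  have h2 : |φ x| = ‖(φ x : ℂ)‖ := by simp
  rw [h2, ← this, norm_mul]
  rw [Complex.norm_real, Real.norm_of_nonneg (by positivity : (0 : ℝ) ≤ (2 * Real.pi)⁻¹)]
  refine mul_le_mul_of_nonneg_left ?_ (by positivity)
  refine (norm_integral_le_integral_norm _).trans_eq ?_
  refine integral_congr_ae (Eventually.of_forall fun t => ?_)
  have : -(Complex.I * t * x) = ((-(t * x) : ℝ) : ℂ) * Complex.I := by push_cast; ring
  simp only [norm_mul, this, Complex.norm_exp_ofReal_mul_I, one_mul]

end Fourier

/-! ### Consequences of the smoothness condition on the jump density -/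

theorem ConditionF.continuous {β L₁ L₂ : ℝ} (hβ : 0 < β) {f : ℝ → ℝ}
    (hF : ConditionF β L₁ L₂ f) : Continuous f := by
  by_cases hl : 0 < ⌊β⌋₊
  · have := hF.holder.differentiable 0 hl
    rw [iteratedDeriv_zero] at this
    exact this.continuous
  · have hl0 : ⌊β⌋₊ = 0 := by omega
    rw [continuous_iff_continuousAt]
    intro x
    have hh := hF.holder.holder x
    simp only [hl0, iteratedDeriv_zero, Nat.cast_zero, sub_zero] at hh
    have h1 : Tendsto (fun y : ℝ => L₁ * |y - x| ^ β) (𝓝 x) (𝓝 0) := by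
      have : Continuous (fun y : ℝ => L₁ * |y - x| ^ β) :=
        continuous_const.mul ((by fun_prop : Continuous fun y : ℝ => |y - x|).rpow_const
          (fun _ => Or.inr hβ.le))
      simpa [Real.zero_rpow hβ.ne'] using this.tendsto x
    refine tendsto_iff_norm_sub_tendsto_zero.2
      (squeeze_zero (fun _ => norm_nonneg _) (fun y => ?_) h1)
    simpa using hh (y - x)

/-- Near zero `φ_f` is integrable by continuity, and elsewhere `|t| ^ β ≥ 1`. -/
theorem ConditionF.integrable_charFn' {β L₁ L₂ : ℝ} (hβ : 0 < β) {f : ℝ → ℝ}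
    (hF : ConditionF β L₁ L₂ f) (hf : Integrable f) : Integrable (charFn f) := by
  have hc := continuous_charFn hf
  have h1 : IntegrableOn (charFn f) (Set.Icc (-1) 1) := hc.continuousOn.integrableOn_Icc
  have h2 : IntegrableOn (charFn f) (Set.Icc (-1) 1)ᶜ := by
    refine Integrable.mono (hF.integrable_charFn.integrableOn (s := (Set.Icc (-1) 1)ᶜ))
      hc.aestronglyMeasurable ?_
    refine (ae_restrict_iff' measurableSet_Icc.compl).2 (Eventually.of_forall fun t ht => ?_)
    have ht1 : 1 ≤ |t| := by
      by_contra hlt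
      exact ht (abs_le.1 (not_le.1 hlt).le)
    rw [norm_mul, Complex.norm_real, Real.norm_of_nonneg (by positivity)]
    exact le_mul_of_one_le_left (norm_nonneg _) (Real.one_le_rpow ht1 hβ.le)
  rw [← integrableOn_univ, ← Set.union_compl_self (Set.Icc (-1 : ℝ) 1)]
  exact h1.union h2

open scoped ENNReal

/-! ### The law of the nonzero observations -/

/-- Convolving a probability measure with a bounded continuous density gives a bounded continuous
density. -/
theorem exists_density_conv {f : ℝ → ℝ} (hf : Continuous f) (h0 : ∀ y, 0 ≤ f y) {K : ℝ}
    (hK : ∀ y, |f y| ≤ K) (ν : Measure ℝ) [IsProbabilityMeasure ν] :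
    ∃ g : ℝ → ℝ, Continuous g ∧ (∀ y, 0 ≤ g y) ∧ (∀ y, g y ≤ K) ∧
      ν ∗ (volume.withDensity fun y => ENNReal.ofReal (f y))
        = volume.withDensity fun y => ENNReal.ofReal (g y) := by
  have hint : ∀ x, Integrable (fun y => f (x - y)) ν := fun x =>
    Integrable.of_bound (by fun_prop) K (Eventually.of_forall fun y => hK _)
  refine ⟨fun x => ∫ y, f (x - y) ∂ν, ?_, fun x => integral_nonneg fun y => h0 _, fun x => ?_, ?_⟩
  · exact continuous_of_dominated (F := fun x y => f (x - y)) (bound := fun _ => K)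
      (fun x => by fun_prop) (fun x => Eventually.of_forall fun y => hK _) (integrable_const K)
      (Eventually.of_forall fun y => by fun_prop)
  · calc ∫ y, f (x - y) ∂ν ≤ ∫ _, K ∂ν :=
          integral_mono (hint x) (integrable_const K) fun y => (le_abs_self _).trans (hK _)
      _ = K := by simp
  · refine Measure.ext fun B hB => ?_
    have hmB : Measurable (B.indicator (1 : ℝ → ℝ≥0∞)) := measurable_one.indicator hB
    rw [← lintegral_indicator_one hB, Measure.lintegral_conv hmB, withDensity_apply _ hB,
      ← lintegral_indicator hB]
    have h1 : ∀ y, ∫⁻ x, B.indicator (1 : ℝ → ℝ≥0∞) (y + x)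
        ∂(volume.withDensity fun y => ENNReal.ofReal (f y))
        = ∫⁻ x, B.indicator (1 : ℝ → ℝ≥0∞) x * ENNReal.ofReal (f (x - y)) := fun y => by
      rw [lintegral_withDensity_eq_lintegral_mul _ (by fun_prop) (by fun_prop),
        ← lintegral_sub_right_eq_self _ y]
      refine lintegral_congr fun x => ?_
      simp [mul_comm]
    simp_rw [h1]
    rw [lintegral_lintegral_swap (by fun_prop)]
    refine lintegral_congr fun x => ?_
    rw [lintegral_const_mul _ (by fun_prop)]
    rw [← ofReal_integral_eq_lintegral_ofReal (hint x) (Eventually.of_forall fun y => h0 _)]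
    by_cases hx : x ∈ B <;> simp [hx]

variable {Ω₀ : Type*} [MeasurableSpace Ω₀] {P₀ : Measure Ω₀}
  {lam : ℝ} {f : ℝ → ℝ} {N : Ω₀ → ℕ} {Y : ℕ → Ω₀ → ℝ}

theorem measurable_compoundSum (hm : IsPoissonSumModel P₀ lam f N Y) :
    Measurable (compoundSum N Y) := by
  have hY := hm.measurable_Y
  refine measurable_from_prod_countable_left (f := fun p : Ω₀ × ℕ =>
    ∑ j ∈ Finset.range p.2, Y j p.1) (fun n => ?_) |>.comp (measurable_id.prodMk hm.measurable_N)
  exact Finset.measurable_sum (Finset.range n) fun j _ => hY j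

theorem IsPoissonSumModel.integrable_density [IsProbabilityMeasure P₀]
    (hm : IsPoissonSumModel P₀ lam f N Y)
    (hf : Continuous f) : Integrable f := by
  have h1 : IsProbabilityMeasure (volume.withDensity fun y => ENNReal.ofReal (f y)) := by
    rw [← hm.law_Y 0]
    exact Measure.isProbabilityMeasure_map (hm.measurable_Y 0).aemeasurable
  refine ⟨hf.aestronglyMeasurable, ?_⟩
  rw [hasFiniteIntegral_iff_ofReal (Eventually.of_forall hm.density_nonneg)]
  have := h1.measure_univ
  rw [withDensity_apply _ MeasurableSet.univ, setLIntegral_univ] at this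
  rw [this]
  exact ENNReal.one_lt_top

theorem charFun_withDensity (hf : Continuous f) (h0 : ∀ y, 0 ≤ f y) (t : ℝ) :
    charFun (volume.withDensity fun y => ENNReal.ofReal (f y)) t = charFn f t := by
  rw [charFun_apply_real, integral_withDensity_eq_integral_toReal_smul (by fun_prop) (by simp),
    charFn]
  refine integral_congr_ae (Eventually.of_forall fun u => ?_)
  simp only [ENNReal.toReal_ofReal (h0 u), Complex.real_smul]
  rw [mul_comm]
  congr 2
  ring

/-- The law of the partial sums of the jumps grows by one convolution factor per jump. -/
theorem map_sum_range_succ [IsProbabilityMeasure P₀]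
    (hm : IsPoissonSumModel P₀ lam f N Y) (k : ℕ) :
    P₀.map (∑ j ∈ Finset.range (k + 1), Y j) =
      P₀.map (∑ j ∈ Finset.range k, Y j) ∗ (volume.withDensity fun y => ENNReal.ofReal (f y)) := by
  have hY := hm.measurable_Y
  rw [Finset.sum_range_succ, ← hm.law_Y k]
  exact (hm.indep_Y.indepFun_sum_range_succ hm.measurable_Y k).map_add_eq_map_conv_map₀
    (Finset.aemeasurable_sum _ fun j _ => (hY j).aemeasurable) (hY k).aemeasurable

theorem charFun_map_sum_range [IsProbabilityMeasure P₀]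
    (hm : IsPoissonSumModel P₀ lam f N Y) (hf : Continuous f)
    (k : ℕ) (t : ℝ) : charFun (P₀.map (∑ j ∈ Finset.range k, Y j)) t = charFn f t ^ k := by
  have hprob : IsProbabilityMeasure (volume.withDensity fun y => ENNReal.ofReal (f y)) := by
    rw [← hm.law_Y 0]
    exact Measure.isProbabilityMeasure_map (hm.measurable_Y 0).aemeasurable
  induction k with
  | zero => simp [Pi.zero_def]
  | succ k ih =>
    rw [map_sum_range_succ hm, charFun_conv, ih,
      charFun_withDensity hf hm.density_nonneg, pow_succ]

theorem measure_N_eq (hm : IsPoissonSumModel P₀ lam f N Y) (hlam : 0 < lam) (k : ℕ) :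
    P₀ (N ⁻¹' {k}) = ENNReal.ofReal (Real.exp (-lam) * lam ^ k / k.factorial) := by
  rw [← Measure.map_apply hm.measurable_N (MeasurableSet.singleton k), hm.law_N,
    poissonMeasure_singleton, Real.coe_toNNReal _ hlam.le]

theorem measure_N_pos [IsProbabilityMeasure P₀]
    (hm : IsPoissonSumModel P₀ lam f N Y) (hlam : 0 < lam) :
    P₀ {ω | 0 < N ω} = ENNReal.ofReal (1 - Real.exp (-lam)) := by
  have : {ω | 0 < N ω} = (N ⁻¹' {0})ᶜ := by
    ext ω; simp [Nat.pos_iff_ne_zero]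
  rw [this, prob_compl_eq_one_sub (hm.measurable_N (MeasurableSet.singleton 0)),
    measure_N_eq hm hlam, ENNReal.ofReal_sub _ (Real.exp_pos _).le]
  simp

theorem measure_compoundSum_inter (hm : IsPoissonSumModel P₀ lam f N Y) (k : ℕ) {B : Set ℝ}
    (hB : MeasurableSet B) :
    P₀ (N ⁻¹' {k} ∩ compoundSum N Y ⁻¹' B)
      = P₀ (N ⁻¹' {k}) * P₀.map (∑ j ∈ Finset.range k, Y j) B := by
  have hY := hm.measurable_Y
  have hms : Measurable (fun y : ℕ → ℝ => ∑ j ∈ Finset.range k, y j) := by fun_prop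
  have h := indepFun_iff_measure_inter_preimage_eq_mul.1 hm.indep_N_Y {k}
    ((fun y : ℕ → ℝ => ∑ j ∈ Finset.range k, y j) ⁻¹' B) (MeasurableSet.singleton k) (hms hB)
  have hsum : Measurable (∑ j ∈ Finset.range k, Y j) := by fun_prop
  rw [Measure.map_apply hsum hB]
  have e1 : (∑ j ∈ Finset.range k, Y j) ⁻¹' B = (fun ω j => Y j ω) ⁻¹'
      ((fun y : ℕ → ℝ => ∑ j ∈ Finset.range k, y j) ⁻¹' B) := by
    ext ω
    simp
  rw [e1, ← h]
  congr 1
  ext ω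
  simp only [Set.mem_inter_iff, Set.mem_preimage, Set.mem_singleton_iff, compoundSum]
  refine and_congr_right fun hN => ?_
  rw [hN]

/-- Given `N > 0`, the law of `X` is the mixture of the laws of `k + 1` jumps with the Poisson
weights of `k + 1`. -/
theorem cond_map_compoundSum_eq_sum (hm : IsPoissonSumModel P₀ lam f N Y) :
    (P₀[|{ω | 0 < N ω}]).map (compoundSum N Y) = Measure.sum fun k : ℕ =>
      ((P₀ {ω | 0 < N ω})⁻¹ * P₀ (N ⁻¹' {k + 1})) •
        P₀.map (∑ j ∈ Finset.range (k + 1), Y j) := by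
  have hX := measurable_compoundSum hm
  have hs : MeasurableSet {ω | 0 < N ω} := measurableSet_lt measurable_const hm.measurable_N
  refine Measure.ext fun B hB => ?_
  rw [Measure.map_apply hX hB, cond_apply hs, Measure.sum_apply _ hB]
  simp only [Measure.smul_apply, smul_eq_mul, mul_assoc, ← measure_compoundSum_inter hm _ hB]
  rw [ENNReal.tsum_mul_left, ← measure_iUnion]
  · congr 2
    ext ω
    simp only [Set.mem_inter_iff, Set.mem_ofPred_eq, Set.mem_preimage, Set.mem_iUnion,
      Set.mem_singleton_iff]
    constructor
    · rintro ⟨h1, h2⟩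
      exact ⟨N ω - 1, by omega, h2⟩
    · rintro ⟨i, h1, h2⟩
      exact ⟨by omega, h2⟩
  · intro i j hij
    refine Set.disjoint_left.2 fun ω h1 h2 => hij ?_
    have e1 : N ω = i + 1 := h1.1
    have e2 : N ω = j + 1 := h2.1
    omega
  · intro i
    exact (hm.measurable_N (MeasurableSet.singleton _)).inter (hX hB)

/-- The properties of the law `μ` of `X` given `N > 0` that the asymptotics rest on. A nonempty sum
of jumps contains the convolution factor `f`, hence the bounded continuous density `g` and the bound
of the characteristic function by that of `f`. -/
theorem exists_density_nonzero [IsProbabilityMeasure P₀]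
    (hm : IsPoissonSumModel P₀ lam f N Y) (hlam : 0 < lam)
    (hf : Continuous f) {K : ℝ} (hK : ∀ y, |f y| ≤ K) (μ : Measure ℝ)
    (hμ : μ = (P₀[|{ω | 0 < N ω}]).map (compoundSum N Y)) :
    IsProbabilityMeasure μ ∧
    (∃ g : ℝ → ℝ, Continuous g ∧ (∀ y, 0 ≤ g y) ∧ (∀ y, g y ≤ K) ∧
      μ = volume.withDensity fun y => ENNReal.ofReal (g y)) ∧
    (∀ t, ‖charFun μ t‖ ≤ ‖charFn f t‖) ∧
    (∀ t, ((Real.exp lam - 1 : ℝ) : ℂ) * charFun μ t + 1 = Complex.exp (lam * charFn f t)) := by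
  have hX := measurable_compoundSum hm
  have hs : MeasurableSet {ω | 0 < N ω} := measurableSet_lt measurable_const hm.measurable_N
  have hexp : Real.exp (-lam) < 1 := Real.exp_lt_one_iff.2 (by linarith)
  have hpos : P₀ {ω | 0 < N ω} ≠ 0 := by
    rw [measure_N_pos hm hlam]
    simpa using hexp
  set ρ := volume.withDensity fun y => ENNReal.ofReal (f y) with hρ
  have hprobρ : IsProbabilityMeasure ρ := by
    rw [hρ, ← hm.law_Y 0]
    exact Measure.isProbabilityMeasure_map (hm.measurable_Y 0).aemeasurable
  have hcond := cond_isProbabilityMeasure (μ := P₀) hpos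
  have hprob : IsProbabilityMeasure μ := by
    rw [hμ]
    exact Measure.isProbabilityMeasure_map hX.aemeasurable
  -- `c k` is the probability of `N = k + 1` given `N > 0`; removing one jump from the mixture `μ`
  -- leaves the mixture `ν`, so that `μ = ν ∗ ρ`.
  set c : ℕ → ℝ≥0∞ := fun k => (P₀ {ω | 0 < N ω})⁻¹ * P₀ (N ⁻¹' {k + 1}) with hc
  have hlaw : ∀ k, IsProbabilityMeasure (P₀.map (∑ j ∈ Finset.range k, Y j)) := fun k =>
    Measure.isProbabilityMeasure_map
      (Finset.aemeasurable_sum _ fun j _ => (hm.measurable_Y j).aemeasurable)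
  have hsum : μ = Measure.sum fun k => c k • P₀.map (∑ j ∈ Finset.range (k + 1), Y j) :=
    hμ.trans (cond_map_compoundSum_eq_sum hm)
  have hc1 : ∑' k, c k = 1 := by
    have := hprob.measure_univ
    rw [hsum, Measure.sum_apply _ MeasurableSet.univ] at this
    simpa using this
  set ν := Measure.sum fun k => c k • P₀.map (∑ j ∈ Finset.range k, Y j) with hν
  have hprobν : IsProbabilityMeasure ν := by
    constructor
    rw [hν, Measure.sum_apply _ MeasurableSet.univ]
    simpa using hc1
  have hconv : μ = ν ∗ ρ := by
    rw [hsum, Measure.conv, hν, Measure.prod_sum_left, Measure.map_sum (by fun_prop)]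
    congr 1
    funext k
    rw [Measure.prod_smul_left, Measure.map_smul, map_sum_range_succ hm]
    rfl
  refine ⟨hprob, ?_, fun t => ?_, fun t => ?_⟩
  · rw [hconv]
    exact exists_density_conv hf hm.density_nonneg hK ν
  · rw [hconv, charFun_conv, norm_mul, charFun_withDensity hf hm.density_nonneg]
    exact mul_le_of_le_one_left (norm_nonneg _) (norm_charFun_le_one t)
  -- The compound Poisson formula, from the exponential series without its constant term.
  · have hcr : ∀ k, (c k).toReal = (1 - Real.exp (-lam))⁻¹ *
        (Real.exp (-lam) * lam ^ (k + 1) / (k + 1).factorial) := fun k => by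
      simp only [hc, measure_N_eq hm hlam, measure_N_pos hm hlam, ENNReal.toReal_mul,
        ENNReal.toReal_inv]
      rw [ENNReal.toReal_ofReal (by linarith), ENNReal.toReal_ofReal (by positivity)]
    have hint : Integrable (fun x : ℝ => Complex.exp (t * x * Complex.I)) μ :=
      Integrable.of_bound (by fun_prop) 1 (Eventually.of_forall fun x => by
        rw [← Complex.ofReal_mul, Complex.norm_exp_ofReal_mul_I])
    have h1 : HasSum (fun k : ℕ => ((c k).toReal : ℂ) * charFn f t ^ (k + 1)) (charFun μ t) := by
      rw [charFun_apply_real]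
      rw [hsum] at hint ⊢
      refine (hasSum_integral_measure hint).congr_fun ?_ |> id
      intro k
      rw [integral_smul_measure, ← charFun_apply_real, charFun_map_sum_range hm hf,
        Complex.real_smul]
    have h2 : HasSum (fun k : ℕ => (lam * charFn f t) ^ (k + 1) / ((k + 1).factorial : ℂ))
        (Complex.exp (lam * charFn f t) - 1) := by
      have := NormedSpace.expSeries_div_hasSum_exp (𝔸 := ℂ) (lam * charFn f t)
      rw [← Complex.exp_eq_exp_ℂ] at this
      rw [← hasSum_nat_add_iff' 1] at this
      simpa using this
    have hne : ((Real.exp lam - 1 : ℝ) : ℂ) ≠ 0 := by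
      have : Real.exp lam - 1 ≠ 0 := by
        have := Real.add_one_lt_exp hlam.ne'
        intro h; linarith
      exact_mod_cast this
    have h3 : HasSum (fun k : ℕ => (lam * charFn f t) ^ (k + 1) / ((k + 1).factorial : ℂ))
        (((Real.exp lam - 1 : ℝ) : ℂ) * charFun μ t) := by
      refine (h1.mul_left _).congr_fun ?_ |> id
      intro k
      have hk : (Real.exp lam - 1) * (c k).toReal = lam ^ (k + 1) / (k + 1).factorial := by
        rw [hcr, Real.exp_neg]
        have h1 : Real.exp lam ≠ 0 := (Real.exp_pos _).ne'
        have h2 : Real.exp lam - 1 ≠ 0 := by exact_mod_cast hne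
        have h3 : (1 - (Real.exp lam)⁻¹) = (Real.exp lam - 1) / Real.exp lam := by
          field_simp
        rw [h3]
        field_simp
      rw [← mul_assoc, ← Complex.ofReal_mul, hk]
      push_cast
      rw [mul_pow]
      ring
    rw [h3.unique h2]
    ring

/-- The law of `X` away from zero: an atom at zero aside, it is `(1 - e^{-λ}) μ`. -/
theorem map_compoundSum_diff_zero [IsProbabilityMeasure P₀]
    (hm : IsPoissonSumModel P₀ lam f N Y) (hlam : 0 < lam)
    {g : ℝ → ℝ} (hμ : (P₀[|{ω | 0 < N ω}]).map (compoundSum N Y)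
      = volume.withDensity fun y => ENNReal.ofReal (g y)) {B : Set ℝ} (hB : MeasurableSet B) :
    P₀.map (compoundSum N Y) (B \ {0}) = ENNReal.ofReal (1 - Real.exp (-lam)) *
      (P₀[|{ω | 0 < N ω}]).map (compoundSum N Y) B := by
  have hX := measurable_compoundSum hm
  have hs : MeasurableSet {ω | 0 < N ω} := measurableSet_lt measurable_const hm.measurable_N
  have h0 : (P₀[|{ω | 0 < N ω}]).map (compoundSum N Y) {0} = 0 := by
    rw [hμ]
    exact withDensity_absolutelyContinuous _ _ (by simp)
  rw [← measure_sdiff_null h0, Measure.map_apply hX (hB.diff (MeasurableSet.singleton 0)),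
    Measure.map_apply hX (hB.diff (MeasurableSet.singleton 0)), ← measure_N_pos hm hlam,
    mul_comm, cond_mul_eq_inter hs]
  congr 1
  ext ω
  simp only [Set.mem_preimage, Set.mem_sdiff, Set.mem_singleton_iff, Set.mem_inter_iff,
    Set.mem_ofPred_eq]
  refine ⟨fun h => ⟨?_, h⟩, fun h => h.2⟩
  by_contra hN
  apply h.2
  have : N ω = 0 := by omega
  simp [compoundSum, this]

/-! ### Independence of the nonzero observations -/

section Selection

variable {Ω : Type*} {X : ℕ → Ω → ℝ}

/-- The event that exactly `k` of `X 0, …, X (m - 1)` are nonzero, and that the `j`-th of these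
lies in `B j` for all `j < k`. The recursion over `m` makes it visible that the event depends only
on `X 0, …, X (m - 1)`. -/
def selectionEvent (X : ℕ → Ω → ℝ) (B : ℕ → Set ℝ) : ℕ → ℕ → Set Ω
  | 0, 0 => Set.univ
  | 0, _ + 1 => ∅
  | m + 1, 0 => selectionEvent X B m 0 ∩ X m ⁻¹' {0}
  | m + 1, k + 1 => (selectionEvent X B m (k + 1) ∩ X m ⁻¹' {0}) ∪
      (selectionEvent X B m k ∩ X m ⁻¹' (B k \ {0}))

open Classical in
/-- The recursive definition describes the intended event. -/
theorem mem_selectionEvent_iff (B : ℕ → Set ℝ) (ω : Ω) (m k : ℕ) :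
    ω ∈ selectionEvent X B m k ↔
      Nat.count (fun i => X i ω ≠ 0) m = k ∧ ∀ j < k, nonzeroObs X j ω ∈ B j := by
  induction m generalizing k with
  | zero =>
    cases k with
    | zero => simp [selectionEvent]
    | succ k => simp [selectionEvent]
  | succ m ih =>
    rw [Nat.count_succ]
    by_cases hx : X m ω = 0
    · cases k with
      | zero => simp [selectionEvent, ih, hx]
      | succ k => simp [selectionEvent, ih, hx]
    · cases k with
      | zero => simp [selectionEvent, ih, hx]
      | succ k =>
        have hobs : Nat.count (fun i => X i ω ≠ 0) m = k → nonzeroObs X k ω = X m ω := fun h => by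
          rw [nonzeroObs, ← h, Nat.nth_count (p := fun i => X i ω ≠ 0) hx]
        simp only [selectionEvent, Set.mem_union, Set.mem_inter_iff, ih, Set.mem_preimage,
          Set.mem_singleton_iff, hx, and_false, false_or, Set.mem_sdiff, not_false_eq_true,
          and_true, ne_eq, if_true, Nat.add_right_cancel_iff, Nat.forall_lt_succ_right]
        constructor
        · rintro ⟨⟨h1, h2⟩, h3⟩
          exact ⟨h1, h2, by rwa [hobs h1]⟩
        · rintro ⟨h1, h2, h3⟩
          exact ⟨⟨h1, h2⟩, by rwa [← hobs h1]⟩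

theorem measurableSet_selectionEvent_iSup {B : ℕ → Set ℝ} (hB : ∀ j, MeasurableSet (B j))
    (m k : ℕ) : MeasurableSet[⨆ i ∈ Set.Iio m, MeasurableSpace.comap (X i) inferInstance]
      (selectionEvent X B m k) := by
  induction m generalizing k with
  | zero =>
    cases k with
    | zero =>
      exact @MeasurableSet.univ Ω (⨆ i ∈ Set.Iio 0, MeasurableSpace.comap (X i) inferInstance)
    | succ k =>
      exact @MeasurableSet.empty Ω (⨆ i ∈ Set.Iio 0, MeasurableSpace.comap (X i) inferInstance)
  | succ m ih =>
    have hmono : ∀ s, MeasurableSet[⨆ i ∈ Set.Iio m, MeasurableSpace.comap (X i) inferInstance] s →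
        MeasurableSet[⨆ i ∈ Set.Iio (m + 1), MeasurableSpace.comap (X i) inferInstance] s :=
      fun s hs => (biSup_mono fun i hi => lt_trans hi (Nat.lt_succ_self m) :
        (⨆ i ∈ Set.Iio m, MeasurableSpace.comap (X i) inferInstance) ≤
        ⨆ i ∈ Set.Iio (m + 1), MeasurableSpace.comap (X i) inferInstance) s hs
    have hX : ∀ s, MeasurableSet s →
        MeasurableSet[⨆ i ∈ Set.Iio (m + 1), MeasurableSpace.comap (X i) inferInstance]
          (X m ⁻¹' s) := fun s hs =>
      (le_iSup₂ (f := fun i (_ : i ∈ Set.Iio (m + 1)) => MeasurableSpace.comap (X i) inferInstance)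
        m (Nat.lt_succ_self m)) _ ⟨s, hs, rfl⟩
    cases k with
    | zero => exact (hmono _ (ih 0)).inter (hX _ (MeasurableSet.singleton 0))
    | succ k =>
      exact ((hmono _ (ih (k + 1))).inter (hX _ (MeasurableSet.singleton 0))).union
        ((hmono _ (ih k)).inter (hX _ ((hB k).diff (MeasurableSet.singleton 0))))

variable [MeasurableSpace Ω]

theorem measurableSet_selectionEvent (hX : ∀ i, Measurable (X i)) {B : ℕ → Set ℝ}
    (hB : ∀ j, MeasurableSet (B j)) (m k : ℕ) : MeasurableSet (selectionEvent X B m k) :=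
  (iSup₂_le fun i _ => (hX i).comap_le : (⨆ i ∈ Set.Iio m,
    MeasurableSpace.comap (X i) inferInstance) ≤ _) _ (measurableSet_selectionEvent_iSup hB m k)

open Classical in
theorem measurable_nonzeroObs (hX : ∀ i, Measurable (X i)) (k : ℕ) :
    Measurable (nonzeroObs X k) := by
  -- `Nat.nth` is `0` when there is no `k`-th nonzero value, so the index `0` is treated separately.
  have hne : ∀ m, m ≠ 0 → MeasurableSet ((fun ω => Nat.nth (fun i => X i ω ≠ 0) k) ⁻¹' {m}) := by
    intro m hm
    have : (fun ω => Nat.nth (fun i => X i ω ≠ 0) k) ⁻¹' {m} =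
        selectionEvent X (fun _ => Set.univ) m k ∩ X m ⁻¹' {0}ᶜ := by
      ext ω
      simp only [Set.mem_preimage, Set.mem_singleton_iff, Set.mem_inter_iff,
        mem_selectionEvent_iff, Set.mem_univ, implies_true, and_true, Set.mem_compl_iff]
      constructor
      · rintro rfl
        exact ⟨Nat.count_nth (Nat.lt_card_toFinset_of_nth_ne_zero hm), Nat.nth_mem_of_ne_zero hm⟩
      · rintro ⟨h1, h2⟩
        rw [← h1]
        exact Nat.nth_count (p := fun i => X i ω ≠ 0) h2
    rw [this]
    exact (measurableSet_selectionEvent hX (fun _ => MeasurableSet.univ) m k).inter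
      (hX m (MeasurableSet.singleton 0).compl)
  have hτ : Measurable (fun ω => Nat.nth (fun i => X i ω ≠ 0) k) := by
    refine measurable_to_countable' fun m => ?_
    by_cases hm : m = 0
    · have : (fun ω => Nat.nth (fun i => X i ω ≠ 0) k) ⁻¹' {m} =
          (⋃ i : ℕ, (fun ω => Nat.nth (fun i => X i ω ≠ 0) k) ⁻¹' {i + 1})ᶜ := by
        ext ω
        simp only [hm, Set.mem_preimage, Set.mem_singleton_iff, Set.mem_compl_iff, Set.mem_iUnion,
          not_exists]
        constructor
        · intro h i hi
          omega
        · intro h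
          by_contra h0
          obtain ⟨i, hi⟩ := Nat.exists_eq_succ_of_ne_zero h0
          exact h i hi
      rw [this]
      exact (MeasurableSet.iUnion fun i => hne _ (Nat.succ_ne_zero i)).compl
    · exact hne m hm
  exact (measurable_from_prod_countable_left (f := fun p : Ω × ℕ => X p.2 p.1) hX).comp
    (measurable_id.prodMk hτ)

variable {P : Measure Ω} {μ : Measure ℝ} {p : ℝ≥0∞}

theorem measure_selectionEvent_inter (hX : ∀ i, Measurable (X i)) (hind : iIndepFun X P)
    {B : ℕ → Set ℝ} (hB : ∀ j, MeasurableSet (B j)) (m k : ℕ) {C : Set ℝ} (hC : MeasurableSet C) :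
    P (selectionEvent X B m k ∩ X m ⁻¹' C) = P (selectionEvent X B m k) * P (X m ⁻¹' C) := by
  have h := indep_iSup_of_disjoint (fun i => (hX i).comap_le) hind
    (S := Set.Iio m) (T := {m}) (by simp)
  refine (Indep_iff _ _ _).1 h _ _ (measurableSet_selectionEvent_iSup hB m k) ?_
  rw [iSup_singleton]
  exact ⟨C, hC, rfl⟩

/-- Given the number of nonzero values among `X 0, …, X (m - 1)`, these values are independent with
law `μ`. -/
theorem measure_selectionEvent [IsProbabilityMeasure P]
    (hX : ∀ i, Measurable (X i)) (hind : iIndepFun X P)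
    (hlaw : ∀ i, ∀ C, MeasurableSet C → P (X i ⁻¹' (C \ {0})) = p * μ C) [IsProbabilityMeasure μ]
    {B : ℕ → Set ℝ} (hB : ∀ j, MeasurableSet (B j)) (m k : ℕ) :
    P (selectionEvent X B m k) =
      P (selectionEvent X (fun _ => Set.univ) m k) * ∏ j ∈ Finset.range k, μ (B j) := by
  induction m generalizing k with
  | zero =>
    cases k with
    | zero => simp [selectionEvent]
    | succ k => simp [selectionEvent]
  | succ m ih =>
    have hu : ∀ j : ℕ, MeasurableSet ((fun _ => Set.univ : ℕ → Set ℝ) j) :=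
      fun _ => MeasurableSet.univ
    have h0 : MeasurableSet ({0} : Set ℝ) := MeasurableSet.singleton 0
    cases k with
    | zero =>
      simp only [selectionEvent]
      rw [measure_selectionEvent_inter hX hind hB _ _ h0,
        measure_selectionEvent_inter hX hind hu _ _ h0, ih]
      simp
    | succ k =>
      have key : ∀ B : ℕ → Set ℝ, (∀ j, MeasurableSet (B j)) →
          P (selectionEvent X B (m + 1) (k + 1)) =
          P (selectionEvent X B m (k + 1)) * P (X m ⁻¹' {0})
            + P (selectionEvent X B m k) * (p * μ (B k)) := by
        intro B hB
        simp only [selectionEvent]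
        rw [measure_union, measure_selectionEvent_inter hX hind hB _ _ h0,
          measure_selectionEvent_inter hX hind hB _ _ ((hB k).diff h0), hlaw m _ (hB k)]
        · refine Set.disjoint_left.2 fun ω h1 h2 => h2.2.2 h1.2
        · exact (measurableSet_selectionEvent hX hB m k).inter (hX m ((hB k).diff h0))
      rw [key B hB, key _ hu, ih (k + 1), ih k, Finset.prod_range_succ, measure_univ]
      ring

/-- Almost surely there are infinitely many nonzero observations. -/
theorem ae_infinite_nonzero [IsProbabilityMeasure P]
    (hX : ∀ i, Measurable (X i)) (hind : iIndepFun X P)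
    (hlaw : ∀ i, ∀ C, MeasurableSet C → P (X i ⁻¹' (C \ {0})) = p * μ C) [IsProbabilityMeasure μ]
    (hp : p ≠ 0) : ∀ᵐ ω ∂P, {i | X i ω ≠ 0}.Infinite := by
  have hs : ∀ i, P (X i ⁻¹' (Set.univ \ {0})) = p := fun i => by
    rw [hlaw i _ MeasurableSet.univ, measure_univ, mul_one]
  have hms : ∀ i, MeasurableSet (X i ⁻¹' (Set.univ \ {0})) := fun i =>
    hX i (MeasurableSet.univ.diff (MeasurableSet.singleton 0))
  have h := measure_limsup_eq_one (μ := P) hms ?_ ?_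
  · have hl : MeasurableSet (limsup (fun i => X i ⁻¹' (Set.univ \ {0})) atTop) :=
      MeasurableSet.measurableSet_limsup hms
    filter_upwards [(mem_ae_iff_prob_eq_one hl).2 h] with ω hω
    rw [mem_limsup_iff_frequently_mem, Nat.frequently_atTop_iff_infinite] at hω
    simpa using hω
  · exact (iIndepSet_iff_meas_biInter hms).2 fun S =>
      hind.measure_inter_preimage_eq_mul S fun _ _ =>
      MeasurableSet.univ.diff (MeasurableSet.singleton 0)
  · simp only [hs]
    exact ENNReal.tsum_const_eq_top_of_ne_zero hp

theorem measure_nonzeroObs [IsProbabilityMeasure P]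
    (hX : ∀ i, Measurable (X i)) (hind : iIndepFun X P)
    (hlaw : ∀ i, ∀ C, MeasurableSet C → P (X i ⁻¹' (C \ {0})) = p * μ C) [IsProbabilityMeasure μ]
    (hp : p ≠ 0) {B : ℕ → Set ℝ} (hB : ∀ j, MeasurableSet (B j)) (n : ℕ) :
    P {ω | ∀ j < n, nonzeroObs X j ω ∈ B j} = ∏ j ∈ Finset.range n, μ (B j) := by
  classical
  have hc : MeasurableSet ({0}ᶜ : Set ℝ) := (MeasurableSet.singleton 0).compl
  -- Sum over the index `m` of the `n`-th nonzero value.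
  have key : ∀ B : ℕ → Set ℝ, (∀ j, MeasurableSet (B j)) →
      P {ω | ∀ j < n, nonzeroObs X j ω ∈ B j} =
        (∑' m, P (selectionEvent X (fun _ => Set.univ) m n) * P (X m ⁻¹' {0}ᶜ)) *
          ∏ j ∈ Finset.range n, μ (B j) := by
    intro B hB
    have hU : P {ω | ∀ j < n, nonzeroObs X j ω ∈ B j} =
        P (⋃ m, selectionEvent X B m n ∩ X m ⁻¹' {0}ᶜ) := by
      refine measure_congr ?_
      filter_upwards [ae_infinite_nonzero hX hind hlaw hp] with ω hω
      refine propext ?_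
      change (∀ j < n, nonzeroObs X j ω ∈ B j) ↔ ω ∈ ⋃ m, selectionEvent X B m n ∩ X m ⁻¹' {0}ᶜ
      simp only [Set.mem_iUnion, Set.mem_inter_iff, mem_selectionEvent_iff, Set.mem_preimage,
        Set.mem_compl_iff, Set.mem_singleton_iff]
      constructor
      · intro h
        exact ⟨Nat.nth (fun i => X i ω ≠ 0) n,
          ⟨Nat.count_nth_of_infinite (p := fun i => X i ω ≠ 0) hω n, h⟩,
          Nat.nth_mem_of_infinite (p := fun i => X i ω ≠ 0) hω n⟩
      · rintro ⟨m, ⟨_, h⟩, _⟩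
        exact h
    rw [hU, measure_iUnion, ← ENNReal.tsum_mul_right]
    · refine tsum_congr fun m => ?_
      rw [measure_selectionEvent_inter hX hind hB _ _ hc,
        measure_selectionEvent hX hind hlaw hB]
      ring
    · intro i j hij
      refine Set.disjoint_left.2 fun ω h1 h2 => hij ?_
      rw [Set.mem_inter_iff, mem_selectionEvent_iff] at h1 h2
      rw [← Nat.nth_count (p := fun i => X i ω ≠ 0) (n := i) h1.2,
        ← Nat.nth_count (p := fun i => X i ω ≠ 0) (n := j) h2.2, h1.1.1, h2.1.1]
    · exact fun m => (measurableSet_selectionEvent hX hB m n).inter (hX m hc)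
  have h1 := key (fun _ => Set.univ) (fun _ => MeasurableSet.univ)
  simp only [Set.mem_univ, implies_true, measure_univ, Finset.prod_const_one, mul_one] at h1
  rw [key B hB, ← h1]
  have : {_ω : Ω | True} = Set.univ := by simp
  rw [this, measure_univ, one_mul]

theorem map_nonzeroObs [IsProbabilityMeasure P]
    (hX : ∀ i, Measurable (X i)) (hind : iIndepFun X P)
    (hlaw : ∀ i, ∀ C, MeasurableSet C → P (X i ⁻¹' (C \ {0})) = p * μ C) [IsProbabilityMeasure μ]
    (hp : p ≠ 0) (k : ℕ) : P.map (nonzeroObs X k) = μ := by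
  classical
  refine Measure.ext fun C hC => ?_
  rw [Measure.map_apply (measurable_nonzeroObs hX k) hC]
  have hB : ∀ j, MeasurableSet (if j = k then C else Set.univ) := fun j => by
    split_ifs
    exacts [hC, MeasurableSet.univ]
  have h := measure_nonzeroObs hX hind hlaw hp hB (k + 1)
  rw [Finset.prod_eq_single k (by intro j _ hj; simp [hj]) (by simp)] at h
  rw [if_pos rfl] at h
  rw [← h]
  congr 1
  ext ω
  simp only [Set.mem_preimage, Set.mem_ofPred_eq]
  constructor
  · intro hω j _
    split_ifs with hj
    · rwa [hj]
    · trivial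
  · intro hω
    simpa using hω k (Nat.lt_succ_self k)

theorem iIndepFun_nonzeroObs [IsProbabilityMeasure P]
    (hX : ∀ i, Measurable (X i)) (hind : iIndepFun X P)
    (hlaw : ∀ i, ∀ C, MeasurableSet C → P (X i ⁻¹' (C \ {0})) = p * μ C) [IsProbabilityMeasure μ]
    (hp : p ≠ 0) : iIndepFun (nonzeroObs X) P := by
  classical
  rw [iIndepFun_iff_measure_inter_preimage_eq_mul]
  intro S B hB
  have hB' : ∀ j, MeasurableSet (if j ∈ S then B j else Set.univ) := fun j => by
    split_ifs with h
    exacts [hB j h, MeasurableSet.univ]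
  obtain ⟨n, hn⟩ : ∃ n, S ⊆ Finset.range n := S.exists_nat_subset_range
  have h := measure_nonzeroObs hX hind hlaw hp hB' n
  have e1 : {ω | ∀ j < n, nonzeroObs X j ω ∈ if j ∈ S then B j else Set.univ}
      = ⋂ i ∈ S, nonzeroObs X i ⁻¹' B i := by
    ext ω
    simp only [Set.mem_ofPred_eq, Set.mem_iInter, Set.mem_preimage]
    constructor
    · intro hω i hi
      simpa [hi] using hω i (Finset.mem_range.1 (hn hi))
    · intro hω j _
      split_ifs with hj
      exacts [hω j hj, trivial]
  rw [← e1, h, ← Finset.prod_subset hn (fun j _ hj => by simp [hj])]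
  refine Finset.prod_congr rfl fun j hj => ?_
  rw [if_pos hj, ← map_nonzeroObs hX hind hlaw hp j,
    Measure.map_apply (measurable_nonzeroObs hX j) (hB j hj)]

end Selection

/-! ### The distinguished logarithm under perturbation -/

theorem distinguishedLog_spec {ψ : ℝ → ℂ} (hc : Continuous ψ) (h0 : ∀ t, ψ t ≠ 0) :
    Continuous (distinguishedLog ψ) ∧ (∀ t, Complex.exp (distinguishedLog ψ t) = ψ t) ∧
      distinguishedLog ψ 0 = Complex.log (ψ 0) := by
  have h := (existsUnique_distinguishedLog hc h0).exists
  rw [distinguishedLog, dif_pos h]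
  exact h.choose_spec

theorem distinguishedLog_eq {ψ L : ℝ → ℂ} (hc : Continuous ψ) (hL : Continuous L)
    (hexp : ∀ t, Complex.exp (L t) = ψ t) (hL0 : L 0 = Complex.log (ψ 0)) :
    distinguishedLog ψ = L := by
  have h0 : ∀ t, ψ t ≠ 0 := fun t => by
    rw [← hexp]
    exact Complex.exp_ne_zero _
  exact (existsUnique_distinguishedLog hc h0).unique (distinguishedLog_spec hc h0) ⟨hL, hexp, hL0⟩

theorem one_add_div_eq {a b : ℂ} (hb : b ≠ 0) : 1 + (a - b) / b = a / b := by
  field_simp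
  ring

/-- A path uniformly closer to `ψ₀` than half of `|ψ₀|` has no zero, and its distinguished logarithm
differs from that of `ψ₀` by the principal logarithm of the quotient. -/
theorem distinguishedLog_perturb {ψ ψ₀ L₀ : ℝ → ℂ} (hc : Continuous ψ) (hc₀ : Continuous ψ₀)
    (hL₀ : Continuous L₀) (hexp : ∀ t, Complex.exp (L₀ t) = ψ₀ t)
    (hL₀0 : L₀ 0 = Complex.log (ψ₀ 0)) (h0 : ψ 0 = ψ₀ 0)
    (hclose : ∀ t, ‖ψ t - ψ₀ t‖ ≤ 1 / 2 * ‖ψ₀ t‖) :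
    (∀ t, ψ t ≠ 0) ∧
      distinguishedLog ψ = fun t => L₀ t + Complex.log (1 + (ψ t - ψ₀ t) / ψ₀ t) := by
  have hne₀ : ∀ t, ψ₀ t ≠ 0 := fun t => by
    rw [← hexp]
    exact Complex.exp_ne_zero _
  have hz : ∀ t, ‖(ψ t - ψ₀ t) / ψ₀ t‖ ≤ 1 / 2 := fun t => by
    rw [norm_div, div_le_iff₀ (norm_pos_iff.2 (hne₀ t))]
    exact hclose t
  have hne : ∀ t, ψ t ≠ 0 := fun t ht => by
    have := hclose t
    rw [ht, zero_sub, norm_neg] at this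
    have := norm_pos_iff.2 (hne₀ t)
    linarith
  refine ⟨hne, distinguishedLog_eq hc ?_ (fun t => ?_) ?_⟩
  · refine hL₀.add (Continuous.clog ?_ fun t => ?_)
    · exact continuous_const.add ((hc.sub hc₀).div hc₀ hne₀)
    · exact Complex.mem_slitPlane_of_norm_lt_one ((hz t).trans_lt (by norm_num))
  · rw [Complex.exp_add, hexp, one_add_div_eq (hne₀ t),
      Complex.exp_log (div_ne_zero (hne t) (hne₀ t)), mul_div_cancel₀ _ (hne₀ t)]
  · simp [h0, hL₀0]

/-! ### The path and the measurability of the estimator -/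

theorem ConditionW.integrable {β : ℝ} {w : ℝ → ℝ} (hW : ConditionW β w) : Integrable w := by
  simpa using hW.kernel.integrable 0 (Nat.zero_le _)

theorem ConditionW.charFn_eq_zero {β : ℝ} {w : ℝ → ℝ} (hW : ConditionW β w) {s : ℝ}
    (hs : 1 < |s|) : charFn w s = 0 := by
  by_contra h
  have := hW.support (Function.mem_support.2 h)
  exact absurd (abs_le.2 this) (not_le.2 hs)

theorem charFn_mul_eq_zero {w : ℝ → ℝ} (hw0 : ∀ s, 1 < |s| → charFn w s = 0) {h : ℝ} (hh : 0 < h)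
    {t : ℝ} (ht : t ∉ Set.Icc (-(1 / h)) (1 / h)) : charFn w (h * t) = 0 := by
  refine hw0 _ (not_le.1 fun hle => ht ?_)
  rw [abs_mul, abs_of_pos hh] at hle
  exact abs_le.1 (by rwa [le_div_iff₀' hh])

theorem norm_empCharFn_le_one (n : ℕ) (z : ℕ → ℝ) (t : ℝ) : ‖empCharFn n z t‖ ≤ 1 := by
  rw [empCharFn, norm_mul]
  have h1 : ‖∑ j ∈ Finset.range n, Complex.exp (Complex.I * t * z j)‖ ≤ n := by
    refine (norm_sum_le _ _).trans ?_
    refine (Finset.sum_le_sum (g := fun _ => (1 : ℝ)) fun j _ => ?_).trans (by simp)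
    have : Complex.I * t * z j = ((t * z j : ℝ) : ℂ) * Complex.I := by push_cast; ring
    rw [this, Complex.norm_exp_ofReal_mul_I]
  rcases Nat.eq_zero_or_pos n with rfl | hn
  · simp
  · have hn' : (0 : ℝ) < n := by exact_mod_cast hn
    rw [norm_div, norm_one, Complex.norm_natCast, one_div, inv_mul_le_iff₀ hn', mul_one]
    exact h1

theorem empCharFn_zero {n : ℕ} (hn : 1 ≤ n) (z : ℕ → ℝ) : empCharFn n z 0 = 1 := by
  have : (n : ℂ) ≠ 0 := by exact_mod_cast (by omega : n ≠ 0)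
  simp [empCharFn, this]

theorem path_zero {lam : ℝ} {w : ℝ → ℝ} (hw1 : ∫ u, w u = 1) (h : ℝ) {n : ℕ} (hn : 1 ≤ n)
    (z : ℕ → ℝ) : path lam w h n z 0 = (Real.exp lam : ℝ) := by
  rw [path, empCharFn_zero hn, mul_zero, charFn_zero, hw1]
  push_cast
  ring

theorem continuous_path_uncurry (lam : ℝ) {w : ℝ → ℝ} (hw : Integrable w) (h : ℝ) (n : ℕ) :
    Continuous fun p : (ℕ → ℝ) × ℝ => path lam w h n p.1 p.2 := by
  have h1 := continuous_charFn hw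
  unfold path empCharFn
  fun_prop

theorem continuous_path (lam : ℝ) {w : ℝ → ℝ} (hw : Integrable w) (h : ℝ) (n : ℕ) (z : ℕ → ℝ) :
    Continuous (path lam w h n z) := by
  have h1 := continuous_charFn hw
  unfold path empCharFn
  fun_prop

/-- Paths of nearby samples are uniformly close, because they agree outside a compact interval. -/
theorem eventually_path_close (lam : ℝ) {w : ℝ → ℝ} (hw : Integrable w)
    (hw0 : ∀ s, 1 < |s| → charFn w s = 0) {h : ℝ} (hh : 0 < h) (n : ℕ) {z₀ : ℕ → ℝ}
    (hz₀ : ∀ t, path lam w h n z₀ t ≠ 0) {ε : ℝ} (hε : 0 < ε) :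
    ∀ᶠ z in 𝓝 z₀, ∀ t, ‖path lam w h n z t - path lam w h n z₀ t‖ ≤ ε * ‖path lam w h n z₀ t‖ := by
  have hc := continuous_path_uncurry lam hw h n
  have hc₀ := continuous_path lam hw h n z₀
  have hK : ∀ᶠ z in 𝓝 z₀, ∀ t ∈ Set.Icc (-(1 / h)) (1 / h),
      ‖path lam w h n z t - path lam w h n z₀ t‖ < ε * ‖path lam w h n z₀ t‖ := by
    refine isCompact_Icc.eventually_forall_of_forall_eventually fun t _ => ?_
    have hl : Continuous fun p : (ℕ → ℝ) × ℝ =>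
        ‖path lam w h n p.1 p.2 - path lam w h n z₀ p.2‖ :=
      (hc.sub (hc₀.comp continuous_snd)).norm
    have hr : Continuous fun p : (ℕ → ℝ) × ℝ => ε * ‖path lam w h n z₀ p.2‖ :=
      continuous_const.mul (hc₀.comp continuous_snd).norm
    refine hl.continuousAt.eventually_lt hr.continuousAt ?_
    simpa using mul_pos hε (norm_pos_iff.2 (hz₀ t))
  filter_upwards [hK] with z hz t
  by_cases ht : t ∈ Set.Icc (-(1 / h)) (1 / h)
  · exact (hz t ht).le
  · have : path lam w h n z t = path lam w h n z₀ t := by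
      simp only [path, charFn_mul_eq_zero hw0 hh ht, mul_zero]
    rw [this, sub_self, norm_zero]
    positivity

theorem norm_exp_neg_I_mul (t x : ℝ) : ‖Complex.exp (-(Complex.I * t * x))‖ = 1 := by
  have : -(Complex.I * t * x) = ((-(t * x) : ℝ) : ℂ) * Complex.I := by push_cast; ring
  rw [this, Complex.norm_exp_ofReal_mul_I]

/-- Before truncation the estimator is continuous on the open set of samples whose path has no zero,
and it vanishes on the complement. -/
theorem measurable_fRaw (lam : ℝ) {w : ℝ → ℝ} (hw : Integrable w) (hw1 : ∫ u, w u = 1)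
    (hw0 : ∀ s, 1 < |s| → charFn w s = 0) {h : ℝ} (hh : 0 < h) {n : ℕ} (hn : 1 ≤ n) (x : ℝ) :
    Measurable fun z => fRaw lam w h n z x := by
  classical
  set U : Set (ℕ → ℝ) := {z | ∀ t, path lam w h n z t ≠ 0} with hU
  -- Near a sample in `U` the distinguished logarithms are uniformly close.
  have hpert : ∀ z₀ ∈ U, ∀ ε, 0 < ε → ε ≤ 1 / 2 → ∀ᶠ z in 𝓝 z₀, z ∈ U ∧
      ∀ t, ‖distinguishedLog (path lam w h n z) t - distinguishedLog (path lam w h n z₀) t‖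
        ≤ 3 / 2 * ε := by
    intro z₀ hz₀ ε hε hε2
    have hc₀ := continuous_path lam hw h n z₀
    obtain ⟨hL, hexp, hL0⟩ := distinguishedLog_spec hc₀ hz₀
    filter_upwards [eventually_path_close lam hw hw0 hh n hz₀ hε] with z hz
    obtain ⟨h1, h2⟩ := distinguishedLog_perturb (continuous_path lam hw h n z) hc₀ hL hexp hL0
      (by rw [path_zero hw1 h hn, path_zero hw1 h hn])
      (fun t => (hz t).trans (mul_le_mul_of_nonneg_right hε2 (norm_nonneg _)))
    refine ⟨h1, fun t => ?_⟩
    have hq : ‖(path lam w h n z t - path lam w h n z₀ t) / path lam w h n z₀ t‖ ≤ ε := by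
      rw [norm_div, div_le_iff₀ (norm_pos_iff.2 (hz₀ t))]
      exact hz t
    rw [h2, add_sub_cancel_left]
    exact (Complex.norm_log_one_add_half_le_self (hq.trans hε2)).trans (by gcongr)
  have hopen : IsOpen U := isOpen_iff_mem_nhds.2 fun z₀ hz₀ =>
    (hpert z₀ hz₀ (1 / 2) (by norm_num) le_rfl).mono fun z hz => hz.1
  have hcont : ContinuousOn (fun z => ∫ t in (-(1 / h))..(1 / h),
      Complex.exp (-(Complex.I * t * x)) * distinguishedLog (path lam w h n z) t) U := by
    intro z₀ hz₀
    refine ContinuousAt.continuousWithinAt ?_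
    rw [ContinuousAt, Metric.tendsto_nhds]
    intro ε hε
    set δ := min (1 / 2) (ε * h / 6) with hδ
    have hδ0 : 0 < δ := by positivity
    have hint : ∀ z ∈ U, IntervalIntegrable (fun t : ℝ => Complex.exp (-(Complex.I * t * x)) *
        distinguishedLog (path lam w h n z) t) volume (-(1 / h)) (1 / h) := fun z hz => by
      have := (distinguishedLog_spec (continuous_path lam hw h n z) hz).1
      exact Continuous.intervalIntegrable (by fun_prop) _ _
    filter_upwards [hpert z₀ hz₀ δ hδ0 (min_le_left _ _)] with z hz
    rw [dist_eq_norm, ← intervalIntegral.integral_sub (hint z hz.1) (hint z₀ hz₀)]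
    refine (intervalIntegral.norm_integral_le_of_norm_le_const (C := 3 / 2 * δ)
      fun t _ => ?_).trans_lt ?_
    · rw [← mul_sub, norm_mul, norm_exp_neg_I_mul, one_mul]
      exact hz.2 t
    · have h1 : |1 / h - -(1 / h)| = 2 / h := by
        rw [sub_neg_eq_add, abs_of_pos (by positivity)]
        ring
      rw [h1]
      have h2 : δ ≤ ε * h / 6 := min_le_right _ _
      calc 3 / 2 * δ * (2 / h) ≤ 3 / 2 * (ε * h / 6) * (2 / h) := by gcongr
        _ = ε / 2 := by field_simp; norm_num
        _ < ε := by linarith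
  refine measurable_of_restrict_of_restrict_compl hopen.measurableSet ?_ ?_
  · have : U.domRestrict (fun z => fRaw lam w h n z x) = U.domRestrict fun z =>
        1 / (2 * Real.pi * lam) * (∫ t in (-(1 / h))..(1 / h),
          Complex.exp (-(Complex.I * t * x)) * distinguishedLog (path lam w h n z) t).re := by
      ext ⟨z, hz⟩
      simp only [Set.domRestrict_apply, fRaw]
      exact if_pos hz
    rw [this]
    refine Continuous.measurable ?_
    exact continuous_const.mul (Complex.continuous_re.comp
      (continuousOn_iff_continuous_domRestrict.1 hcont))
  · have : Uᶜ.domRestrict (fun z => fRaw lam w h n z x) = fun _ => 0 := by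
      ext ⟨z, hz⟩
      simp only [Set.domRestrict_apply, fRaw]
      exact if_neg hz
    rw [this]
    exact measurable_const

theorem measurable_fHat (lam : ℝ) {w : ℝ → ℝ} (hw : Integrable w) (hw1 : ∫ u, w u = 1)
    (hw0 : ∀ s, 1 < |s| → charFn w s = 0) {h : ℝ} (hh : 0 < h) (M : ℝ) {n : ℕ} (hn : 1 ≤ n)
    (x : ℝ) : Measurable fun z => fHat lam w h M n z x := by
  have := measurable_fRaw lam hw hw1 hw0 hh hn x
  unfold fHat
  fun_prop

theorem abs_fHat_le (lam : ℝ) (w : ℝ → ℝ) (h : ℝ) {M : ℝ} (hM : 0 ≤ M) (n : ℕ) (z : ℕ → ℝ)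
    (x : ℝ) : |fHat lam w h M n z x| ≤ M := by
  rw [abs_le, fHat]
  exact ⟨le_max_right _ _, max_le (min_le_left _ _) (by linarith)⟩

/-! ### Moments and deviations of sample means -/

section Sample

variable {Ω : Type*} [MeasurableSpace Ω] {P : Measure Ω} {Z : ℕ → Ω → ℝ} {μ : Measure ℝ}

theorem integral_comp_sample {E : Type*} [NormedAddCommGroup E] [NormedSpace ℝ E]
    (hZ : ∀ j, Measurable (Z j)) (hlaw : ∀ j, P.map (Z j) = μ) {q : ℝ → E}
    (hq : StronglyMeasurable q) (j : ℕ) : ∫ ω, q (Z j ω) ∂P = ∫ y, q y ∂μ := by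
  rw [← hlaw j, integral_map (hZ j).aemeasurable hq.aestronglyMeasurable]

/-- Second and fourth moment of a sum of independent centred bounded variables: in the fourth moment
of `S + V` the odd mixed terms vanish. -/
theorem moments_sum_sample [IsProbabilityMeasure P] (hZ : ∀ j, Measurable (Z j))
    (hind : iIndepFun Z P) (hlaw : ∀ j, P.map (Z j) = μ) {q : ℝ → ℝ} (hq : Measurable q) {b : ℝ}
    (hb : ∀ y, |q y| ≤ b) (hq0 : ∫ y, q y ∂μ = 0) (n : ℕ) :
    ∫ ω, (∑ j ∈ Finset.range n, q (Z j ω)) ^ 2 ∂P = n * ∫ y, q y ^ 2 ∂μ ∧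
    ∫ ω, (∑ j ∈ Finset.range n, q (Z j ω)) ^ 4 ∂P ≤
      n * (b ^ 2 * ∫ y, q y ^ 2 ∂μ) + 3 * n ^ 2 * (∫ y, q y ^ 2 ∂μ) ^ 2 := by
  set v := ∫ y, q y ^ 2 ∂μ with hv
  have hv0 : 0 ≤ v := integral_nonneg fun y => sq_nonneg _
  have hmeas : ∀ j, Measurable fun ω => q (Z j ω) := fun j => hq.comp (hZ j)
  have hindq : iIndepFun (fun j ω => q (Z j ω)) P := hind.comp (fun _ => q) (fun _ => hq)
  set S : ℕ → Ω → ℝ := fun n ω => ∑ j ∈ Finset.range n, q (Z j ω) with hS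
  have hSm : ∀ n, Measurable (S n) := fun n => Finset.measurable_sum _ fun j _ => hmeas j
  have hSb : ∀ n ω, |S n ω| ≤ n * b := fun n ω => by
    refine (Finset.abs_sum_le_sum_abs _ _).trans ?_
    refine (Finset.sum_le_sum (g := fun _ => b) fun j _ => hb _).trans (by simp)
  have hint : ∀ n k l, Integrable (fun ω => S n ω ^ k * q (Z n ω) ^ l) P := fun n k l => by
    refine Integrable.of_bound (((hSm n).pow_const k).mul
      ((hmeas n).pow_const l)).aestronglyMeasurable ((n * b) ^ k * b ^ l)
      (Eventually.of_forall fun ω => ?_)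
    rw [Real.norm_eq_abs, abs_mul, abs_pow, abs_pow]
    have hb0 : 0 ≤ b := (abs_nonneg _).trans (hb 0)
    gcongr
    exacts [hSb n ω, hb _]
  have hprod : ∀ n k l, ∫ ω, S n ω ^ k * q (Z n ω) ^ l ∂P =
      (∫ ω, S n ω ^ k ∂P) * ∫ y, q y ^ l ∂μ := fun n k l => by
    have hi : IndepFun (fun ω => S n ω ^ k) (fun ω => q (Z n ω) ^ l) P := by
      have h := (hindq.indepFun_sum_range_succ hmeas n).comp (φ := fun x : ℝ => x ^ k)
        (ψ := fun x : ℝ => x ^ l) (by fun_prop) (by fun_prop)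
      convert h using 1
      · ext ω
        simp [hS]
      · rfl
    rw [hi.integral_fun_mul_eq_mul_integral ((hSm n).pow_const k).aestronglyMeasurable
      ((hmeas n).pow_const l).aestronglyMeasurable,
      integral_comp_sample hZ hlaw (q := fun y => q y ^ l) (hq.pow_const l).stronglyMeasurable]
  have h4 : ∫ y, q y ^ 4 ∂μ ≤ b ^ 2 * v := by
    have hprob : IsProbabilityMeasure μ := by
      rw [← hlaw 0]
      exact Measure.isProbabilityMeasure_map (hZ 0).aemeasurable
    have hi : ∀ k, Integrable (fun y => q y ^ k) μ := fun k =>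
      Integrable.of_bound (hq.pow_const k).aestronglyMeasurable (b ^ k)
        (Eventually.of_forall fun y => by
          rw [Real.norm_eq_abs, abs_pow]
          have := hb y
          gcongr)
    rw [hv, ← integral_const_mul]
    refine integral_mono (hi 4) ((hi 2).const_mul _) fun y => ?_
    have h1 : q y ^ 2 ≤ b ^ 2 := sq_le_sq' (abs_le.1 (hb y)).1 (abs_le.1 (hb y)).2
    calc q y ^ 4 = q y ^ 2 * q y ^ 2 := by ring
      _ ≤ b ^ 2 * q y ^ 2 := by gcongr
  suffices hall : (∫ ω, S n ω ∂P = 0) ∧ (∫ ω, S n ω ^ 2 ∂P = n * v) ∧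
      ∫ ω, S n ω ^ 4 ∂P ≤ n * (b ^ 2 * v) + 3 * n ^ 2 * v ^ 2 from hall.2
  induction n with
  | zero => simp [hS]
  | succ n ih =>
    obtain ⟨ih1, ih2, ih4⟩ := ih
    have hsucc : ∀ ω, S (n + 1) ω = S n ω + q (Z n ω) := fun ω => by
      simp only [hS, Finset.sum_range_succ]
    have i1 := hint n 1 0
    have p : ∀ k l, ∫ ω, S n ω ^ k * q (Z n ω) ^ l ∂P =
      (∫ ω, S n ω ^ k ∂P) * ∫ y, q y ^ l ∂μ := hprod n
    have hμ1 : ∫ y, q y ^ 1 ∂μ = 0 := by simpa using hq0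
    have hS1 : ∫ ω, S n ω ^ 1 ∂P = 0 := by simpa using ih1
    have hμ0 : ∫ y, q y ^ 0 ∂μ = 1 := by
      rw [← integral_comp_sample hZ hlaw (q := fun y => q y ^ 0)
        (hq.pow_const 0).stronglyMeasurable 0]
      simp
    have hS0 : ∫ ω, S n ω ^ 0 ∂P = 1 := by simp
    refine ⟨?_, ?_, ?_⟩
    · have e : ∀ ω, S (n + 1) ω = S n ω ^ 1 * q (Z n ω) ^ 0 + S n ω ^ 0 * q (Z n ω) ^ 1 :=
        fun ω => by rw [hsucc]; ring
      simp_rw [e]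
      rw [integral_add (hint n 1 0) (hint n 0 1), p, p, hS1, hμ1]
      ring
    · have e : ∀ ω, S (n + 1) ω ^ 2 = S n ω ^ 2 * q (Z n ω) ^ 0 + 2 * (S n ω ^ 1 * q (Z n ω) ^ 1)
          + S n ω ^ 0 * q (Z n ω) ^ 2 := fun ω => by rw [hsucc]; ring
      simp_rw [e]
      rw [integral_add ((hint n 2 0).fun_add ((hint n 1 1).const_mul 2)) (hint n 0 2),
        integral_add (hint n 2 0) ((hint n 1 1).const_mul 2), integral_const_mul, p, p, p, hS1,
        hμ0, hS0, ih2]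
      push_cast
      ring
    · have e : ∀ ω, S (n + 1) ω ^ 4 = S n ω ^ 4 * q (Z n ω) ^ 0 + 4 * (S n ω ^ 3 * q (Z n ω) ^ 1)
          + 6 * (S n ω ^ 2 * q (Z n ω) ^ 2) + 4 * (S n ω ^ 1 * q (Z n ω) ^ 3)
          + S n ω ^ 0 * q (Z n ω) ^ 4 := fun ω => by rw [hsucc]; ring
      have j1 := (hint n 4 0).fun_add ((hint n 3 1).const_mul 4)
      have j2 := j1.fun_add ((hint n 2 2).const_mul 6)
      have j3 := j2.fun_add ((hint n 1 3).const_mul 4)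
      simp_rw [e]
      rw [integral_add j3 (hint n 0 4), integral_add j2 ((hint n 1 3).const_mul 4),
        integral_add j1 ((hint n 2 2).const_mul 6),
        integral_add (hint n 4 0) ((hint n 3 1).const_mul 4), integral_const_mul,
        integral_const_mul, integral_const_mul, p, p, p, p, p, hS1, hμ1, hμ0, hS0, ih2, ← hv]
      push_cast
      nlinarith [sq_nonneg v]

variable (μ) in
/-- The deviation of the sample mean of `q` from its expectation under `μ`. -/
noncomputable def deviation (n : ℕ) (q : ℝ → ℝ) (z : ℕ → ℝ) : ℝ :=
  (1 / (n : ℝ)) * ∑ j ∈ Finset.range n, q (z j) - ∫ y, q y ∂μ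

theorem deviation_eq_sum {n : ℕ} (hn : 1 ≤ n) (q : ℝ → ℝ) (z : ℕ → ℝ) :
    deviation μ n q z = (1 / (n : ℝ)) * ∑ j ∈ Finset.range n, (q (z j) - ∫ y, q y ∂μ) := by
  have : (n : ℝ) ≠ 0 := by exact_mod_cast (by omega : n ≠ 0)
  rw [deviation, Finset.sum_sub_distrib, Finset.sum_const, Finset.card_range, nsmul_eq_mul]
  field_simp

theorem abs_integral_le_of_abs_le [IsProbabilityMeasure μ] {q : ℝ → ℝ} {b : ℝ}
    (hb : ∀ y, |q y| ≤ b) : |∫ y, q y ∂μ| ≤ b := by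
  simpa using norm_integral_le_of_norm_le_const (μ := μ) (f := q) (Eventually.of_forall hb)

theorem abs_deviation_le [IsProbabilityMeasure μ] {n : ℕ} (hn : 1 ≤ n) {q : ℝ → ℝ} {b : ℝ}
    (hb : ∀ y, |q y| ≤ b) (z : ℕ → ℝ) : |deviation μ n q z| ≤ 2 * b := by
  have hn' : (0 : ℝ) < n := by exact_mod_cast hn
  rw [deviation_eq_sum hn, abs_mul, abs_of_pos (by positivity), one_div, inv_mul_le_iff₀ hn']
  refine (Finset.abs_sum_le_sum_abs _ _).trans ?_
  refine (Finset.sum_le_sum (g := fun _ => 2 * b) fun j _ => ?_).trans (by simp)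
  have h1 := hb (z j)
  have h2 := abs_integral_le_of_abs_le (μ := μ) hb
  have h3 := abs_sub (q (z j)) (∫ y, q y ∂μ)
  linarith

theorem measurable_deviation (hZ : ∀ j, Measurable (Z j)) {q : ℝ → ℝ} (hq : Measurable q) (n : ℕ) :
    Measurable fun ω => deviation μ n q fun j => Z j ω := by
  unfold deviation
  fun_prop

/-- The variance of a sample mean, and a bound for its fourth central moment. -/
theorem moments_deviation [IsProbabilityMeasure P] (hZ : ∀ j, Measurable (Z j))
    (hind : iIndepFun Z P) (hlaw : ∀ j, P.map (Z j) = μ) {q : ℝ → ℝ} (hq : Measurable q) {b : ℝ}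
    (hb : ∀ y, |q y| ≤ b) {n : ℕ} (hn : 1 ≤ n) :
    ∫ ω, deviation μ n q (fun j => Z j ω) ^ 2 ∂P =
      (1 / n) * (∫ y, q y ^ 2 ∂μ - (∫ y, q y ∂μ) ^ 2) ∧
    ∫ ω, deviation μ n q (fun j => Z j ω) ^ 4 ∂P ≤
      (4 * b ^ 2 / n ^ 3) * ∫ y, q y ^ 2 ∂μ + 3 / n ^ 2 * (∫ y, q y ^ 2 ∂μ) ^ 2 := by
  have hn' : (0 : ℝ) < n := by exact_mod_cast hn
  have hprob : IsProbabilityMeasure μ := by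
    rw [← hlaw 0]
    exact Measure.isProbabilityMeasure_map (hZ 0).aemeasurable
  set m := ∫ y, q y ∂μ with hm
  have hi : ∀ k, Integrable (fun y => q y ^ k) μ := fun k =>
    Integrable.of_bound (hq.pow_const k).aestronglyMeasurable (b ^ k)
      (Eventually.of_forall fun y => by
        rw [Real.norm_eq_abs, abs_pow]
        have := hb y
        gcongr)
  have hi1 : Integrable q μ := by simpa using hi 1
  have hmb : |m| ≤ b := abs_integral_le_of_abs_le hb
  have hcb : ∀ y, |q y - m| ≤ 2 * b := fun y => by
    have := hb y
    have := abs_sub (q y) m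
    linarith
  have hc0 : ∫ y, (q y - m) ∂μ = 0 := by
    rw [integral_sub hi1 (integrable_const _)]
    simp [hm]
  obtain ⟨h2, h4⟩ := moments_sum_sample hZ hind hlaw (hq.sub_const m) hcb hc0 n
  have hv : ∫ y, (q y - m) ^ 2 ∂μ = ∫ y, q y ^ 2 ∂μ - m ^ 2 := by
    have e : ∀ y, (q y - m) ^ 2 = q y ^ 2 - 2 * m * q y + m ^ 2 := fun y => by ring
    simp_rw [e]
    have hsub : Integrable (fun y => q y ^ 2 - 2 * m * q y) μ := (hi 2).sub (hi1.const_mul _)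
    rw [integral_add hsub (integrable_const _),
      integral_sub (hi 2) (hi1.const_mul _), integral_const_mul, ← hm]
    simp
    ring
  have hvle : ∫ y, (q y - m) ^ 2 ∂μ ≤ ∫ y, q y ^ 2 ∂μ := by
    rw [hv]
    nlinarith [sq_nonneg m]
  have hv0 : 0 ≤ ∫ y, (q y - m) ^ 2 ∂μ := integral_nonneg fun y => sq_nonneg _
  simp_rw [deviation_eq_sum hn, ← hm, mul_pow]
  rw [integral_const_mul, integral_const_mul, h2, hv]
  constructor
  · field_simp
  · rw [hv] at h4 hvle hv0
    set A := ∫ y, q y ^ 2 ∂μ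
    calc (1 / (n : ℝ)) ^ 4 * ∫ ω, (∑ j ∈ Finset.range n, (q (Z j ω) - m)) ^ 4 ∂P
        ≤ (1 / (n : ℝ)) ^ 4 * (n * ((2 * b) ^ 2 * (A - m ^ 2)) + 3 * n ^ 2 * (A - m ^ 2) ^ 2) := by
          gcongr
      _ ≤ (1 / (n : ℝ)) ^ 4 * (n * ((2 * b) ^ 2 * A) + 3 * n ^ 2 * A ^ 2) := by
          gcongr
      _ = _ := by
          field_simp
          ring

/-- Hoeffding's inequality for the sample mean of a bounded function. -/
theorem measureReal_deviation_ge_le [IsProbabilityMeasure P] (hZ : ∀ j, Measurable (Z j))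
    (hind : iIndepFun Z P) (hlaw : ∀ j, P.map (Z j) = μ) {q : ℝ → ℝ} (hq : Measurable q) {b : ℝ}
    (hb0 : 0 < b) (hb : ∀ y, |q y| ≤ b) {n : ℕ} (hn : 1 ≤ n) {ε : ℝ} (hε : 0 ≤ ε) :
    P.real {ω | ε ≤ |deviation μ n q fun j => Z j ω|} ≤
      2 * Real.exp (-(ε ^ 2 / (2 * b ^ 2)) * n) := by
  have hn' : (0 : ℝ) < n := by exact_mod_cast hn
  have hmain : ∀ q : ℝ → ℝ, Measurable q → (∀ y, |q y| ≤ b) →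
      P.real {ω | ε ≤ deviation μ n q fun j => Z j ω} ≤
        Real.exp (-(ε ^ 2 / (2 * b ^ 2)) * n) := by
    intro q hq hb
    have hsub : ∀ i < n, HasSubgaussianMGF (fun ω => q (Z i ω) - ∫ y, q y ∂μ)
        ((‖b - -b‖₊ / 2) ^ 2) P := fun i _ => by
      have h := hasSubgaussianMGF_of_mem_Icc (X := fun ω => q (Z i ω)) (μ := P) (a := -b) (b := b)
        (hq.comp (hZ i)).aemeasurable (Eventually.of_forall fun ω => abs_le.1 (hb _))
      rwa [integral_comp_sample hZ hlaw hq.stronglyMeasurable] at h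
    have hindq : iIndepFun (fun i ω => q (Z i ω) - ∫ y, q y ∂μ) P :=
      hind.comp (fun _ y => q y - ∫ y, q y ∂μ) (fun _ => hq.sub_const _)
    have h := HasSubgaussianMGF.measure_sum_range_ge_le_of_iIndepFun hindq hsub
      (ε := n * ε) (by positivity)
    have hset : {ω | ε ≤ deviation μ n q fun j => Z j ω} =
        {ω | n * ε ≤ ∑ i ∈ Finset.range n, (q (Z i ω) - ∫ y, q y ∂μ)} := by
      ext ω
      simp only [Set.mem_ofPred_eq]
      rw [deviation_eq_sum hn, one_div, le_inv_mul_iff₀ hn']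
    rw [hset]
    refine h.trans_eq ?_
    congr 1
    have hb2 : (((‖b - -b‖₊ / 2) ^ 2 : NNReal) : ℝ) = b ^ 2 := by
      push_cast
      rw [sub_neg_eq_add, Real.norm_of_nonneg (by linarith)]
      ring
    rw [hb2]
    field_simp
  have hneg : ∀ z, deviation μ n (fun y => -q y) z = -deviation μ n q z := fun z => by
    simp only [deviation, Finset.sum_neg_distrib, integral_neg]
    ring
  have hset : {ω | ε ≤ |deviation μ n q fun j => Z j ω|} ⊆
      {ω | ε ≤ deviation μ n q fun j => Z j ω} ∪
        {ω | ε ≤ deviation μ n (fun y => -q y) fun j => Z j ω} := fun ω hω => by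
    rcases le_abs.1 (show ε ≤ |deviation μ n q fun j => Z j ω| from hω) with h | h
    · exact Or.inl h
    · refine Or.inr ?_
      change ε ≤ deviation μ n (fun y => -q y) _
      rw [hneg]
      exact h
  refine (measureReal_mono hset).trans ((measureReal_union_le _ _).trans ?_)
  have h1 := hmain q hq hb
  have h2 := hmain (fun y => -q y) hq.neg (fun y => by rw [abs_neg]; exact hb y)
  linarith

end Sample

/-! ### The empirical characteristic function -/

section Sample

variable {Ω : Type*} [MeasurableSpace Ω] {P : Measure Ω} {Z : ℕ → Ω → ℝ} {μ : Measure ℝ}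

theorem empCharFn_sub_re [IsProbabilityMeasure μ] (n : ℕ) (z : ℕ → ℝ) (t : ℝ) :
    (empCharFn n z t - charFun μ t).re = deviation μ n (fun y => Real.cos (t * y)) z := by
  have hint : Integrable (fun x : ℝ => Complex.exp (t * x * Complex.I)) μ :=
    Integrable.of_bound (by fun_prop) 1 (Eventually.of_forall fun x => by
      rw [← Complex.ofReal_mul, Complex.norm_exp_ofReal_mul_I])
  have h1 : (charFun μ t).re = ∫ y, Real.cos (t * y) ∂μ := by
    rw [charFun_apply_real, ← Complex.reCLM_apply, ← Complex.reCLM.integral_comp_comm hint]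
    refine integral_congr_ae (Eventually.of_forall fun y => ?_)
    simp only [Complex.reCLM_apply, ← Complex.ofReal_mul, Complex.exp_ofReal_mul_I_re]
  rw [Complex.sub_re, h1, deviation, empCharFn]
  congr 1
  have : (1 / (n : ℂ)) = ((1 / (n : ℝ) : ℝ) : ℂ) := by push_cast; rfl
  rw [this, Complex.re_ofReal_mul, Complex.re_sum]
  congr 1
  refine Finset.sum_congr rfl fun j _ => ?_
  have : Complex.I * t * z j = ((t * z j : ℝ) : ℂ) * Complex.I := by push_cast; ring
  rw [this, Complex.exp_ofReal_mul_I_re]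

theorem empCharFn_sub_im [IsProbabilityMeasure μ] (n : ℕ) (z : ℕ → ℝ) (t : ℝ) :
    (empCharFn n z t - charFun μ t).im = deviation μ n (fun y => Real.sin (t * y)) z := by
  have hint : Integrable (fun x : ℝ => Complex.exp (t * x * Complex.I)) μ :=
    Integrable.of_bound (by fun_prop) 1 (Eventually.of_forall fun x => by
      rw [← Complex.ofReal_mul, Complex.norm_exp_ofReal_mul_I])
  have h1 : (charFun μ t).im = ∫ y, Real.sin (t * y) ∂μ := by
    rw [charFun_apply_real, ← Complex.imCLM_apply, ← Complex.imCLM.integral_comp_comm hint]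
    refine integral_congr_ae (Eventually.of_forall fun y => ?_)
    simp only [Complex.imCLM_apply, ← Complex.ofReal_mul, Complex.exp_ofReal_mul_I_im]
  rw [Complex.sub_im, h1, deviation, empCharFn]
  congr 1
  have : (1 / (n : ℂ)) = ((1 / (n : ℝ) : ℝ) : ℂ) := by push_cast; rfl
  rw [this, Complex.im_ofReal_mul, Complex.im_sum]
  congr 1
  refine Finset.sum_congr rfl fun j _ => ?_
  have : Complex.I * t * z j = ((t * z j : ℝ) : ℂ) * Complex.I := by push_cast; ring
  rw [this, Complex.exp_ofReal_mul_I_im]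

theorem norm_empCharFn_sub_le_two [IsProbabilityMeasure μ] (n : ℕ) (z : ℕ → ℝ) (t : ℝ) :
    ‖empCharFn n z t - charFun μ t‖ ≤ 2 := by
  have h1 := norm_sub_le (empCharFn n z t) (charFun μ t)
  have h2 := norm_empCharFn_le_one n z t
  have h3 := norm_charFun_le_one (μ := μ) t
  linarith

theorem continuous_charFun_real [IsProbabilityMeasure μ] : Continuous (charFun μ) := by
  rw [funext (charFun_apply_real (μ := μ))]
  refine continuous_of_dominated (bound := fun _ => 1) (fun t => by fun_prop)
    (fun t => Eventually.of_forall fun x => ?_) (integrable_const _)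
    (Eventually.of_forall fun x => by fun_prop)
  rw [← Complex.ofReal_mul, Complex.norm_exp_ofReal_mul_I]

/-- The truncated modulus `min (s |y|) 2`, which bounds the increments of `t ↦ e^{ity}` over steps
of length `s`. Its boundedness makes moment conditions unnecessary. -/
noncomputable def stepModulus (s y : ℝ) : ℝ := min (s * |y|) 2

theorem abs_stepModulus_le {s : ℝ} (hs : 0 ≤ s) (y : ℝ) : |stepModulus s y| ≤ 2 := by
  rw [abs_of_nonneg (le_min (by positivity) (by norm_num))]
  exact min_le_right _ _

theorem measurable_stepModulus (s : ℝ) : Measurable (stepModulus s) := by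
  unfold stepModulus
  fun_prop

theorem norm_exp_sub_exp_le {s t u : ℝ} (h : |t - u| ≤ s) (y : ℝ) :
    ‖Complex.exp (Complex.I * t * y) - Complex.exp (Complex.I * u * y)‖ ≤ stepModulus s y := by
  refine le_min ?_ ?_
  · have e : Complex.exp (Complex.I * t * y) - Complex.exp (Complex.I * u * y) =
        Complex.exp (((u * y : ℝ) : ℂ) * Complex.I) *
          (Complex.exp (Complex.I * ((t - u) * y : ℝ)) - 1) := by
      rw [mul_sub, ← Complex.exp_add, mul_one]
      congr 1 <;> congr 1 <;> push_cast <;> ring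
    rw [e, norm_mul, Complex.norm_exp_ofReal_mul_I, one_mul]
    refine Real.norm_exp_I_mul_ofReal_sub_one_le.trans ?_
    rw [Real.norm_eq_abs, abs_mul]
    gcongr
  · have e : ∀ v : ℝ, ‖Complex.exp (Complex.I * v * y)‖ = 1 := fun v => by
      have : Complex.I * v * y = ((v * y : ℝ) : ℂ) * Complex.I := by push_cast; ring
      rw [this, Complex.norm_exp_ofReal_mul_I]
    refine (norm_sub_le _ _).trans ?_
    rw [e, e]
    norm_num

theorem norm_empCharFn_sub_empCharFn_le (n : ℕ) (z : ℕ → ℝ) {s t u : ℝ} (h : |t - u| ≤ s) :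
    ‖empCharFn n z t - empCharFn n z u‖ ≤
      (1 / (n : ℝ)) * ∑ j ∈ Finset.range n, stepModulus s (z j) := by
  rw [empCharFn, empCharFn, ← mul_sub, ← Finset.sum_sub_distrib, norm_mul]
  have : ‖(1 / (n : ℂ))‖ = 1 / (n : ℝ) := by simp
  rw [this]
  refine mul_le_mul_of_nonneg_left ?_ (by positivity)
  exact (norm_sum_le _ _).trans (Finset.sum_le_sum fun j _ => norm_exp_sub_exp_le h _)

theorem norm_charFun_sub_charFun_le [IsProbabilityMeasure μ] {s t u : ℝ} (hs : 0 ≤ s)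
    (h : |t - u| ≤ s) : ‖charFun μ t - charFun μ u‖ ≤ ∫ y, stepModulus s y ∂μ := by
  have hint : ∀ t : ℝ, Integrable (fun x : ℝ => Complex.exp (t * x * Complex.I)) μ := fun t =>
    Integrable.of_bound (by fun_prop) 1 (Eventually.of_forall fun x => by
      rw [← Complex.ofReal_mul, Complex.norm_exp_ofReal_mul_I])
  rw [charFun_apply_real, charFun_apply_real, ← integral_sub (hint t) (hint u)]
  refine norm_integral_le_of_norm_le (Integrable.of_bound
    (measurable_stepModulus s).aestronglyMeasurable 2
    (Eventually.of_forall (abs_stepModulus_le hs))) (Eventually.of_forall fun y => ?_)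
  have e : ∀ v : ℝ, (v : ℂ) * y * Complex.I = Complex.I * v * y := fun v => by ring
  rw [e, e]
  exact norm_exp_sub_exp_le h y

theorem exists_integral_stepModulus_le [IsProbabilityMeasure μ] {ε : ℝ} (hε : 0 < ε) :
    ∃ s, 0 < s ∧ ∫ y, stepModulus s y ∂μ ≤ ε := by
  have h : Tendsto (fun s => ∫ y, stepModulus s y ∂μ) (𝓝[>] 0) (𝓝 (∫ _, 0 ∂μ)) := by
    refine tendsto_integral_filter_of_dominated_convergence (fun _ => 2)
      (Eventually.of_forall fun s => (measurable_stepModulus s).aestronglyMeasurable) ?_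
      (integrable_const _) (Eventually.of_forall fun y => ?_)
    · filter_upwards [self_mem_nhdsWithin] with s hs
      exact Eventually.of_forall (abs_stepModulus_le (le_of_lt hs))
    · have hc : Continuous fun s : ℝ => stepModulus s y := by
        unfold stepModulus
        fun_prop
      have := hc.tendsto 0
      simp only [stepModulus, zero_mul] at this
      rw [min_eq_left (by norm_num)] at this
      exact this.mono_left nhdsWithin_le_nhds
  rw [integral_zero] at h
  obtain ⟨s, h1, h2⟩ := ((h.eventually (Iic_mem_nhds hε)).and self_mem_nhdsWithin).exists
  exact ⟨s, h2, h1⟩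

/-- The empirical characteristic function is uniformly close to the characteristic function on
`[-R, R]`, outside an event whose probability is at most linear in `R` and exponentially small in
`n`: Hoeffding's inequality at the points of a grid with fixed mesh, and for the step modulus in
between. -/
theorem exists_uniform_empCharFn_close [IsProbabilityMeasure P] (hZ : ∀ j, Measurable (Z j))
    (hind : iIndepFun Z P) (hlaw : ∀ j, P.map (Z j) = μ) {δ : ℝ} (hδ : 0 < δ) :
    ∃ K c : ℝ, 0 < c ∧ ∀ n : ℕ, 1 ≤ n → ∀ R : ℝ, 0 ≤ R → ∃ G : Set Ω, MeasurableSet G ∧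
      P.real Gᶜ ≤ K * (R + 1) * Real.exp (-c * n) ∧
      ∀ ω ∈ G, ∀ t, |t| ≤ R → ‖empCharFn n (fun j => Z j ω) t - charFun μ t‖ ≤ δ := by
  have hprob : IsProbabilityMeasure μ := by
    rw [← hlaw 0]
    exact Measure.isProbabilityMeasure_map (hZ 0).aemeasurable
  obtain ⟨s, hs, hsle⟩ := exists_integral_stepModulus_le (μ := μ) (ε := δ / 8) (by positivity)
  set c := (δ / 8) ^ 2 / (2 * 2 ^ 2) with hc
  refine ⟨2 + 4 * (2 / s + 5), c, by positivity, fun n hn R hR => ?_⟩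
  -- The grid points are `k * s` with `|k| ≤ m`; the extra `1` makes the grid cover `[-R, R]` when
  -- `t` is rounded down.
  set m : ℤ := ⌈R / s⌉ + 1 with hm
  set bad : (ℝ → ℝ) → Set Ω := fun q => {ω | δ / 8 ≤ |deviation μ n q fun j => Z j ω|} with hbad
  have hbadm : ∀ q, Measurable q → MeasurableSet (bad q) := fun q hq =>
    measurableSet_le measurable_const (measurable_deviation hZ hq n).abs
  have hbadP : ∀ q, Measurable q → (∀ y, |q y| ≤ 2) → P.real (bad q) ≤ 2 * Real.exp (-c * n) :=
    fun q hq hb => measureReal_deviation_ge_le hZ hind hlaw hq (by norm_num) hb hn (by positivity)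
  set qc : ℤ → ℝ → ℝ := fun k y => Real.cos (k * s * y) with hqc
  set qs : ℤ → ℝ → ℝ := fun k y => Real.sin (k * s * y) with hqs
  have hqcm : ∀ k, Measurable (qc k) := fun k => by simp only [hqc]; fun_prop
  have hqsm : ∀ k, Measurable (qs k) := fun k => by simp only [hqs]; fun_prop
  have hqcb : ∀ k y, |qc k y| ≤ 2 := fun k y => (Real.abs_cos_le_one _).trans (by norm_num)
  have hqsb : ∀ k y, |qs k y| ≤ 2 := fun k y => (Real.abs_sin_le_one _).trans (by norm_num)
  set B : Set Ω := bad (stepModulus s) ∪ ⋃ k ∈ Finset.Icc (-m) m, (bad (qc k) ∪ bad (qs k)) with hB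
  refine ⟨Bᶜ, ?_, ?_, ?_⟩
  · refine MeasurableSet.compl ((hbadm _ (measurable_stepModulus s)).union ?_)
    exact Finset.measurableSet_biUnion _ fun k _ => (hbadm _ (hqcm k)).union (hbadm _ (hqsm k))
  · rw [compl_compl]
    have hexp := Real.exp_pos (-c * n)
    have h1 : P.real (⋃ k ∈ Finset.Icc (-m) m, (bad (qc k) ∪ bad (qs k))) ≤
        (2 * (R / s + 2) + 1) * (4 * Real.exp (-c * n)) := by
      refine (measureReal_biUnion_finset_le _ _).trans ?_
      refine (Finset.sum_le_sum (g := fun _ => 4 * Real.exp (-c * n)) fun k _ => ?_).trans ?_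
      · refine (measureReal_union_le _ _).trans ?_
        have := hbadP _ (hqcm k) (hqcb k)
        have := hbadP _ (hqsm k) (hqsb k)
        linarith
      · rw [Finset.sum_const, nsmul_eq_mul]
        refine mul_le_mul_of_nonneg_right ?_ (by positivity)
        have hm0 : 0 ≤ m := by
          have : 0 ≤ ⌈R / s⌉ := Int.ceil_nonneg (by positivity)
          omega
        have hcard : ((Finset.Icc (-m) m).card : ℝ) = 2 * m + 1 := by
          rw [Int.card_Icc]
          have : ((m + 1 - -m).toNat : ℤ) = 2 * m + 1 := by omega
          exact_mod_cast this
        rw [hcard]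
        have : (m : ℝ) ≤ R / s + 2 := by
          rw [hm]
          push_cast
          have := (Int.ceil_lt_add_one (R / s)).le
          linarith
        linarith
    refine (measureReal_union_le _ _).trans ?_
    have h2 := hbadP _ (measurable_stepModulus s) (abs_stepModulus_le hs.le)
    have h4 : (2 * (R / s + 2) + 1) * (4 * Real.exp (-c * n)) ≤
        4 * (2 * (R / s) + 5) * Real.exp (-c * n) := by
      apply le_of_eq; ring
    have h5 : 2 + 4 * (2 * (R / s) + 5) ≤ (2 + 4 * (2 / s + 5)) * (R + 1) := by
      have : (2 + 4 * (2 / s + 5)) * (R + 1) = 4 * (2 * (R / s)) + 8 / s + 22 * R + 22 := by ring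
      rw [this]
      have : 0 < 8 / s := by positivity
      linarith
    calc P.real (bad (stepModulus s)) + P.real (⋃ k ∈ Finset.Icc (-m) m, (bad (qc k) ∪ bad (qs k)))
        ≤ (2 + 4 * (2 * (R / s) + 5)) * Real.exp (-c * n) := by linarith
      _ ≤ (2 + 4 * (2 / s + 5)) * (R + 1) * Real.exp (-c * n) := by gcongr
  · intro ω hω t ht
    rw [hB, Set.mem_compl_iff, Set.mem_union, not_or] at hω
    obtain ⟨hω1, hω2⟩ := hω
    have g1 : |deviation μ n (stepModulus s) fun j => Z j ω| < δ / 8 := not_le.1 hω1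
    -- Compare `t` with the grid point `k * s` on its left.
    set k : ℤ := ⌊t / s⌋ with hk
    have hkm : k ∈ Finset.Icc (-m) m := by
      have ht' := abs_le.1 ht
      rw [Finset.mem_Icc]
      have hR1 : R / s ≤ ⌈R / s⌉ := Int.le_ceil _
      have hup : t / s ≤ R / s := div_le_div_of_nonneg_right ht'.2 hs.le
      have hlo : -(R / s) ≤ t / s := by
        rw [← neg_div]
        exact div_le_div_of_nonneg_right ht'.1 hs.le
      have h1 : (k : ℝ) ≤ t / s := Int.floor_le _
      have h2 : t / s < k + 1 := Int.lt_floor_add_one _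
      constructor
      · have : (-m : ℝ) ≤ k := by
          rw [hm]; push_cast; linarith
        exact_mod_cast this
      · have : (k : ℝ) ≤ m := by
          rw [hm]; push_cast; linarith
        exact_mod_cast this
    have hω3 : ω ∉ bad (qc k) ∧ ω ∉ bad (qs k) := by
      simp only [Set.mem_iUnion, not_exists] at hω2
      simpa [not_or] using hω2 k hkm
    have g2 : |deviation μ n (qc k) fun j => Z j ω| < δ / 8 := not_le.1 hω3.1
    have g3 : |deviation μ n (qs k) fun j => Z j ω| < δ / 8 := not_le.1 hω3.2
    have htk : |t - k * s| ≤ s := by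
      have h1 : k * s ≤ t := (le_div_iff₀ hs).1 (Int.floor_le _)
      have h2 : t < (k + 1) * s := (div_lt_iff₀ hs).1 (Int.lt_floor_add_one _)
      rw [abs_of_nonneg (by linarith)]
      linarith
    have a1 := norm_empCharFn_sub_empCharFn_le n (fun j => Z j ω) htk
    have a2 := norm_charFun_sub_charFun_le (μ := μ) hs.le htk
    have a3 : ‖empCharFn n (fun j => Z j ω) (k * s) - charFun μ (k * s)‖ ≤ δ / 4 := by
      refine (Complex.norm_le_abs_re_add_abs_im _).trans ?_
      rw [empCharFn_sub_re, empCharFn_sub_im]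
      simp only [hqc, hqs] at g2 g3
      linarith
    have a4 : (1 / (n : ℝ)) * ∑ j ∈ Finset.range n, stepModulus s (Z j ω) ≤ δ / 4 := by
      have := (abs_lt.1 g1).2
      rw [deviation] at this
      linarith
    have e : empCharFn n (fun j => Z j ω) t - charFun μ t =
        (empCharFn n (fun j => Z j ω) t - empCharFn n (fun j => Z j ω) (k * s)) +
        (empCharFn n (fun j => Z j ω) (k * s) - charFun μ (k * s)) -
        (charFun μ t - charFun μ (k * s)) := by ring
    rw [e]
    refine (norm_sub_le _ _).trans ?_
    have := norm_add_le (empCharFn n (fun j => Z j ω) t - empCharFn n (fun j => Z j ω) (k * s))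
      (empCharFn n (fun j => Z j ω) (k * s) - charFun μ (k * s))
    linarith

/-- The real and the imaginary part are deviations of sample means of functions bounded by one, each
with fourth moment at most `(4 + 3) / n ^ 2`. -/
theorem integral_norm_empCharFn_sub_pow_four_le [IsProbabilityMeasure P]
    (hZ : ∀ j, Measurable (Z j)) (hind : iIndepFun Z P) (hlaw : ∀ j, P.map (Z j) = μ) {n : ℕ}
    (hn : 1 ≤ n) (t : ℝ) :
    ∫ ω, ‖empCharFn n (fun j => Z j ω) t - charFun μ t‖ ^ 4 ∂P ≤ 28 / n ^ 2 := by
  have hn1 : (1 : ℝ) ≤ n := by exact_mod_cast hn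
  have hprob : IsProbabilityMeasure μ := by
    rw [← hlaw 0]
    exact Measure.isProbabilityMeasure_map (hZ 0).aemeasurable
  have hbound : ∀ q : ℝ → ℝ, Measurable q → (∀ y, |q y| ≤ 1) →
      Integrable (fun ω => deviation μ n q (fun j => Z j ω) ^ 4) P ∧
      ∫ ω, deviation μ n q (fun j => Z j ω) ^ 4 ∂P ≤ 7 / n ^ 2 := by
    intro q hq hb
    refine ⟨?_, ?_⟩
    · refine Integrable.of_bound ((measurable_deviation hZ hq n).pow_const 4).aestronglyMeasurable
        (2 ^ 4) (Eventually.of_forall fun ω => ?_)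
      rw [Real.norm_eq_abs, abs_pow]
      have := abs_deviation_le (μ := μ) hn hb (fun j => Z j ω)
      gcongr
      linarith
    · refine (moments_deviation hZ hind hlaw hq hb hn).2.trans ?_
      have hv0 : 0 ≤ ∫ y, q y ^ 2 ∂μ := integral_nonneg fun y => sq_nonneg _
      have hv1 : ∫ y, q y ^ 2 ∂μ ≤ 1 := by
        refine (le_abs_self _).trans (abs_integral_le_of_abs_le fun y => ?_)
        rw [abs_pow]
        exact pow_le_one₀ (abs_nonneg _) (hb y)
      set v := ∫ y, q y ^ 2 ∂μ
      calc 4 * 1 ^ 2 / (n : ℝ) ^ 3 * v + 3 / (n : ℝ) ^ 2 * v ^ 2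
          ≤ 4 * 1 ^ 2 / (n : ℝ) ^ 2 * 1 + 3 / (n : ℝ) ^ 2 * 1 ^ 2 := by
            gcongr
            · norm_num
        _ = 7 / (n : ℝ) ^ 2 := by ring
  obtain ⟨i1, b1⟩ := hbound (fun y => Real.cos (t * y)) (by fun_prop)
    (fun y => Real.abs_cos_le_one _)
  obtain ⟨i2, b2⟩ := hbound (fun y => Real.sin (t * y)) (by fun_prop)
    (fun y => Real.abs_sin_le_one _)
  calc ∫ ω, ‖empCharFn n (fun j => Z j ω) t - charFun μ t‖ ^ 4 ∂P
      ≤ ∫ ω, (2 * deviation μ n (fun y => Real.cos (t * y)) (fun j => Z j ω) ^ 4 +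
          2 * deviation μ n (fun y => Real.sin (t * y)) (fun j => Z j ω) ^ 4) ∂P := by
        refine integral_mono_of_nonneg (Eventually.of_forall fun ω => by positivity)
          ((i1.const_mul 2).add (i2.const_mul 2)) (Eventually.of_forall fun ω => ?_)
        have e : ‖empCharFn n (fun j => Z j ω) t - charFun μ t‖ ^ 4 =
            (‖empCharFn n (fun j => Z j ω) t - charFun μ t‖ ^ 2) ^ 2 := by ring
        simp only
        rw [e, ← Complex.normSq_eq_norm_sq, Complex.normSq_apply, empCharFn_sub_re,
          empCharFn_sub_im]
        set a := deviation μ n (fun y => Real.cos (t * y)) fun j => Z j ω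
        set b := deviation μ n (fun y => Real.sin (t * y)) fun j => Z j ω
        nlinarith [sq_nonneg (a ^ 2 - b ^ 2)]
    _ ≤ 28 / n ^ 2 := by
        rw [integral_add (i1.const_mul 2) (i2.const_mul 2), integral_const_mul, integral_const_mul]
        have : (28 : ℝ) / n ^ 2 = 2 * (7 / n ^ 2) + 2 * (7 / n ^ 2) := by ring
        linarith

variable (μ) in
/-- The integrated squared error of the empirical characteristic function over `[-R, R]`, which
dominates the remainder of the expansion of the logarithm. -/
noncomputable def squaredError (n : ℕ) (R : ℝ) (z : ℕ → ℝ) : ℝ :=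
  ∫ t in Set.Icc (-R) R, ‖empCharFn n z t - charFun μ t‖ ^ 2

theorem continuous_empCharFn (n : ℕ) (z : ℕ → ℝ) : Continuous (empCharFn n z) := by
  unfold empCharFn
  fun_prop

theorem measurable_empCharFn_uncurry (hZ : ∀ j, Measurable (Z j)) (n : ℕ) :
    Measurable fun p : Ω × ℝ => empCharFn n (fun j => Z j p.1) p.2 := by
  unfold empCharFn
  fun_prop

theorem measurable_squaredError [IsProbabilityMeasure μ] (hZ : ∀ j, Measurable (Z j)) (n : ℕ)
    (R : ℝ) : Measurable fun ω => squaredError μ n R fun j => Z j ω := by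
  have h : StronglyMeasurable fun p : Ω × ℝ =>
      ‖empCharFn n (fun j => Z j p.1) p.2 - charFun μ p.2‖ ^ 2 :=
    (((measurable_empCharFn_uncurry hZ n).sub
      (continuous_charFun_real.measurable.comp measurable_snd)).norm.pow_const 2).stronglyMeasurable
  exact (h.integral_prod_right (ν := volume.restrict (Set.Icc (-R) R))).measurable

/-- The Cauchy-Schwarz inequality against the constant function on `[-R, R]`. -/
theorem sq_setIntegral_le {R : ℝ} (hR : 0 < R) {F : ℝ → ℝ} (hF : Continuous F) :
    (∫ t in Set.Icc (-R) R, F t) ^ 2 ≤ 2 * R * ∫ t in Set.Icc (-R) R, F t ^ 2 := by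
  set I := ∫ t in Set.Icc (-R) R, F t with hI
  have i1 : IntegrableOn F (Set.Icc (-R) R) := hF.continuousOn.integrableOn_Icc
  have i2 : IntegrableOn (fun t => F t ^ 2) (Set.Icc (-R) R) :=
    (hF.pow 2).continuousOn.integrableOn_Icc
  have h : 0 ≤ ∫ t in Set.Icc (-R) R, (F t - I / (2 * R)) ^ 2 :=
    integral_nonneg fun t => sq_nonneg _
  have e : ∀ t, (F t - I / (2 * R)) ^ 2 = F t ^ 2 - 2 * (I / (2 * R)) * F t + (I / (2 * R)) ^ 2 :=
    fun t => by ring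
  simp_rw [e] at h
  have i3 : IntegrableOn (fun t => F t ^ 2 - 2 * (I / (2 * R)) * F t) (Set.Icc (-R) R) :=
    i2.sub (i1.const_mul _)
  have hconst : ∫ _ in Set.Icc (-R) R, (I / (2 * R)) ^ 2 = 2 * R * (I / (2 * R)) ^ 2 := by
    rw [setIntegral_const, measureReal_def, Real.volume_Icc, ENNReal.toReal_ofReal (by linarith),
      smul_eq_mul]
    ring
  rw [integral_add i3 (integrable_const _), integral_sub i2 (i1.const_mul _), integral_const_mul,
    hconst, ← hI] at h
  have e2 : (∫ t in Set.Icc (-R) R, F t ^ 2) - 2 * (I / (2 * R)) * I + 2 * R * (I / (2 * R)) ^ 2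
      = (∫ t in Set.Icc (-R) R, F t ^ 2) - I ^ 2 / (2 * R) := by
    field_simp
    ring
  rw [e2, sub_nonneg, div_le_iff₀ (by positivity)] at h
  linarith

/-- The integrated squared error over `[-R, R]` is of order `R / n` in mean square. -/
theorem integral_squaredError_sq_le [IsProbabilityMeasure P]
    (hZ : ∀ j, Measurable (Z j)) (hind : iIndepFun Z P) (hlaw : ∀ j, P.map (Z j) = μ) {n : ℕ}
    (hn : 1 ≤ n) {R : ℝ} (hR : 0 < R) :
    Integrable (fun ω => squaredError μ n R (fun j => Z j ω) ^ 2) P ∧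
    ∫ ω, squaredError μ n R (fun j => Z j ω) ^ 2 ∂P ≤ 112 * (R / n) ^ 2 := by
  have hprob : IsProbabilityMeasure μ := by
    rw [← hlaw 0]
    exact Measure.isProbabilityMeasure_map (hZ 0).aemeasurable
  set F : Ω → ℝ → ℝ := fun ω t => ‖empCharFn n (fun j => Z j ω) t - charFun μ t‖ with hF
  have hFc : ∀ ω, Continuous (F ω) := fun ω =>
    ((continuous_empCharFn n _).sub continuous_charFun_real).norm
  have hFm : Measurable fun p : Ω × ℝ => F p.1 p.2 ^ 4 :=
    ((measurable_empCharFn_uncurry hZ n).sub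
      (continuous_charFun_real.measurable.comp measurable_snd)).norm.pow_const 4
  have hFb : ∀ ω t, ‖F ω t ^ 4‖ ≤ 2 ^ 4 := fun ω t => by
    rw [Real.norm_eq_abs, abs_pow]
    simp only [hF, abs_norm]
    have := norm_empCharFn_sub_le_two (μ := μ) n (fun j => Z j ω) t
    gcongr
  have hFi : Integrable (fun p : Ω × ℝ => F p.1 p.2 ^ 4)
      (P.prod (volume.restrict (Set.Icc (-R) R))) :=
    Integrable.of_bound hFm.aestronglyMeasurable (2 ^ 4) (Eventually.of_forall fun p => hFb _ _)
  have hle : ∀ ω, squaredError μ n R (fun j => Z j ω) ^ 2 ≤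
      2 * R * ∫ t in Set.Icc (-R) R, F ω t ^ 4 := fun ω => by
    have := sq_setIntegral_le hR (F := fun t => F ω t ^ 2) ((hFc ω).pow 2)
    have e : ∀ t, (F ω t ^ 2) ^ 2 = F ω t ^ 4 := fun t => by ring
    simp_rw [e] at this
    exact this
  have hi2 : Integrable (fun ω => 2 * R * ∫ t in Set.Icc (-R) R, F ω t ^ 4) P :=
    hFi.integral_prod_left.const_mul _
  have hi1 : Integrable (fun ω => squaredError μ n R (fun j => Z j ω) ^ 2) P := by
    refine hi2.mono ((measurable_squaredError hZ n R).pow_const 2).aestronglyMeasurable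
      (Eventually.of_forall fun ω => ?_)
    rw [Real.norm_of_nonneg (sq_nonneg _)]
    exact (hle ω).trans (le_abs_self _)
  refine ⟨hi1, (integral_mono hi1 hi2 hle).trans ?_⟩
  rw [integral_const_mul, integral_integral_swap hFi]
  have h4 : ∫ t in Set.Icc (-R) R, ∫ ω, F ω t ^ 4 ∂P ≤ ∫ _ in Set.Icc (-R) R, 28 / (n : ℝ) ^ 2 :=
    integral_mono hFi.integral_prod_right (integrable_const _)
      fun t => integral_norm_empCharFn_sub_pow_four_le hZ hind hlaw hn t
  rw [setIntegral_const, measureReal_def, Real.volume_Icc, ENNReal.toReal_ofReal (by linarith),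
    smul_eq_mul] at h4
  calc 2 * R * ∫ t in Set.Icc (-R) R, ∫ ω, F ω t ^ 4 ∂P
      ≤ 2 * R * ((R - -R) * (28 / (n : ℝ) ^ 2)) := by gcongr
    _ = 112 * (R / n) ^ 2 := by ring

end Sample

/-! ### Expansion of the estimator around the mean path -/

/-- What the expansion uses of the model: a kernel `w` with compactly supported characteristic
function, a jump density `f` with integrable characteristic function, and the law `μ` of the nonzero
observations, linked to `f` by the compound Poisson formula. -/
structure CompoundSetting (lam : ℝ) (f w : ℝ → ℝ) (μ : Measure ℝ) : Prop where
  lam_pos : 0 < lam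
  integrable_w : Integrable w
  integral_w : ∫ u, w u = 1
  charFn_w_eq_zero : ∀ s, 1 < |s| → charFn w s = 0
  integrable_f : Integrable f
  integrable_charFn_f : Integrable (charFn f)
  norm_charFn_f_le : ∀ t, ‖charFn f t‖ ≤ 1
  charFn_f_zero : charFn f 0 = 1
  norm_charFun_le : ∀ t, ‖charFun μ t‖ ≤ ‖charFn f t‖
  compound : ∀ t, ((Real.exp lam - 1 : ℝ) : ℂ) * charFun μ t + 1 = Complex.exp (lam * charFn f t)

/-- The path of the estimator with the empirical characteristic function replaced by its mean. -/
noncomputable def meanPath (lam : ℝ) (w : ℝ → ℝ) (μ : Measure ℝ) (h t : ℝ) : ℂ :=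
  ((Real.exp lam - 1 : ℝ) : ℂ) * charFun μ t * charFn w (h * t) + 1

/-- The bandwidth is positive and so small that smoothing moves the path `e^{λ φ_f}` by at most half
of its modulus. -/
structure SmallBandwidth (lam : ℝ) (f w : ℝ → ℝ) (μ : Measure ℝ) (h : ℝ) : Prop where
  pos : 0 < h
  close : ∀ t, ‖((Real.exp lam - 1 : ℝ) : ℂ) * charFun μ t * (charFn w (h * t) - 1)‖ ≤
    1 / 2 * ‖Complex.exp (lam * charFn f t)‖

/-- A continuous logarithm of the mean path: that of `e^{λ φ_f}` corrected by the principal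
logarithm of the quotient. -/
noncomputable def meanLog (lam : ℝ) (f w : ℝ → ℝ) (μ : Measure ℝ) (h t : ℝ) : ℂ :=
  lam * charFn f t + Complex.log (1 + ((Real.exp lam - 1 : ℝ) : ℂ) * charFun μ t *
    (charFn w (h * t) - 1) / Complex.exp (lam * charFn f t))

section Expansion

variable {lam : ℝ} {f w : ℝ → ℝ} {μ : Measure ℝ} {h : ℝ}

theorem CompoundSetting.exp_sub_one_pos (hs : CompoundSetting lam f w μ) :
    0 < Real.exp lam - 1 := by
  have := Real.add_one_lt_exp hs.lam_pos.ne'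
  have := hs.lam_pos
  linarith

theorem CompoundSetting.norm_exp_sub_one (hs : CompoundSetting lam f w μ) :
    ‖((Real.exp lam - 1 : ℝ) : ℂ)‖ = Real.exp lam - 1 := by
  rw [Complex.norm_real, Real.norm_of_nonneg hs.exp_sub_one_pos.le]

theorem CompoundSetting.le_norm_exp (hs : CompoundSetting lam f w μ) (t : ℝ) :
    Real.exp (-lam) ≤ ‖Complex.exp (lam * charFn f t)‖ := by
  rw [Complex.norm_exp, Complex.re_ofReal_mul]
  refine Real.exp_le_exp.2 ?_
  have h1 := (abs_le.1 ((Complex.abs_re_le_norm _).trans (hs.norm_charFn_f_le t))).1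
  nlinarith [hs.lam_pos]

theorem CompoundSetting.continuous_charFn_w (hs : CompoundSetting lam f w μ) :
    Continuous (charFn w) := continuous_charFn hs.integrable_w

/-- Small bandwidths move the path uniformly little, because `|φ_μ| ≤ |φ_f|` vanishes at
infinity. -/
theorem CompoundSetting.eventually_smallBandwidth (hs : CompoundSetting lam f w μ) {h : ℕ → ℝ}
    (hpos : ∀ᶠ n in atTop, 0 < h n) (hh : Tendsto h atTop (𝓝 0)) :
    ∀ᶠ n in atTop, SmallBandwidth lam f w μ (h n) := by
  set W := ∫ u, |w u| with hW
  have hW0 : 0 ≤ W := integral_nonneg fun u => abs_nonneg _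
  set a := Real.exp lam - 1 with ha
  have ha0 : 0 < a := hs.exp_sub_one_pos
  set ε := Real.exp (-lam) / (2 * a * (W + 1)) with hε
  have hε0 : 0 < ε := by positivity
  have hwc := hs.continuous_charFn_w
  have hw0 : charFn w 0 = 1 := by rw [charFn_zero, hs.integral_w, Complex.ofReal_one]
  -- `φ_f` is small outside a compact set, and `φ_w (h t)` is close to `1` on it.
  obtain ⟨K, hK, hKf⟩ := (hasBasis_cocompact.eventually_iff).1
    ((tendsto_charFn_cocompact f).norm.eventually (Iio_mem_nhds (by simpa using hε0)))
  have hcl : ∀ᶠ x in 𝓝 (0 : ℝ), ∀ t ∈ K, ‖charFn w (x * t) - 1‖ < ε * (W + 1) := by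
    refine hK.eventually_forall_of_forall_eventually fun t _ => ?_
    have hc : Continuous fun p : ℝ × ℝ => ‖charFn w (p.1 * p.2) - 1‖ := by fun_prop
    refine hc.continuousAt.eventually_lt continuousAt_const ?_
    simpa [hw0] using by positivity
  filter_upwards [hpos, hh.eventually hcl] with n hn hcn
  refine ⟨hn, fun t => ?_⟩
  have key : ‖charFun μ t‖ * ‖charFn w (h n * t) - 1‖ ≤ ε * (W + 1) := by
    by_cases ht : t ∈ K
    · have h1 := (hs.norm_charFun_le t).trans (hs.norm_charFn_f_le t)
      have h2 := (hcn t ht).le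
      calc _ ≤ 1 * (ε * (W + 1)) := by gcongr
        _ = _ := one_mul _
    · have h1 := (hs.norm_charFun_le t).trans (hKf ht : ‖charFn f t‖ < ε).le
      have h2 : ‖charFn w (h n * t) - 1‖ ≤ W + 1 :=
        (norm_sub_le _ _).trans (by simpa using norm_charFn_le w (h n * t))
      gcongr
  rw [norm_mul, norm_mul, hs.norm_exp_sub_one, mul_assoc]
  calc a * (‖charFun μ t‖ * ‖charFn w (h n * t) - 1‖) ≤ a * (ε * (W + 1)) := by gcongr
    _ = 1 / 2 * Real.exp (-lam) := by rw [hε]; field_simp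
    _ ≤ _ := by gcongr; exact hs.le_norm_exp t

theorem meanPath_eq (hs : CompoundSetting lam f w μ) (h t : ℝ) :
    meanPath lam w μ h t = Complex.exp (lam * charFn f t) +
      ((Real.exp lam - 1 : ℝ) : ℂ) * charFun μ t * (charFn w (h * t) - 1) := by
  rw [← hs.compound, meanPath]
  ring

theorem SmallBandwidth.norm_quotient_le (hh : SmallBandwidth lam f w μ h) (t : ℝ) :
    ‖((Real.exp lam - 1 : ℝ) : ℂ) * charFun μ t * (charFn w (h * t) - 1) /
      Complex.exp (lam * charFn f t)‖ ≤ 1 / 2 := by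
  rw [norm_div, div_le_iff₀ (norm_pos_iff.2 (Complex.exp_ne_zero _))]
  exact hh.close t

theorem SmallBandwidth.le_norm_meanPath (hs : CompoundSetting lam f w μ)
    (hh : SmallBandwidth lam f w μ h) (t : ℝ) :
    Real.exp (-lam) / 2 ≤ ‖meanPath lam w μ h t‖ := by
  rw [meanPath_eq hs]
  have h1 := hh.close t
  have h2 := hs.le_norm_exp t
  have h3 := norm_sub_le_norm_add (Complex.exp (lam * charFn f t))
    (((Real.exp lam - 1 : ℝ) : ℂ) * charFun μ t * (charFn w (h * t) - 1))
  linarith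

theorem SmallBandwidth.meanPath_ne_zero (hs : CompoundSetting lam f w μ)
    (hh : SmallBandwidth lam f w μ h) (t : ℝ) : meanPath lam w μ h t ≠ 0 := by
  rw [← norm_pos_iff]
  exact lt_of_lt_of_le (by positivity) (hh.le_norm_meanPath hs t)

theorem continuous_meanPath [IsProbabilityMeasure μ] (hs : CompoundSetting lam f w μ) (h : ℝ) :
    Continuous (meanPath lam w μ h) := by
  have h1 := hs.continuous_charFn_w
  have h2 := continuous_charFun_real (μ := μ)
  unfold meanPath
  fun_prop

theorem continuous_meanLog [IsProbabilityMeasure μ] (hs : CompoundSetting lam f w μ)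
    (hh : SmallBandwidth lam f w μ h) : Continuous (meanLog lam f w μ h) := by
  have h1 := hs.continuous_charFn_w
  have h2 := continuous_charFun_real (μ := μ)
  have h3 := continuous_charFn hs.integrable_f
  unfold meanLog
  refine Continuous.add (by fun_prop) (Continuous.clog ?_ fun t => ?_)
  · exact continuous_const.add (Continuous.div (by fun_prop) (by fun_prop)
      fun t => Complex.exp_ne_zero _)
  · exact Complex.mem_slitPlane_of_norm_lt_one ((hh.norm_quotient_le t).trans_lt (by norm_num))

theorem exp_meanLog (hs : CompoundSetting lam f w μ) (hh : SmallBandwidth lam f w μ h) (t : ℝ) :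
    Complex.exp (meanLog lam f w μ h t) = meanPath lam w μ h t := by
  have h1 := Complex.exp_ne_zero (lam * charFn f t)
  have h2 : 1 + ((Real.exp lam - 1 : ℝ) : ℂ) * charFun μ t * (charFn w (h * t) - 1) /
      Complex.exp (lam * charFn f t) = meanPath lam w μ h t / Complex.exp (lam * charFn f t) := by
    rw [meanPath_eq hs]
    field_simp
  rw [meanLog, Complex.exp_add, h2,
    Complex.exp_log (div_ne_zero (hh.meanPath_ne_zero hs t) h1), mul_div_cancel₀ _ h1]

theorem charFun_zero_eq_one [IsProbabilityMeasure μ] : charFun μ (0 : ℝ) = 1 := by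
  rw [charFun_zero]
  simp

theorem meanLog_zero (hs : CompoundSetting lam f w μ) : meanLog lam f w μ h 0 = lam := by
  have hw0 : charFn w 0 = 1 := by rw [charFn_zero, hs.integral_w, Complex.ofReal_one]
  simp [meanLog, hs.charFn_f_zero, hw0]

theorem meanPath_zero [IsProbabilityMeasure μ] (hs : CompoundSetting lam f w μ) :
    meanPath lam w μ h 0 = (Real.exp lam : ℝ) := by
  have hw0 : charFn w 0 = 1 := by rw [charFn_zero, hs.integral_w, Complex.ofReal_one]
  rw [meanPath, charFun_zero_eq_one, mul_zero, hw0]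
  push_cast
  ring

/-- The bound by `|φ_f|` is integrable over the whole line, whatever the bandwidth. -/
theorem norm_meanLog_le (hs : CompoundSetting lam f w μ) (hh : SmallBandwidth lam f w μ h) (t : ℝ) :
    ‖meanLog lam f w μ h t‖ ≤
      (lam + 3 / 2 * ((Real.exp lam - 1) * ((∫ u, |w u|) + 1) * Real.exp lam))
      * ‖charFn f t‖ := by
  have ha0 := hs.exp_sub_one_pos
  have hl0 := hs.lam_pos
  refine (norm_add_le _ _).trans ?_
  rw [add_mul, norm_mul, Complex.norm_real, Real.norm_of_nonneg hs.lam_pos.le]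
  refine add_le_add le_rfl ?_
  refine (Complex.norm_log_one_add_half_le_self (hh.norm_quotient_le t)).trans ?_
  rw [mul_assoc (3 / 2)]
  refine mul_le_mul_of_nonneg_left ?_ (by norm_num)
  rw [norm_div, norm_mul, norm_mul, hs.norm_exp_sub_one]
  have h1 := hs.norm_charFun_le t
  have h2 : ‖charFn w (h * t) - 1‖ ≤ (∫ u, |w u|) + 1 :=
    (norm_sub_le _ _).trans (by simpa using norm_charFn_le w (h * t))
  have h3 := hs.le_norm_exp t
  have hW0 : 0 ≤ ∫ u, |w u| := integral_nonneg fun u => abs_nonneg _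
  rw [div_le_iff₀ (norm_pos_iff.2 (Complex.exp_ne_zero _))]
  have e1 : Real.exp lam * Real.exp (-lam) = 1 := by rw [← Real.exp_add]; simp
  calc (Real.exp lam - 1) * ‖charFun μ t‖ * ‖charFn w (h * t) - 1‖
      ≤ (Real.exp lam - 1) * ‖charFn f t‖ * ((∫ u, |w u|) + 1) := by gcongr
    _ = (Real.exp lam - 1) * ((∫ u, |w u|) + 1) * Real.exp lam * ‖charFn f t‖ *
          Real.exp (-lam) := by
        linear_combination (-(Real.exp lam - 1) * ‖charFn f t‖ * ((∫ u, |w u|) + 1)) * e1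
    _ ≤ _ := by
        refine mul_le_mul_of_nonneg_left h3 ?_
        positivity

/-- The deterministic centre of the estimator. -/
noncomputable def center (lam : ℝ) (f w : ℝ → ℝ) (μ : Measure ℝ) (h x : ℝ) : ℝ :=
  1 / (2 * Real.pi * lam) * (∫ t in (-(1 / h))..(1 / h),
    Complex.exp (-(Complex.I * t * x)) * meanLog lam f w μ h t).re

theorem exists_abs_center_le [IsProbabilityMeasure μ] (hs : CompoundSetting lam f w μ) :
    ∃ C, ∀ h x, SmallBandwidth lam f w μ h → |center lam f w μ h x| ≤ C := by
  have hl0 := hs.lam_pos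
  set D := lam + 3 / 2 * ((Real.exp lam - 1) * ((∫ u, |w u|) + 1) * Real.exp lam) with hD
  refine ⟨1 / (2 * Real.pi * lam) * ∫ t, D * ‖charFn f t‖, fun h x hh => ?_⟩
  have hh0 := hh.pos
  rw [center, abs_mul, abs_of_pos (by positivity)]
  refine mul_le_mul_of_nonneg_left ((Complex.abs_re_le_norm _).trans ?_) (by positivity)
  have hle : -(1 / h) ≤ 1 / h := by
    have : 0 < 1 / h := by positivity
    linarith
  have hint : Integrable fun t => D * ‖charFn f t‖ := hs.integrable_charFn_f.norm.const_mul D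
  refine (intervalIntegral.norm_integral_le_of_norm_le hle (g := fun t => D * ‖charFn f t‖)
    (Eventually.of_forall fun t _ => ?_) hint.intervalIntegrable).trans ?_
  · rw [norm_mul, norm_exp_neg_I_mul, one_mul]
    exact norm_meanLog_le hs hh t
  · rw [intervalIntegral.integral_of_le hle]
    refine setIntegral_le_integral hint (Eventually.of_forall fun t => ?_)
    exact (norm_nonneg _).trans (norm_meanLog_le hs hh t)

/-- The relative deviation of the path of a sample from the mean path. -/
noncomputable def relDev (lam : ℝ) (w : ℝ → ℝ) (μ : Measure ℝ) (h : ℝ) (n : ℕ) (z : ℕ → ℝ) (t : ℝ) :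
    ℂ :=
  ((Real.exp lam - 1 : ℝ) : ℂ) * (empCharFn n z t - charFun μ t) * charFn w (h * t) /
    meanPath lam w μ h t

theorem continuous_relDev [IsProbabilityMeasure μ] (hs : CompoundSetting lam f w μ)
    (hh : SmallBandwidth lam f w μ h) (n : ℕ) (z : ℕ → ℝ) :
    Continuous (relDev lam w μ h n z) := by
  have h1 := hs.continuous_charFn_w
  have h2 := continuous_charFun_real (μ := μ)
  have h3 := continuous_meanPath hs h
  have h4 := continuous_empCharFn n z
  unfold relDev
  exact Continuous.div (by fun_prop) h3 fun t => hh.meanPath_ne_zero hs t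

theorem norm_relDev_le (hs : CompoundSetting lam f w μ)
    (hh : SmallBandwidth lam f w μ h) (n : ℕ) (z : ℕ → ℝ) (t : ℝ) :
    ‖relDev lam w μ h n z t‖ ≤ 2 * (Real.exp lam - 1) * (∫ u, |w u|) * Real.exp lam *
      ‖empCharFn n z t - charFun μ t‖ := by
  have ha0 := hs.exp_sub_one_pos
  rw [relDev, norm_div, norm_mul, norm_mul, hs.norm_exp_sub_one,
    div_le_iff₀ (norm_pos_iff.2 (hh.meanPath_ne_zero hs t))]
  have h3 := hh.le_norm_meanPath hs t
  have h4 := norm_charFn_le w (h * t)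
  have hW0 : 0 ≤ ∫ u, |w u| := integral_nonneg fun u => abs_nonneg _
  have e1 : Real.exp lam * Real.exp (-lam) = 1 := by rw [← Real.exp_add]; simp
  calc (Real.exp lam - 1) * ‖empCharFn n z t - charFun μ t‖ * ‖charFn w (h * t)‖
      ≤ (Real.exp lam - 1) * ‖empCharFn n z t - charFun μ t‖ * ∫ u, |w u| := by gcongr
    _ = 2 * (Real.exp lam - 1) * (∫ u, |w u|) * Real.exp lam *
      ‖empCharFn n z t - charFun μ t‖ * (Real.exp (-lam) / 2) := by
        linear_combination (-(Real.exp lam - 1) * ‖empCharFn n z t - charFun μ t‖ *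
          (∫ u, |w u|)) * e1
    _ ≤ _ := by
        refine mul_le_mul_of_nonneg_left h3 ?_
        positivity

/-- The part of the estimator that is linear in the empirical characteristic function. -/
noncomputable def linearPart (lam : ℝ) (w : ℝ → ℝ) (μ : Measure ℝ) (h : ℝ) (n : ℕ) (z : ℕ → ℝ)
    (x : ℝ) : ℝ :=
  1 / (2 * Real.pi * lam) * (∫ t in (-(1 / h))..(1 / h),
    Complex.exp (-(Complex.I * t * x)) * relDev lam w μ h n z t).re

/-- On samples whose empirical characteristic function is uniformly close to its mean, the estimator
is its centre plus the linear part, up to the integrated squared error. -/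
theorem exists_abs_fRaw_sub_le [IsProbabilityMeasure μ] (hs : CompoundSetting lam f w μ) :
    ∃ δ C : ℝ, 0 < δ ∧ 0 ≤ C ∧ ∀ h x, SmallBandwidth lam f w μ h → ∀ n : ℕ, 1 ≤ n → ∀ z : ℕ → ℝ,
      (∀ t, |t| ≤ 1 / h → ‖empCharFn n z t - charFun μ t‖ ≤ δ) →
      |fRaw lam w h n z x - center lam f w μ h x - linearPart lam w μ h n z x| ≤
        C * squaredError μ n (1 / h) z := by
  classical
  have ha0 := hs.exp_sub_one_pos
  have hl0 := hs.lam_pos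
  have hW0 : 0 ≤ ∫ u, |w u| := integral_nonneg fun u => abs_nonneg _
  set D := 2 * (Real.exp lam - 1) * (∫ u, |w u|) * Real.exp lam with hD
  have hD0 : 0 ≤ D := by positivity
  refine ⟨1 / (2 * (D + 1)), 1 / (2 * Real.pi * lam) * D ^ 2, by positivity, by positivity,
    fun h x hh n hn z hz => ?_⟩
  have hh0 := hh.pos
  have hle : -(1 / h) ≤ 1 / h := by
    have : 0 < 1 / h := by positivity
    linarith
  -- The choice of `δ` makes the relative deviation at most `1 / 2`: on `[-1 / h, 1 / h]` by
  -- assumption, and outside because `φ_w` vanishes there.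
  have hpm : ∀ t, path lam w h n z t - meanPath lam w μ h t =
      relDev lam w μ h n z t * meanPath lam w μ h t := fun t => by
    rw [relDev, div_mul_cancel₀ _ (hh.meanPath_ne_zero hs t), path, meanPath]
    ring
  have hrel : ∀ t, ‖relDev lam w μ h n z t‖ ≤ 1 / 2 := fun t => by
    by_cases ht : t ∈ Set.Icc (-(1 / h)) (1 / h)
    · refine (norm_relDev_le hs hh n z t).trans ?_
      rw [← hD]
      calc D * ‖empCharFn n z t - charFun μ t‖ ≤ D * (1 / (2 * (D + 1))) := by
            gcongr
            exact hz t (abs_le.2 ht)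
        _ = 1 / 2 * (D / (D + 1)) := by field_simp
        _ ≤ 1 / 2 * 1 := by
            gcongr
            rw [div_le_one (by positivity)]
            linarith
        _ = 1 / 2 := by norm_num
    · rw [relDev, charFn_mul_eq_zero hs.charFn_w_eq_zero hh0 ht]
      simp
  obtain ⟨hne, hlog⟩ := distinguishedLog_perturb (ψ := path lam w h n z)
    (continuous_path lam hs.integrable_w h n z) (continuous_meanPath hs h)
    (continuous_meanLog hs hh) (exp_meanLog hs hh)
    (by rw [meanLog_zero hs, meanPath_zero hs, ← Complex.ofReal_log (Real.exp_pos _).le,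
      Real.log_exp])
    (by rw [path_zero hs.integral_w h hn, meanPath_zero hs])
    (fun t => by
      rw [hpm, norm_mul]
      exact mul_le_mul_of_nonneg_right (hrel t) (norm_nonneg _))
  have hlog' : distinguishedLog (path lam w h n z) =
      fun t => meanLog lam f w μ h t + Complex.log (1 + relDev lam w μ h n z t) := by
    rw [hlog]
    funext t
    rw [hpm, mul_div_cancel_right₀ _ (hh.meanPath_ne_zero hs t)]
  have c1 := continuous_meanLog hs hh
  have c2 := continuous_relDev hs hh n z
  have c3 : Continuous fun t => Complex.log (1 + relDev lam w μ h n z t) :=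
    Continuous.clog (by fun_prop) fun t =>
      Complex.mem_slitPlane_of_norm_lt_one ((hrel t).trans_lt (by norm_num))
  have i1 : IntervalIntegrable (fun t : ℝ => Complex.exp (-(Complex.I * t * x)) *
      distinguishedLog (path lam w h n z) t) volume (-(1 / h)) (1 / h) := by
    rw [hlog']
    exact Continuous.intervalIntegrable (by fun_prop) _ _
  have i2 : IntervalIntegrable (fun t : ℝ => Complex.exp (-(Complex.I * t * x)) *
      meanLog lam f w μ h t) volume (-(1 / h)) (1 / h) :=
    Continuous.intervalIntegrable (by fun_prop) _ _
  have i3 : IntervalIntegrable (fun t : ℝ => Complex.exp (-(Complex.I * t * x)) *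
      relDev lam w μ h n z t) volume (-(1 / h)) (1 / h) :=
    Continuous.intervalIntegrable (by fun_prop) _ _
  rw [fRaw, if_pos hne, center, linearPart, ← mul_sub, ← mul_sub, ← Complex.sub_re,
    ← Complex.sub_re, ← intervalIntegral.integral_sub i1 i2,
    ← intervalIntegral.integral_sub (i1.sub i2) i3, abs_mul, abs_of_pos (by positivity),
    mul_assoc _ (D ^ 2)]
  refine mul_le_mul_of_nonneg_left ((Complex.abs_re_le_norm _).trans ?_) (by positivity)
  have c4 : Continuous fun t => D ^ 2 * ‖empCharFn n z t - charFun μ t‖ ^ 2 := by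
    have h2 := continuous_charFun_real (μ := μ)
    have h4 := continuous_empCharFn n z
    fun_prop
  refine (intervalIntegral.norm_integral_le_of_norm_le hle
    (g := fun t => D ^ 2 * ‖empCharFn n z t - charFun μ t‖ ^ 2)
    (Eventually.of_forall fun t _ => ?_) (c4.intervalIntegrable _ _)).trans_eq ?_
  · have e : Complex.exp (-(Complex.I * t * x)) * distinguishedLog (path lam w h n z) t -
        Complex.exp (-(Complex.I * t * x)) * meanLog lam f w μ h t -
        Complex.exp (-(Complex.I * t * x)) * relDev lam w μ h n z t =
        Complex.exp (-(Complex.I * t * x)) * (Complex.log (1 + relDev lam w μ h n z t) -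
          relDev lam w μ h n z t) := by
      rw [hlog']
      ring
    rw [e, norm_mul, norm_exp_neg_I_mul, one_mul, ← mul_pow]
    have hr := hrel t
    refine (Complex.norm_log_one_add_sub_self_le (hr.trans_lt (by norm_num))).trans ?_
    have h2 : (1 - ‖relDev lam w μ h n z t‖)⁻¹ ≤ 2 := by
      rw [inv_le_comm₀ (by linarith) (by norm_num)]
      linarith
    calc ‖relDev lam w μ h n z t‖ ^ 2 * (1 - ‖relDev lam w μ h n z t‖)⁻¹ / 2
        ≤ ‖relDev lam w μ h n z t‖ ^ 2 * 2 / 2 := by gcongr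
      _ = ‖relDev lam w μ h n z t‖ ^ 2 := by ring
      _ ≤ _ := by
        have := norm_relDev_le hs hh n z t
        gcongr
  · rw [intervalIntegral.integral_of_le hle, ← integral_Icc_eq_integral_Ioc, integral_const_mul]
    rfl

end Expansion

/-! ### The linear part as a sample mean -/

section Influence

variable {lam : ℝ} {f w : ℝ → ℝ} {μ : Measure ℝ} {h : ℝ}

/-- The Fourier multiplier of the linear part. -/
noncomputable def multiplier (lam : ℝ) (w : ℝ → ℝ) (μ : Measure ℝ) (h t : ℝ) : ℂ :=
  ((Real.exp lam - 1 : ℝ) : ℂ) * charFn w (h * t) / meanPath lam w μ h t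

/-- The contribution of an observation at `y` to the linear part of the estimator at `x`. -/
noncomputable def influence (lam : ℝ) (w : ℝ → ℝ) (μ : Measure ℝ) (h x y : ℝ) : ℝ :=
  1 / (2 * Real.pi * lam) * (∫ t in (-(1 / h))..(1 / h),
    Complex.exp (-(Complex.I * t * x)) * (Complex.exp (Complex.I * t * y) *
      multiplier lam w μ h t)).re

theorem norm_exp_I_mul (t y : ℝ) : ‖Complex.exp (Complex.I * t * y)‖ = 1 := by
  have : Complex.I * t * y = ((t * y : ℝ) : ℂ) * Complex.I := by push_cast; ring
  rw [this, Complex.norm_exp_ofReal_mul_I]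

theorem continuous_multiplier [IsProbabilityMeasure μ] (hs : CompoundSetting lam f w μ)
    (hh : SmallBandwidth lam f w μ h) : Continuous (multiplier lam w μ h) := by
  have h1 := hs.continuous_charFn_w
  have h3 := continuous_meanPath hs h
  unfold multiplier
  exact Continuous.div (by fun_prop) h3 fun t => hh.meanPath_ne_zero hs t

theorem continuous_influence [IsProbabilityMeasure μ] (hs : CompoundSetting lam f w μ)
    (hh : SmallBandwidth lam f w μ h) (x : ℝ) : Continuous (influence lam w μ h x) := by
  have h1 := continuous_multiplier hs hh
  have h2 : Continuous fun y : ℝ => ∫ t in (-(1 / h))..(1 / h),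
      Complex.exp (-(Complex.I * t * x)) * (Complex.exp (Complex.I * t * y) *
        multiplier lam w μ h t) :=
    intervalIntegral.continuous_parametric_intervalIntegral_of_continuous' (by fun_prop) _ _
  unfold influence
  exact continuous_const.mul (Complex.continuous_re.comp h2)

theorem linearPart_eq_deviation [IsProbabilityMeasure μ] (hs : CompoundSetting lam f w μ)
    (hh : SmallBandwidth lam f w μ h) (n : ℕ) (z : ℕ → ℝ) (x : ℝ) :
    linearPart lam w μ h n z x = deviation μ n (influence lam w μ h x) z := by
  have hh0 := hh.pos
  have hle : -(1 / h) ≤ 1 / h := by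
    have : 0 < 1 / h := by positivity
    linarith
  have hm := continuous_multiplier hs hh
  have hφ := continuous_charFun_real (μ := μ)
  have hemp := continuous_empCharFn n z
  set J : ℝ → ℂ := fun y => ∫ t in (-(1 / h))..(1 / h),
    Complex.exp (-(Complex.I * t * x)) * (Complex.exp (Complex.I * t * y) *
      multiplier lam w μ h t) with hJ
  have hJi : ∀ y : ℝ, IntervalIntegrable (fun t : ℝ => Complex.exp (-(Complex.I * t * x)) *
      (Complex.exp (Complex.I * t * y) * multiplier lam w μ h t)) volume (-(1 / h)) (1 / h) :=
    fun y => Continuous.intervalIntegrable (by fun_prop) _ _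
  have e0 : ∀ t, relDev lam w μ h n z t = empCharFn n z t * multiplier lam w μ h t -
      charFun μ t * multiplier lam w μ h t := fun t => by
    rw [relDev, multiplier]
    ring
  have e1 : ∫ t in (-(1 / h))..(1 / h), Complex.exp (-(Complex.I * t * x)) *
      (empCharFn n z t * multiplier lam w μ h t) =
      ((1 / (n : ℝ) : ℝ) : ℂ) * ∑ j ∈ Finset.range n, J (z j) := by
    rw [hJ, ← intervalIntegral.integral_finsetSum fun j _ => hJi (z j),
      ← intervalIntegral.integral_const_mul]
    refine intervalIntegral.integral_congr fun t _ => ?_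
    rw [empCharFn, ← Finset.mul_sum, ← Finset.sum_mul]
    push_cast
    ring
  have hprod : Integrable (fun p : ℝ × ℝ => Complex.exp (-(Complex.I * p.1 * x)) *
      (Complex.exp (Complex.I * p.1 * p.2) * multiplier lam w μ h p.1))
      ((volume.restrict (Set.Ioc (-(1 / h)) (1 / h))).prod μ) := by
    have hmi : Integrable (multiplier lam w μ h) (volume.restrict (Set.Ioc (-(1 / h)) (1 / h))) :=
      (hm.intervalIntegrable (-(1 / h)) (1 / h)).1
    refine Integrable.mono (hmi.comp_fst μ) ?_ (Eventually.of_forall fun p => ?_)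
    · exact Continuous.aestronglyMeasurable (by fun_prop)
    · rw [norm_mul, norm_mul, norm_exp_neg_I_mul, norm_exp_I_mul, one_mul, one_mul]
  have hJint : Integrable J μ := by
    have := hprod.integral_prod_right
    refine this.congr (Eventually.of_forall fun y => ?_)
    simp only [hJ]
    rw [intervalIntegral.integral_of_le hle]
  have e2 : ∫ t in (-(1 / h))..(1 / h), Complex.exp (-(Complex.I * t * x)) *
      (charFun μ t * multiplier lam w μ h t) = ∫ y, J y ∂μ := by
    simp only [hJ, intervalIntegral.integral_of_le hle]
    rw [← integral_integral_swap hprod]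
    refine integral_congr_ae (Eventually.of_forall fun t => ?_)
    simp only
    rw [integral_const_mul, integral_mul_const, charFun_apply_real]
    have e : ∀ y : ℝ, (t : ℂ) * y * Complex.I = Complex.I * t * y := fun v => by ring
    simp_rw [e]
  have e3 : ∀ y, influence lam w μ h x y = 1 / (2 * Real.pi * lam) * (J y).re := fun y => rfl
  have e4 : ∫ y, (J y).re ∂μ = (∫ y, J y ∂μ).re := by
    have := Complex.reCLM.integral_comp_comm hJint
    simpa using this
  rw [linearPart, deviation]
  simp_rw [e0, e3, mul_sub]
  rw [intervalIntegral.integral_sub (Continuous.intervalIntegrable (by fun_prop) _ _)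
    (Continuous.intervalIntegrable (by fun_prop) _ _), e1, e2, integral_const_mul, e4,
    Complex.sub_re, Complex.re_ofReal_mul, Complex.re_sum, ← Finset.mul_sum]
  ring

/-- The continuous version of the kernel, given by Fourier inversion. -/
noncomputable def kernelVersion (w : ℝ → ℝ) (u : ℝ) : ℝ :=
  (((2 * Real.pi)⁻¹ : ℝ) * ∫ t : ℝ, Complex.exp (-(Complex.I * t * u)) * charFn w t : ℂ).re

theorem CompoundSetting.integrable_charFn_w (hs : CompoundSetting lam f w μ) :
    Integrable (charFn w) := by
  refine hs.continuous_charFn_w.integrable_of_hasCompactSupport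
    (HasCompactSupport.intro (isCompact_Icc (a := (-1 : ℝ)) (b := 1)) fun s hs' => ?_)
  exact hs.charFn_w_eq_zero s (not_le.1 fun hle => hs' (abs_le.1 hle))

theorem kernelVersion_ae_eq (hs : CompoundSetting lam f w μ) : kernelVersion w =ᵐ[volume] w := by
  filter_upwards [ae_eq_integral_charFn hs.integrable_w hs.integrable_charFn_w] with u hu
  rw [kernelVersion, hu, Complex.ofReal_re]

theorem abs_kernelVersion_le (w : ℝ → ℝ) (u : ℝ) :
    |kernelVersion w u| ≤ (2 * Real.pi)⁻¹ * ∫ t, ‖charFn w t‖ := by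
  refine (Complex.abs_re_le_norm _).trans ?_
  rw [norm_mul, Complex.norm_real, Real.norm_of_nonneg (by positivity : (0 : ℝ) ≤ (2 * Real.pi)⁻¹)]
  refine mul_le_mul_of_nonneg_left ?_ (by positivity)
  refine (norm_integral_le_integral_norm _).trans_eq ?_
  refine integral_congr_ae (Eventually.of_forall fun t => ?_)
  simp only [norm_mul, norm_exp_neg_I_mul, one_mul]

theorem continuous_kernelVersion (hs : CompoundSetting lam f w μ) :
    Continuous (kernelVersion w) := by
  have h : Continuous fun u : ℝ => ∫ t : ℝ, Complex.exp (-(Complex.I * t * u)) * charFn w t := by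
    have h1 := hs.continuous_charFn_w
    refine continuous_of_dominated (bound := fun t => ‖charFn w t‖)
      (fun u => Continuous.aestronglyMeasurable (by fun_prop))
      (fun u => Eventually.of_forall fun t => ?_) hs.integrable_charFn_w.norm
      (Eventually.of_forall fun t => by fun_prop)
    rw [norm_mul, norm_exp_neg_I_mul, one_mul]
  unfold kernelVersion
  exact Complex.continuous_re.comp (continuous_const.mul h)

/-- The Fourier integral over `[-1 / h, 1 / h]` is the full inversion integral of the rescaled
kernel, as `φ_w` vanishes outside `[-1, 1]`. -/
theorem intervalIntegral_charFn_w (hs : CompoundSetting lam f w μ) (hh : 0 < h) (x y : ℝ) :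
    (∫ t in (-(1 / h))..(1 / h), Complex.exp (-(Complex.I * t * x)) *
      (Complex.exp (Complex.I * t * y) * charFn w (h * t))).re =
      2 * Real.pi / h * kernelVersion w ((x - y) / h) := by
  have hle : -(1 / h) ≤ 1 / h := by
    have : 0 < 1 / h := by positivity
    linarith
  set H : ℝ → ℂ := fun s => Complex.exp (-(Complex.I * s * ((x - y) / h : ℝ))) * charFn w s
  have h1 : ∀ t : ℝ, Complex.exp (-(Complex.I * t * x)) *
      (Complex.exp (Complex.I * t * y) * charFn w (h * t)) = H (h * t) := fun t => by
    have hne : (h : ℂ) ≠ 0 := by exact_mod_cast hh.ne'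
    simp only [H]
    rw [← mul_assoc, ← Complex.exp_add]
    congr 2
    push_cast
    field_simp
    ring
  simp_rw [h1]
  rw [intervalIntegral.integral_of_le hle, ← integral_Icc_eq_integral_Ioc,
    setIntegral_eq_integral_of_forall_compl_eq_zero fun t ht => by
      simp only [H]
      rw [charFn_mul_eq_zero hs.charFn_w_eq_zero hh ht, mul_zero],
    Measure.integral_comp_mul_left, abs_of_pos (by positivity), kernelVersion, Complex.real_smul,
    Complex.re_ofReal_mul, Complex.re_ofReal_mul]
  field_simp
  rfl

/-- Up to a term that stays bounded as the bandwidth shrinks, the linear part is a multiple of the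
ordinary kernel estimator: the difference of the two multipliers is of the order of `φ_μ`, hence
dominated by a multiple of the integrable `|φ_f|`. -/
theorem exists_abs_influence_sub_le (hs : CompoundSetting lam f w μ) [IsProbabilityMeasure μ] :
    ∃ C, 0 ≤ C ∧ ∀ h, SmallBandwidth lam f w μ h → ∀ x y,
      |influence lam w μ h x y -
        (Real.exp lam - 1) / lam * (1 / h * kernelVersion w ((x - y) / h))| ≤ C := by
  have ha0 := hs.exp_sub_one_pos
  have hl0 := hs.lam_pos
  set a := Real.exp lam - 1 with ha
  set W := ∫ u, |w u| with hW
  have hW0 : 0 ≤ W := integral_nonneg fun u => abs_nonneg _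
  set D := 2 * a * W * a * W * Real.exp lam with hD
  have hD0 : 0 ≤ D := by positivity
  refine ⟨1 / (2 * Real.pi * lam) * ∫ t, D * ‖charFn f t‖, by positivity, fun h hh x y => ?_⟩
  have hh0 := hh.pos
  have hle : -(1 / h) ≤ 1 / h := by
    have : 0 < 1 / h := by positivity
    linarith
  have hm := continuous_multiplier hs hh
  have hw := hs.continuous_charFn_w
  have hker := intervalIntegral_charFn_w hs hh0 x y
  have e1 : a / lam * (1 / h * kernelVersion w ((x - y) / h)) =
      1 / (2 * Real.pi * lam) * (∫ t in (-(1 / h))..(1 / h), Complex.exp (-(Complex.I * t * x)) *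
        (Complex.exp (Complex.I * t * y) * ((a : ℂ) * charFn w (h * t)))).re := by
    have : ∀ t : ℝ, Complex.exp (-(Complex.I * t * x)) *
        (Complex.exp (Complex.I * t * y) * ((a : ℂ) * charFn w (h * t))) =
        (a : ℂ) * (Complex.exp (-(Complex.I * t * x)) *
        (Complex.exp (Complex.I * t * y) * charFn w (h * t))) := fun t => by ring
    simp_rw [this]
    rw [intervalIntegral.integral_const_mul, Complex.re_ofReal_mul, hker]
    field_simp
  rw [e1, influence, ← mul_sub, ← Complex.sub_re, ← intervalIntegral.integral_sub
    (Continuous.intervalIntegrable (by fun_prop) _ _)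
    (Continuous.intervalIntegrable (by fun_prop) _ _), abs_mul, abs_of_pos (by positivity)]
  refine mul_le_mul_of_nonneg_left ((Complex.abs_re_le_norm _).trans ?_) (by positivity)
  have hint : Integrable fun t => D * ‖charFn f t‖ := hs.integrable_charFn_f.norm.const_mul D
  refine (intervalIntegral.norm_integral_le_of_norm_le hle (g := fun t => D * ‖charFn f t‖)
    (Eventually.of_forall fun t _ => ?_) hint.intervalIntegrable).trans ?_
  · rw [← mul_sub, ← mul_sub, norm_mul, norm_mul, norm_exp_neg_I_mul, norm_exp_I_mul, one_mul,
      one_mul]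
    have hne := hh.meanPath_ne_zero hs t
    have e2 : multiplier lam w μ h t - (a : ℂ) * charFn w (h * t) =
        -((a : ℂ) * charFn w (h * t) * ((a : ℂ) * charFun μ t * charFn w (h * t))) /
          meanPath lam w μ h t := by
      rw [multiplier, eq_div_iff hne, sub_mul, div_mul_cancel₀ _ hne, meanPath, ← ha]
      ring
    have hna : ‖(a : ℂ)‖ = a := by rw [Complex.norm_real, Real.norm_of_nonneg ha0.le]
    rw [e2, norm_div, norm_neg, norm_mul, norm_mul, norm_mul, norm_mul, hna,
      div_le_iff₀ (norm_pos_iff.2 hne)]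
    have h3 := hh.le_norm_meanPath hs t
    have h4 := norm_charFn_le w (h * t)
    have h5 := hs.norm_charFun_le t
    have e3 : Real.exp lam * Real.exp (-lam) = 1 := by rw [← Real.exp_add]; simp
    calc a * ‖charFn w (h * t)‖ * (a * ‖charFun μ t‖ * ‖charFn w (h * t)‖)
        ≤ a * W * (a * ‖charFn f t‖ * W) := by gcongr
      _ = D * ‖charFn f t‖ * (Real.exp (-lam) / 2) := by
          rw [hD]
          linear_combination (-a * W * a * W * ‖charFn f t‖) * e3
      _ ≤ _ := by gcongr
  · rw [intervalIntegral.integral_of_le hle]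
    exact setIntegral_le_integral hint (Eventually.of_forall fun t => by positivity)

/-! ### The variance of the linear part -/

theorem integral_withDensity_scaled {g : ℝ → ℝ} (hg : Continuous g) (hg0 : ∀ y, 0 ≤ g y)
    (hμ : μ = volume.withDensity fun y => ENNReal.ofReal (g y)) (F : ℝ → ℝ) (hh : 0 < h) (x : ℝ) :
    ∫ y, F ((x - y) / h) ∂μ = h * ∫ u, F u * g (x - h * u) := by
  rw [hμ, integral_withDensity_eq_integral_toReal_smul (by fun_prop) (by simp)]
  simp only [ENNReal.toReal_ofReal (hg0 _), smul_eq_mul]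
  rw [← integral_sub_left_eq_self _ volume x]
  simp only [sub_sub_cancel]
  have h1 := Measure.integral_comp_mul_left (fun y => g (x - y) * F (y / h)) h
  rw [abs_of_pos (by positivity), smul_eq_mul] at h1
  have h2 : ∀ u, g (x - h * u) * F (h * u / h) = F u * g (x - h * u) := fun u => by
    rw [mul_div_cancel_left₀ _ hh.ne', mul_comm]
  simp_rw [h2] at h1
  rw [h1]
  field_simp

/-- Smoothing with a shrinking bandwidth reproduces the value of a bounded continuous density. -/
theorem tendsto_integral_scaled {g : ℝ → ℝ} (hg : Continuous g) {K : ℝ} (hK : ∀ y, |g y| ≤ K)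
    {F : ℝ → ℝ} (hF : Integrable F) {h : ℕ → ℝ} (hh : Tendsto h atTop (𝓝 0)) (x : ℝ) :
    Tendsto (fun n => ∫ u, F u * g (x - h n * u)) atTop (𝓝 (g x * ∫ u, F u)) := by
  have e : g x * ∫ u, F u = ∫ u, F u * g x := by rw [integral_mul_const, mul_comm]
  rw [e]
  refine tendsto_integral_of_dominated_convergence (fun u => |F u| * K) (fun n => ?_)
    (hF.abs.mul_const K) (fun n => Eventually.of_forall fun u => ?_)
    (Eventually.of_forall fun u => ?_)
  · exact hF.aestronglyMeasurable.mul (by fun_prop : Continuous _).aestronglyMeasurable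
  · rw [Real.norm_eq_abs, abs_mul]
    exact mul_le_mul_of_nonneg_left (hK _) (abs_nonneg _)
  · refine Tendsto.const_mul _ ?_
    have : Tendsto (fun n => x - h n * u) atTop (𝓝 (x - 0 * u)) :=
      tendsto_const_nhds.sub (hh.mul_const u)
    rw [zero_mul, sub_zero] at this
    exact (hg.tendsto x).comp this

/-- The asymptotics of the influence function: its variance is that of the kernel estimator to first
order, and it is of order `1 / h`. -/
theorem influence_asymptotics [IsProbabilityMeasure μ] (hs : CompoundSetting lam f w μ)
    {g : ℝ → ℝ} (hg : Continuous g) (hg0 : ∀ y, 0 ≤ g y) {K : ℝ} (hK : ∀ y, g y ≤ K)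
    (hμ : μ = volume.withDensity fun y => ENNReal.ofReal (g y)) {h : ℕ → ℝ}
    (hsm : ∀ᶠ n in atTop, SmallBandwidth lam f w μ (h n)) (hh : Tendsto h atTop (𝓝 0)) (x : ℝ) :
    Tendsto (fun n => h n * (∫ y, influence lam w μ (h n) x y ^ 2 ∂μ -
        (∫ y, influence lam w μ (h n) x y ∂μ) ^ 2)) atTop
      (𝓝 ((Real.exp lam - 1) ^ 2 / lam ^ 2 * g x * ∫ u, w u ^ 2)) ∧
    ∃ C, 0 < C ∧ ∀ᶠ n in atTop, (∀ y, |influence lam w μ (h n) x y| ≤ C / h n) ∧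
      ∫ y, influence lam w μ (h n) x y ^ 2 ∂μ ≤ C / h n := by
  have ha0 := hs.exp_sub_one_pos
  have hl0 := hs.lam_pos
  set r := (Real.exp lam - 1) / lam with hr
  have hr0 : 0 < r := by positivity
  obtain ⟨C, hC0, hC⟩ := exists_abs_influence_sub_le hs
  have hk := kernelVersion_ae_eq hs
  have hkc := continuous_kernelVersion hs
  set B := (2 * Real.pi)⁻¹ * ∫ t, ‖charFn w t‖ with hB
  have hB0 : 0 ≤ B := by positivity
  have hkb : ∀ u, |kernelVersion w u| ≤ B := abs_kernelVersion_le w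
  have hki : Integrable (kernelVersion w) := hs.integrable_w.congr hk.symm
  have hk2 : Integrable fun u => kernelVersion w u ^ 2 := by
    refine (hki.abs.const_mul B).mono (hkc.pow 2).aestronglyMeasurable
      (Eventually.of_forall fun u => ?_)
    rw [Real.norm_eq_abs, abs_pow, Real.norm_eq_abs, abs_mul, abs_abs, abs_of_nonneg hB0, sq]
    exact mul_le_mul_of_nonneg_right (hkb u) (abs_nonneg _)
  have hk2w : ∫ u, kernelVersion w u ^ 2 = ∫ u, w u ^ 2 := by
    refine integral_congr_ae ?_
    filter_upwards [hk] with u hu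
    rw [hu]
  have hgK : ∀ y, |g y| ≤ K := fun y => by rw [abs_of_nonneg (hg0 y)]; exact hK y
  have hK0 : 0 ≤ K := (hg0 0).trans (hK 0)
  set A := r * (K * ∫ u, |kernelVersion w u|) with hA
  have hA0 : 0 ≤ A := by positivity
  -- The kernel part `k` and the bounded rest `v - k` of the influence function `v`.
  set k : ℕ → ℝ → ℝ := fun n y => r * (1 / h n * kernelVersion w ((x - y) / h n)) with hkdef
  set v : ℕ → ℝ → ℝ := fun n y => influence lam w μ (h n) x y with hv
  have hkcont : ∀ n, Continuous (k n) := fun n => by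
    simp only [hkdef]
    fun_prop
  have hkbound : ∀ n, 0 < h n → ∀ y, |k n y| ≤ r * (1 / h n * B) := fun n hn y => by
    rw [hkdef, abs_mul, abs_mul, abs_of_pos hr0, abs_of_pos (by positivity : (0 : ℝ) < 1 / h n)]
    have := hkb ((x - y) / h n)
    gcongr
  have hksq : ∀ n, 0 < h n → h n * ∫ y, k n y ^ 2 ∂μ =
      r ^ 2 * ∫ u, kernelVersion w u ^ 2 * g (x - h n * u) := fun n hn => by
    have e : ∀ y, k n y ^ 2 = (r * (1 / h n)) ^ 2 * (kernelVersion w ((x - y) / h n)) ^ 2 :=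
      fun y => by simp only [hkdef]; ring
    simp_rw [e]
    rw [integral_const_mul, integral_withDensity_scaled hg hg0 hμ
      (fun u => kernelVersion w u ^ 2) hn x]
    field_simp
  have hkabs : ∀ n, 0 < h n → ∫ y, |k n y| ∂μ ≤ A := fun n hn => by
    have e : ∀ y, |k n y| = (r * (1 / h n)) * |kernelVersion w ((x - y) / h n)| := fun y => by
      simp only [hkdef]
      rw [abs_mul, abs_mul, abs_of_pos hr0, abs_of_pos (by positivity : (0 : ℝ) < 1 / h n)]
      ring
    simp_rw [e]
    rw [integral_const_mul, integral_withDensity_scaled hg hg0 hμ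
      (fun u => |kernelVersion w u|) hn x]
    have h1 : ∫ u, |kernelVersion w u| * g (x - h n * u) ≤ K * ∫ u, |kernelVersion w u| := by
      rw [← integral_const_mul]
      refine integral_mono_of_nonneg (Eventually.of_forall fun u => ?_) (hki.abs.const_mul K)
        (Eventually.of_forall fun u => ?_)
      · exact mul_nonneg (abs_nonneg _) (hg0 _)
      · change |kernelVersion w u| * g (x - h n * u) ≤ K * |kernelVersion w u|
        rw [mul_comm]
        exact mul_le_mul_of_nonneg_right (hK _) (abs_nonneg _)
    calc r * (1 / h n) * (h n * ∫ u, |kernelVersion w u| * g (x - h n * u))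
        = r * ∫ u, |kernelVersion w u| * g (x - h n * u) := by field_simp
      _ ≤ A := by rw [hA]; gcongr
  have hbounded : ∀ q : ℝ → ℝ, Continuous q → (∃ c, ∀ y, |q y| ≤ c) → Integrable q μ :=
    fun q hq ⟨c, hc⟩ => Integrable.of_bound hq.aestronglyMeasurable c (Eventually.of_forall hc)
  -- Everything except the integral of `k ^ 2` stays bounded.
  have hmain : ∀ n, SmallBandwidth lam f w μ (h n) →
      |∫ y, v n y ^ 2 ∂μ - ∫ y, k n y ^ 2 ∂μ| ≤ C ^ 2 + 2 * C * A ∧ |∫ y, v n y ∂μ| ≤ A + C := by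
    intro n hn
    have hn0 := hn.pos
    have hvc : Continuous (v n) := continuous_influence hs hn x
    have hd : ∀ y, |v n y - k n y| ≤ C := fun y => hC (h n) hn x y
    have ik : Integrable (k n) μ := hbounded _ (hkcont n) ⟨_, hkbound n hn0⟩
    have ik2 : Integrable (fun y => k n y ^ 2) μ := hbounded _ ((hkcont n).pow 2)
      ⟨(r * (1 / h n * B)) ^ 2, fun y => by
        rw [abs_pow]
        have := hkbound n hn0 y
        gcongr⟩
    have hvb : ∀ y, |v n y| ≤ |k n y| + C := fun y => by
      have h1 := hd y
      have h2 : |v n y| ≤ |k n y| + |v n y - k n y| := by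
        have := abs_add_le (k n y) (v n y - k n y)
        simpa using this
      linarith
    have iv2 : Integrable (fun y => v n y ^ 2) μ := hbounded _ (hvc.pow 2)
      ⟨(r * (1 / h n * B) + C) ^ 2, fun y => by
        rw [abs_pow]
        have := hkbound n hn0 y
        have := hvb y
        gcongr
        linarith⟩
    constructor
    · rw [← integral_sub iv2 ik2]
      refine (norm_integral_le_of_norm_le (f := fun y => v n y ^ 2 - k n y ^ 2)
        (g := fun y => C ^ 2 + 2 * C * |k n y|)
        ((integrable_const _).add (ik.abs.const_mul _)) (Eventually.of_forall fun y => ?_)).trans ?_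
      · rw [Real.norm_eq_abs]
        have e : v n y ^ 2 - k n y ^ 2 = (v n y - k n y) ^ 2 + 2 * ((v n y - k n y) * k n y) := by
          ring
        rw [e]
        refine (abs_add_le _ _).trans ?_
        rw [abs_pow, abs_mul, abs_mul, abs_two]
        have := hd y
        have h0 := abs_nonneg (k n y)
        calc |v n y - k n y| ^ 2 + 2 * (|v n y - k n y| * |k n y|)
            ≤ C ^ 2 + 2 * (C * |k n y|) := by gcongr
          _ = _ := by ring
      · rw [integral_add (integrable_const _) (ik.abs.const_mul _), integral_const_mul]
        simp only [integral_const, probReal_univ, one_smul]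
        have := hkabs n hn0
        gcongr
    · refine (norm_integral_le_of_norm_le (f := v n) (g := fun y => |k n y| + C)
        (ik.abs.add (integrable_const _)) (Eventually.of_forall hvb)).trans ?_
      rw [integral_add ik.abs (integrable_const _)]
      simp only [integral_const, probReal_univ, one_smul]
      have := hkabs n hn0
      gcongr
  have hlim1 : Tendsto (fun n => h n * ∫ y, k n y ^ 2 ∂μ) atTop
      (𝓝 ((Real.exp lam - 1) ^ 2 / lam ^ 2 * g x * ∫ u, w u ^ 2)) := by
    have h1 := (tendsto_integral_scaled hg hgK hk2 hh x).const_mul (r ^ 2)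
    have e : r ^ 2 * (g x * ∫ u, kernelVersion w u ^ 2) =
        (Real.exp lam - 1) ^ 2 / lam ^ 2 * g x * ∫ u, w u ^ 2 := by
      rw [hk2w, hr, div_pow]
      ring
    rw [e] at h1
    refine h1.congr' ?_
    filter_upwards [hsm] with n hn
    rw [hksq n hn.pos]
  refine ⟨?_, ?_⟩
  · set E := C ^ 2 + 2 * C * A + (A + C) ^ 2 with hE
    have hdiff : Tendsto (fun n => h n * (∫ y, v n y ^ 2 ∂μ - (∫ y, v n y ∂μ) ^ 2) -
        h n * ∫ y, k n y ^ 2 ∂μ) atTop (𝓝 0) := by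
      refine squeeze_zero_norm' (a := fun n => |h n| * E) ?_ ?_
      · filter_upwards [hsm] with n hn
        obtain ⟨h1, h2⟩ := hmain n hn
        rw [← mul_sub, norm_mul, Real.norm_eq_abs, Real.norm_eq_abs]
        refine mul_le_mul_of_nonneg_left ?_ (abs_nonneg _)
        have e : ∫ y, v n y ^ 2 ∂μ - (∫ y, v n y ∂μ) ^ 2 - ∫ y, k n y ^ 2 ∂μ =
            (∫ y, v n y ^ 2 ∂μ - ∫ y, k n y ^ 2 ∂μ) - (∫ y, v n y ∂μ) ^ 2 := by ring
        rw [e]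
        refine (abs_sub _ _).trans ?_
        rw [abs_pow, hE]
        gcongr
      · simpa using hh.abs.mul_const E
    simpa using hdiff.add hlim1
  · obtain ⟨L, hL⟩ := hlim1.bddAbove_range.imp fun L hL n => hL ⟨n, rfl⟩
    set C' := r * B + C + 1 + (|L| + (C ^ 2 + 2 * C * A)) with hC'
    refine ⟨C', by positivity, ?_⟩
    filter_upwards [hsm, hh.eventually (Iic_mem_nhds (zero_lt_one))] with n hn hn1
    have hn0 := hn.pos
    have hn1' : h n ≤ 1 := hn1
    refine ⟨fun y => ?_, ?_⟩
    · have h1 := hkbound n hn0 y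
      have h2 : |v n y| ≤ |k n y| + |v n y - k n y| := by
        have := abs_add_le (k n y) (v n y - k n y)
        simpa using this
      have h3 : |v n y - k n y| ≤ C := hC (h n) hn x y
      rw [le_div_iff₀ hn0]
      have e : r * (1 / h n * B) * h n = r * B := by field_simp
      have h5 : 0 ≤ |L| + (C ^ 2 + 2 * C * A) := by positivity
      calc |v n y| * h n ≤ (r * (1 / h n * B) + C) * h n := by gcongr; linarith
        _ = r * B + C * h n := by rw [add_mul, e]
        _ ≤ r * B + C * 1 := by gcongr
        _ ≤ C' := by rw [hC']; linarith
    · have h1 := (abs_le.1 (hmain n hn).1).2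
      have h2 : h n * ∫ y, k n y ^ 2 ∂μ ≤ |L| := (hL n).trans (le_abs_self _)
      rw [le_div_iff₀ hn0]
      have h3 : (∫ y, v n y ^ 2 ∂μ) ≤ ∫ y, k n y ^ 2 ∂μ + (C ^ 2 + 2 * C * A) := by linarith
      calc (∫ y, v n y ^ 2 ∂μ) * h n ≤ (∫ y, k n y ^ 2 ∂μ + (C ^ 2 + 2 * C * A)) * h n := by
            gcongr
        _ = h n * ∫ y, k n y ^ 2 ∂μ + (C ^ 2 + 2 * C * A) * h n := by ring
        _ ≤ |L| + (C ^ 2 + 2 * C * A) * 1 := by gcongr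
        _ ≤ C' := by
          rw [hC']
          have : 0 ≤ r * B + C + 1 := by positivity
          linarith

end Influence

/-! ### The effect of a small remainder on the variance -/

/-- Truncation at a level exceeding `|c|` by at least one changes `c + T` by at most `T ^ 2`. -/
theorem abs_truncate_sub_le {M c T y r : ℝ} (hM : |c| + 1 ≤ M) (hy : |y - c - T| ≤ r) :
    |max (min M y) (-M) - c - T| ≤ r + T ^ 2 := by
  obtain ⟨hy1, hy2⟩ := abs_le.1 hy
  have hc1 := le_abs_self c
  have hc2 := neg_abs_le c
  have hr : 0 ≤ r := (abs_nonneg _).trans hy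
  -- `|T| ≤ T ^ 2` as soon as `|T| ≥ 1`, and the truncation is inactive at `c + T` otherwise.
  have hT1 : 1 ≤ |T| → |T| ≤ T ^ 2 := fun h => by
    rw [← sq_abs]
    nlinarith
  have hT2 := le_abs_self T
  have hT3 := neg_abs_le T
  have hT4 := sq_nonneg T
  have hT5 : |T| ≤ 1 ∨ |T| ≤ T ^ 2 := (le_total |T| 1).imp_right hT1
  rw [abs_le]
  rcases max_cases (min M y) (-M) with ⟨e1, h1⟩ | ⟨e1, h1⟩ <;>
  rcases min_cases M y with ⟨e2, h2⟩ | ⟨e2, h2⟩ <;>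
  rcases hT5 with h5 | h5 <;> constructor <;> linarith

section Variance

variable {Ω : Type*} [MeasurableSpace Ω] {P : Measure Ω}

theorem sq_integral_mul_le {T E : Ω → ℝ} (hT : MemLp T 2 P) (hE : MemLp E 2 P) :
    (∫ ω, T ω * E ω ∂P) ^ 2 ≤ (∫ ω, T ω ^ 2 ∂P) * ∫ ω, E ω ^ 2 ∂P := by
  have hTE : Integrable (fun ω => T ω * E ω) P := hT.integrable_mul hE
  -- The second moment of `T + s * E` is a nonnegative quadratic polynomial in `s`.
  have h : ∀ s : ℝ, 0 ≤ (∫ ω, E ω ^ 2 ∂P) * (s * s) + (2 * ∫ ω, T ω * E ω ∂P) * s +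
      ∫ ω, T ω ^ 2 ∂P := fun s => by
    have e : (∫ ω, E ω ^ 2 ∂P) * (s * s) + (2 * ∫ ω, T ω * E ω ∂P) * s + ∫ ω, T ω ^ 2 ∂P =
        ∫ ω, (T ω + s * E ω) ^ 2 ∂P := by
      have e1 : ∀ ω, (T ω + s * E ω) ^ 2 = (s * s) * E ω ^ 2 + (2 * s) * (T ω * E ω) + T ω ^ 2 :=
        fun ω => by ring
      simp_rw [e1]
      have i1 := hE.integrable_sq.const_mul (s * s)
      have i2 := hTE.const_mul (2 * s)
      rw [integral_add (i1.fun_add i2) hT.integrable_sq, integral_add i1 i2, integral_const_mul,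
        integral_const_mul]
      ring
    rw [e]
    exact integral_nonneg fun ω => sq_nonneg _
  have := discrim_le_zero h
  rw [discrim] at this
  linarith

/-- If `F` is a constant plus a centred `T` plus a remainder, then the second moment of the
remainder bounds the distance of the variances of `F` and `T`, by the Cauchy-Schwarz inequality. -/
theorem abs_variance_sub_le [IsProbabilityMeasure P] {T F : Ω → ℝ} {c : ℝ} (hT : MemLp T 2 P)
    (hF : MemLp F 2 P) (hT0 : ∫ ω, T ω ∂P = 0) :
    |Var[F; P] - ∫ ω, T ω ^ 2 ∂P| ≤
      2 * √((∫ ω, T ω ^ 2 ∂P) * ∫ ω, (F ω - c - T ω) ^ 2 ∂P) + ∫ ω, (F ω - c - T ω) ^ 2 ∂P := by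
  set E : Ω → ℝ := fun ω => F ω - c - T ω with hEdef
  have hE : MemLp E 2 P := (hF.sub (memLp_const c)).sub hT
  have hTE : Integrable (fun ω => T ω * E ω) P := hT.integrable_mul hE
  have hTi : Integrable T P := hT.integrable (by norm_num)
  have hEi : Integrable E P := hE.integrable (by norm_num)
  have hFi : Integrable F P := hF.integrable (by norm_num)
  have hmean : ∫ ω, F ω ∂P = c + ∫ ω, E ω ∂P := by
    have : ∀ ω, F ω = c + (T ω + E ω) := fun ω => by simp only [hEdef]; ring
    simp_rw [this]
    rw [integral_add (integrable_const _) (hTi.fun_add hEi), integral_add hTi hEi, hT0]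
    simp
  set m := ∫ ω, E ω ∂P with hm
  have hvar : Var[F; P] = ∫ ω, T ω ^ 2 ∂P + 2 * ∫ ω, T ω * E ω ∂P + ∫ ω, E ω ^ 2 ∂P - m ^ 2 := by
    rw [variance_eq_integral hF.aestronglyMeasurable.aemeasurable, hmean]
    have e1 : ∀ ω, (F ω - (c + m)) ^ 2 = T ω ^ 2 + 2 * (T ω * E ω) + E ω ^ 2 +
        (-(2 * m)) * (T ω + E ω) + m ^ 2 := fun ω => by simp only [hEdef]; ring
    simp_rw [e1]
    have i1 := hT.integrable_sq
    have i2 := hTE.const_mul 2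
    have i3 := hE.integrable_sq
    have i4 := (hTi.fun_add hEi).const_mul (-(2 * m))
    have i5 := (i1.fun_add i2).fun_add i3
    rw [integral_add (i5.fun_add i4) (integrable_const _),
      integral_add i5 i4, integral_add (i1.fun_add i2) i3,
      integral_add i1 i2, integral_const_mul, integral_const_mul, integral_add hTi hEi, hT0]
    simp only [integral_const, probReal_univ, one_smul]
    ring
  have h1 := Real.abs_le_sqrt (sq_integral_mul_le hT hE)
  have hm2 : m ^ 2 ≤ ∫ ω, E ω ^ 2 ∂P := by
    have := variance_nonneg E P
    rw [variance_eq_sub hE] at this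
    simpa [hm] using this
  obtain ⟨h2, h3⟩ := abs_le.1 h1
  have := sq_nonneg m
  rw [hvar, abs_le]
  constructor <;> linarith

/-- The error bound of `abs_variance_sub_le` is negligible at the scale `s`, if `s * a` converges
and `s * b` tends to zero. -/
theorem tendsto_mul_of_abs_sub_le {s v a b : ℕ → ℝ} {V : ℝ} (hs : ∀ᶠ n in atTop, 0 ≤ s n)
    (ha : Tendsto (fun n => s n * a n) atTop (𝓝 V)) (hb : Tendsto (fun n => s n * b n) atTop (𝓝 0))
    (hv : ∀ᶠ n in atTop, |v n - a n| ≤ 2 * √(a n * b n) + b n) :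
    Tendsto (fun n => s n * v n) atTop (𝓝 V) := by
  have h0 : Tendsto (fun n => s n * v n - s n * a n) atTop (𝓝 0) := by
    refine squeeze_zero_norm' (a := fun n => 2 * √((s n * a n) * (s n * b n)) + s n * b n) ?_ ?_
    · filter_upwards [hs, hv] with n h1 h2
      have e : s n * a n * (s n * b n) = s n ^ 2 * (a n * b n) := by ring
      rw [← mul_sub, norm_mul, Real.norm_of_nonneg h1, e, Real.sqrt_mul (sq_nonneg _),
        Real.sqrt_sq h1, Real.norm_eq_abs]
      calc s n * |v n - a n| ≤ s n * (2 * √(a n * b n) + b n) := by gcongr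
        _ = _ := by ring
    · have := ((ha.mul hb).sqrt.const_mul 2).add hb
      simpa using this
  simpa using h0.add ha

variable {Z : ℕ → Ω → ℝ} {μ : Measure ℝ}

theorem integral_deviation [IsProbabilityMeasure P] (hZ : ∀ j, Measurable (Z j))
    (hlaw : ∀ j, P.map (Z j) = μ) {q : ℝ → ℝ} (hq : Measurable q) {b : ℝ} (hb : ∀ y, |q y| ≤ b)
    {n : ℕ} (hn : 1 ≤ n) : ∫ ω, deviation μ n q (fun j => Z j ω) ∂P = 0 := by
  have hi : ∀ j, Integrable (fun ω => q (Z j ω)) P := fun j =>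
    Integrable.of_bound (hq.comp (hZ j)).aestronglyMeasurable b (Eventually.of_forall fun ω => hb _)
  have hn' : (n : ℝ) ≠ 0 := by exact_mod_cast (by omega : n ≠ 0)
  simp only [deviation]
  rw [integral_sub ((integrable_finsetSum _ fun j _ => hi j).const_mul _) (integrable_const _),
    integral_const_mul, integral_finsetSum _ fun j _ => hi j]
  simp_rw [integral_comp_sample hZ hlaw hq.stronglyMeasurable]
  simp only [Finset.sum_const, Finset.card_range, nsmul_eq_mul, integral_const, probReal_univ,
    one_smul]
  field_simp
  ring

/-- If the remainder is at most `C * S + T ^ 2` on `G` and at most `D` everywhere, then its second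
moment is controlled by those of `S` and `T ^ 2` and by the probability of the complement of `G`. -/
theorem integral_sq_remainder_le [IsProbabilityMeasure P] {E S T : Ω → ℝ} {G : Set Ω}
    (hG : MeasurableSet G) {C D : ℝ}
    (hE : MemLp E 2 P) (hS : Integrable (fun ω => S ω ^ 2) P) (hT : Integrable (fun ω => T ω ^ 4) P)
    (hgood : ∀ ω ∈ G, |E ω| ≤ C * S ω + T ω ^ 2) (hbad : ∀ ω, |E ω| ≤ D) :
    ∫ ω, E ω ^ 2 ∂P ≤ 2 * C ^ 2 * ∫ ω, S ω ^ 2 ∂P + 2 * ∫ ω, T ω ^ 4 ∂P + D ^ 2 * P.real Gᶜ := by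
  have i1 := hS.const_mul (2 * C ^ 2)
  have i2 := hT.const_mul 2
  have i3 : Integrable (Gᶜ.indicator fun _ => D ^ 2) P :=
    (integrable_const (D ^ 2)).indicator hG.compl
  have hle : ∀ ω, E ω ^ 2 ≤
      2 * C ^ 2 * S ω ^ 2 + 2 * T ω ^ 4 + Gᶜ.indicator (fun _ => D ^ 2) ω := by
    intro ω
    by_cases hω : ω ∈ G
    · have h1 := hgood ω hω
      have h2 : E ω ^ 2 ≤ (C * S ω + T ω ^ 2) ^ 2 := sq_le_sq' (abs_le.1 h1).1 (abs_le.1 h1).2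
      rw [Set.indicator_of_notMem (by simpa using hω)]
      nlinarith [sq_nonneg (C * S ω - T ω ^ 2)]
    · have h1 := hbad ω
      have h2 : E ω ^ 2 ≤ D ^ 2 := sq_le_sq' (abs_le.1 h1).1 (abs_le.1 h1).2
      rw [Set.indicator_of_mem (by simpa using hω)]
      have : 0 ≤ T ω ^ 4 := by positivity
      nlinarith [sq_nonneg (C * S ω)]
  refine (integral_mono hE.integrable_sq ((i1.fun_add i2).fun_add i3) hle).trans_eq ?_
  rw [integral_add (i1.fun_add i2) i3, integral_add i1 i2, integral_const_mul, integral_const_mul,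
    integral_indicator hG.compl, setIntegral_const, smul_eq_mul, mul_comm (P.real _)]

end Variance

/-! ### Bandwidths and truncation levels -/

theorem ConditionH.pos {h : ℕ → ℝ} (hH : ConditionH h) {n : ℕ} (hn : 1 ≤ n) : 0 < h n := by
  obtain ⟨C, γ, hC, -, -, e⟩ := hH
  have : (0 : ℝ) < n := by exact_mod_cast hn
  rw [e n hn]
  positivity

theorem ConditionH.tendsto_zero {h : ℕ → ℝ} (hH : ConditionH h) : Tendsto h atTop (𝓝 0) := by
  obtain ⟨C, γ, -, h0, -, e⟩ := hH
  have h1 := ((tendsto_rpow_neg_atTop h0).comp tendsto_natCast_atTop_atTop).const_mul C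
  rw [mul_zero] at h1
  refine h1.congr' ?_
  filter_upwards [eventually_ge_atTop 1] with n hn
  rw [e n hn, Function.comp_apply]

theorem ConditionH.tendsto_natCast_mul {h : ℕ → ℝ} (hH : ConditionH h) :
    Tendsto (fun n : ℕ => n * h n) atTop atTop := by
  obtain ⟨C, γ, hC, -, h1, e⟩ := hH
  have h2 := ((tendsto_rpow_atTop (by linarith : 0 < 1 - γ)).comp
    tendsto_natCast_atTop_atTop).const_mul_atTop hC
  refine h2.congr' ?_
  filter_upwards [eventually_ge_atTop 1] with n hn
  have hn' : (0 : ℝ) < n := by exact_mod_cast hn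
  rw [e n hn, Function.comp_apply, sub_eq_add_neg, Real.rpow_add hn', Real.rpow_one]
  ring

theorem ConditionH.exists_bounds {h : ℕ → ℝ} (hH : ConditionH h) :
    ∃ B, 0 < B ∧ ∀ n : ℕ, 1 ≤ n → h n ≤ B ∧ 1 / h n ≤ B * n := by
  obtain ⟨C, γ, hC, h0, h1, e⟩ := hH
  refine ⟨C + 1 / C, by positivity, fun n hn => ?_⟩
  have hn' : (1 : ℝ) ≤ n := by exact_mod_cast hn
  have hn0 : (0 : ℝ) < n := by linarith
  rw [e n hn]
  constructor
  · have h2 : (n : ℝ) ^ (-γ) ≤ 1 := Real.rpow_le_one_of_one_le_of_nonpos hn' (by linarith)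
    have : 0 < 1 / C := by positivity
    nlinarith
  · have h2 : (n : ℝ) ^ γ ≤ n := by
      simpa using Real.rpow_le_rpow_of_exponent_le hn' h1.le
    rw [Real.rpow_neg hn0.le]
    have e2 : 1 / (C * ((n : ℝ) ^ γ)⁻¹) = 1 / C * (n : ℝ) ^ γ := by field_simp
    rw [e2]
    have : 1 / C ≤ C + 1 / C := by linarith
    gcongr

theorem ConditionM.nonneg {M : ℕ → ℝ} (hM : ConditionM M) {n : ℕ} (hn : 1 ≤ n) : 0 ≤ M n := by
  obtain ⟨α, -, e⟩ := hM
  rw [e n hn]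
  positivity

theorem ConditionM.tendsto_atTop {M : ℕ → ℝ} (hM : ConditionM M) : Tendsto M atTop atTop := by
  obtain ⟨α, h0, e⟩ := hM
  refine ((tendsto_rpow_atTop h0).comp tendsto_natCast_atTop_atTop).congr' ?_
  filter_upwards [eventually_ge_atTop 1] with n hn
  rw [e n hn, Function.comp_apply]

theorem ConditionM.exists_le_pow {M : ℕ → ℝ} (hM : ConditionM M) :
    ∃ k : ℕ, ∀ n : ℕ, 1 ≤ n → M n ≤ (n : ℝ) ^ k := by
  obtain ⟨α, -, e⟩ := hM
  refine ⟨⌈α⌉₊, fun n hn => ?_⟩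
  rw [e n hn, ← Real.rpow_natCast]
  exact Real.rpow_le_rpow_of_exponent_le (by exact_mod_cast hn) (Nat.le_ceil α)

/-- Exponentially small probabilities beat the polynomial growth of the truncation levels and of the
inverse bandwidths. -/
theorem tendsto_badEvent_zero {h M : ℕ → ℝ} (hH : ConditionH h) (hM : ConditionM M) {A c : ℝ}
    (hA : 0 ≤ A) (hc : 0 < c) : Tendsto (fun n : ℕ => n * h n * ((2 * M n + A / h n) ^ 2 *
      ((1 / h n + 1) * Real.exp (-c * n)))) atTop (𝓝 0) := by
  obtain ⟨B, hB, hBn⟩ := hH.exists_bounds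
  obtain ⟨k, hk⟩ := hM.exists_le_pow
  have h1 := tendsto_pow_const_mul_const_pow_of_abs_lt_one (2 * k + 4) (r := Real.exp (-c))
    (by rw [abs_of_pos (Real.exp_pos _)]; exact Real.exp_lt_one_iff.2 (by linarith))
  have h2 := h1.const_mul (B * (2 + A * B) ^ 2 * (B + 1))
  rw [mul_zero] at h2
  refine squeeze_zero' ?_ ?_ h2
  · filter_upwards [eventually_ge_atTop 1] with n hn
    have := hH.pos hn
    positivity
  · filter_upwards [eventually_ge_atTop 1] with n hn
    have hn1 : (1 : ℝ) ≤ n := by exact_mod_cast hn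
    have hh := hH.pos hn
    have hM0 := hM.nonneg hn
    obtain ⟨b1, b2⟩ := hBn n hn
    have hk' := hk n hn
    have e1 : 2 * M n + A / h n ≤ (2 + A * B) * (n : ℝ) ^ (k + 1) := by
      have p1 : (n : ℝ) ^ k ≤ (n : ℝ) ^ (k + 1) := pow_le_pow_right₀ hn1 (Nat.le_succ k)
      have p2 : (n : ℝ) ≤ (n : ℝ) ^ (k + 1) := le_self_pow₀ hn1 (Nat.succ_ne_zero k)
      calc 2 * M n + A / h n = 2 * M n + A * (1 / h n) := by ring
        _ ≤ 2 * (n : ℝ) ^ (k + 1) + A * (B * (n : ℝ) ^ (k + 1)) := by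
          gcongr
          · exact hk'.trans p1
          · exact b2.trans (by gcongr)
        _ = _ := by ring
    have e2 : 1 / h n + 1 ≤ (B + 1) * n := by linarith
    have e3 : Real.exp (-c * n) = Real.exp (-c) ^ n := by
      rw [← Real.exp_nat_mul]
      ring_nf
    calc n * h n * ((2 * M n + A / h n) ^ 2 * ((1 / h n + 1) * Real.exp (-c * n)))
        ≤ n * B * (((2 + A * B) * (n : ℝ) ^ (k + 1)) ^ 2 *
            (((B + 1) * n) * Real.exp (-c) ^ n)) := by
          rw [e3]
          gcongr
      _ = _ := by ring

/-! ### The variance of the estimator -/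

section Estimator

variable {Ω : Type*} [MeasurableSpace Ω] {P : Measure Ω} {Z : ℕ → Ω → ℝ} {μ : Measure ℝ}
  {lam : ℝ} {f w : ℝ → ℝ} {h M : ℕ → ℝ}

theorem memLp_fHat [IsProbabilityMeasure P] (hZ : ∀ j, Measurable (Z j))
    (hs : CompoundSetting lam f w μ) (hH : ConditionH h) (hM : ConditionM M) {n : ℕ} (hn : 1 ≤ n)
    (x : ℝ) : MemLp (fun ω => fHat lam w (h n) (M n) n (fun j => Z j ω) x) 2 P := by
  have h1 := (measurable_fHat lam hs.integrable_w hs.integral_w hs.charFn_w_eq_zero (hH.pos hn)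
    (M n) hn x).comp (measurable_pi_lambda (fun ω j => Z j ω) hZ)
  exact MemLp.of_bound h1.aestronglyMeasurable (M n)
    (Eventually.of_forall fun ω => abs_fHat_le lam w (h n) (hM.nonneg hn) n _ x)

/-- The remainder of the estimator after its linear part is negligible in mean square. -/
theorem tendsto_integral_sq_remainder [IsProbabilityMeasure P] [IsProbabilityMeasure μ]
    (hZ : ∀ j, Measurable (Z j)) (hind : iIndepFun Z P) (hlaw : ∀ j, P.map (Z j) = μ)
    (hs : CompoundSetting lam f w μ) (hH : ConditionH h) (hM : ConditionM M) (x : ℝ)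
    (hsm : ∀ᶠ n in atTop, SmallBandwidth lam f w μ (h n)) {A : ℝ} (hA : 0 < A)
    (hinf : ∀ᶠ n in atTop, (∀ y, |influence lam w μ (h n) x y| ≤ A / h n) ∧
      ∫ y, influence lam w μ (h n) x y ^ 2 ∂μ ≤ A / h n) :
    Tendsto (fun n : ℕ => n * h n * ∫ ω, (fHat lam w (h n) (M n) n (fun j => Z j ω) x -
      center lam f w μ (h n) x -
      deviation μ n (influence lam w μ (h n) x) (fun j => Z j ω)) ^ 2 ∂P) atTop (𝓝 0) := by
  obtain ⟨δ, C, hδ, hC, hexp⟩ := exists_abs_fRaw_sub_le hs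
  obtain ⟨K, c, hc, hunif⟩ := exists_uniform_empCharFn_close hZ hind hlaw hδ
  obtain ⟨C₀, hC₀⟩ := exists_abs_center_le hs
  have hnh := hH.tendsto_natCast_mul
  have l1 := hnh.inv_tendsto_atTop
  have l2 := tendsto_badEvent_zero hH hM (A := 2 * A) (by positivity) hc
  have hlim : Tendsto (fun n : ℕ => (2 * C ^ 2 * 112) * (n * h n)⁻¹ +
      (8 * A ^ 3 * ((n * h n)⁻¹) ^ 2 + 6 * A ^ 2 * (n * h n)⁻¹) +
      K * (n * h n * ((2 * M n + 2 * A / h n) ^ 2 * ((1 / h n + 1) * Real.exp (-c * n)))))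
      atTop (𝓝 0) := by
    have := ((l1.const_mul (2 * C ^ 2 * 112)).add (((l1.pow 2).const_mul (8 * A ^ 3)).add
      (l1.const_mul (6 * A ^ 2)))).add (l2.const_mul K)
    simpa using this
  refine squeeze_zero' ?_ ?_ hlim
  · filter_upwards [eventually_ge_atTop 1] with n hn
    have := hH.pos hn
    exact mul_nonneg (by positivity) (integral_nonneg fun ω => sq_nonneg _)
  · filter_upwards [eventually_ge_atTop 1, hsm, hinf,
      hM.tendsto_atTop.eventually_ge_atTop (C₀ + 1)] with n hn hsn ⟨hv, hv2⟩ hMn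
    have hn0 : (0 : ℝ) < n := by exact_mod_cast hn
    have hh := hH.pos hn
    have hq := (continuous_influence hs hsn x).measurable
    set q := influence lam w μ (h n) x with hqdef
    set c₀ := center lam f w μ (h n) x with hc₀
    have hcM : |c₀| + 1 ≤ M n := by linarith [hC₀ (h n) x hsn]
    set T : Ω → ℝ := fun ω => deviation μ n q (fun j => Z j ω) with hT
    set S : Ω → ℝ := fun ω => squaredError μ n (1 / h n) (fun j => Z j ω) with hS
    set E : Ω → ℝ := fun ω => fHat lam w (h n) (M n) n (fun j => Z j ω) x - c₀ - T ω with hE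
    obtain ⟨G, hG, hPG, hGδ⟩ := hunif n hn (1 / h n) (by positivity)
    have hTm : Measurable T := measurable_deviation hZ hq n
    have hTb : ∀ ω, |T ω| ≤ 2 * (A / h n) := fun ω => abs_deviation_le hn hv _
    have hEL : MemLp E 2 P := ((memLp_fHat hZ hs hH hM hn x).sub (memLp_const c₀)).sub
      (MemLp.of_bound hTm.aestronglyMeasurable _ (Eventually.of_forall hTb))
    have hT4 : Integrable (fun ω => T ω ^ 4) P :=
      Integrable.of_bound (hTm.pow_const 4).aestronglyMeasurable ((2 * (A / h n)) ^ 4)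
        (Eventually.of_forall fun ω => by
          rw [Real.norm_eq_abs, abs_pow]
          have := hTb ω
          gcongr)
    obtain ⟨hS2, hS2le⟩ := integral_squaredError_sq_le hZ hind hlaw hn
      (R := 1 / h n) (by positivity)
    have hgood : ∀ ω ∈ G, |E ω| ≤ C * S ω + T ω ^ 2 := fun ω hω => by
      have h1 := hexp (h n) x hsn n hn (fun j => Z j ω) (hGδ ω hω)
      rw [linearPart_eq_deviation hs hsn] at h1
      exact abs_truncate_sub_le hcM h1
    have hbad : ∀ ω, |E ω| ≤ 2 * M n + 2 * A / h n := fun ω => by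
      have h1 := abs_fHat_le lam w (h n) (hM.nonneg hn) n (fun j => Z j ω) x
      have h2 := hTb ω
      have h3 := abs_sub (fHat lam w (h n) (M n) n (fun j => Z j ω) x - c₀) (T ω)
      have h4 := abs_sub (fHat lam w (h n) (M n) n (fun j => Z j ω) x) c₀
      have e : 2 * A / h n = 2 * (A / h n) := by ring
      rw [e]
      change |fHat lam w (h n) (M n) n (fun j => Z j ω) x - c₀ - T ω| ≤ _
      linarith
    have hmain := integral_sq_remainder_le hG hEL hS2 hT4 hgood hbad
    have h4 := (moments_deviation hZ hind hlaw hq hv hn).2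
    have hq0 : 0 ≤ ∫ y, q y ^ 2 ∂μ := integral_nonneg fun y => sq_nonneg _
    have h4' : ∫ ω, T ω ^ 4 ∂P ≤ (4 * (A / h n) ^ 2 / n ^ 3) * (A / h n) +
        3 / n ^ 2 * (A / h n) ^ 2 := h4.trans (by gcongr)
    calc n * h n * ∫ ω, E ω ^ 2 ∂P
        ≤ n * h n * (2 * C ^ 2 * (112 * (1 / h n / n) ^ 2) +
          2 * ((4 * (A / h n) ^ 2 / n ^ 3) * (A / h n) + 3 / n ^ 2 * (A / h n) ^ 2) +
          (2 * M n + 2 * A / h n) ^ 2 * (K * (1 / h n + 1) * Real.exp (-c * n))) := by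
          gcongr
          exact hmain.trans (by gcongr)
      _ = _ := by
          field_simp
          ring

/-- The variance asymptotics for a sample `Z` from `μ`. -/
theorem tendsto_variance_fHat [IsProbabilityMeasure P] [IsProbabilityMeasure μ]
    (hZ : ∀ j, Measurable (Z j)) (hind : iIndepFun Z P) (hlaw : ∀ j, P.map (Z j) = μ)
    (hs : CompoundSetting lam f w μ) (hH : ConditionH h) (hM : ConditionM M)
    {g : ℝ → ℝ} (hg : Continuous g) (hg0 : ∀ y, 0 ≤ g y) {K : ℝ} (hK : ∀ y, g y ≤ K)
    (hμ : μ = volume.withDensity fun y => ENNReal.ofReal (g y)) (x : ℝ) :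
    Tendsto (fun n : ℕ => n * h n * Var[fun ω => fHat lam w (h n) (M n) n (fun j => Z j ω) x; P])
      atTop (𝓝 ((Real.exp lam - 1) ^ 2 / lam ^ 2 * g x * ∫ u, w u ^ 2)) := by
  have hpos : ∀ᶠ n in atTop, 0 < h n := by
    filter_upwards [eventually_ge_atTop 1] with n hn using hH.pos hn
  have hsm := hs.eventually_smallBandwidth hpos hH.tendsto_zero
  obtain ⟨hlim, A, hA, hinf⟩ := influence_asymptotics hs hg hg0 hK hμ hsm hH.tendsto_zero x
  refine tendsto_mul_of_abs_sub_le
    (a := fun n => ∫ ω, deviation μ n (influence lam w μ (h n) x) (fun j => Z j ω) ^ 2 ∂P) ?_ ?_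
    (tendsto_integral_sq_remainder hZ hind hlaw hs hH hM x hsm hA hinf) ?_
  · filter_upwards [hpos] with n hn
    positivity
  · refine hlim.congr' ?_
    filter_upwards [eventually_ge_atTop 1, hsm, hinf] with n hn hsn hv
    have hn0 : (0 : ℝ) < n := by exact_mod_cast hn
    rw [(moments_deviation hZ hind hlaw (continuous_influence hs hsn x).measurable hv.1 hn).1]
    field_simp
  · filter_upwards [eventually_ge_atTop 1, hsm, hinf] with n hn hsn hv
    have hq := (continuous_influence hs hsn x).measurable
    exact abs_variance_sub_le (MemLp.of_bound (measurable_deviation hZ hq n).aestronglyMeasurable _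
      (Eventually.of_forall fun ω => abs_deviation_le hn hv.1 _)) (memLp_fHat hZ hs hH hM hn x)
      (integral_deviation hZ hlaw hq hv.1 hn)

end Estimator

end Decompounding

theorem proposition2p2
    {Ω₀ Ω : Type*} [MeasurableSpace Ω₀] [MeasurableSpace Ω]
    (P₀ : Measure Ω₀) [IsProbabilityMeasure P₀] (P : Measure Ω) [IsProbabilityMeasure P]
    (lam β L₁ L₂ : ℝ) (hlam : 0 < lam) (hβ : 0 < β) (hL₁ : 0 < L₁) (hL₂ : 0 < L₂)
    (f : ℝ → ℝ) (N : Ω₀ → ℕ) (Y : ℕ → Ω₀ → ℝ)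
    (hmodel : Decompounding.IsPoissonSumModel P₀ lam f N Y)
    (X : ℕ → Ω → ℝ) (hXm : ∀ i, Measurable (X i)) (hXindep : iIndepFun X P)
    (hXlaw : ∀ i, P.map (X i) = P₀.map (Decompounding.compoundSum N Y))
    (w : ℝ → ℝ) (h M : ℕ → ℝ)
    (hF : Decompounding.ConditionF β L₁ L₂ f) (hW : Decompounding.ConditionW β w)
    (hH : Decompounding.ConditionH h) (hM : Decompounding.ConditionM M)
    (hnh : Tendsto (fun n : ℕ => (n : ℝ) * h n ^ (1 + 4 * β)) atTop (𝓝 0)) :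
    ∃ g : ℝ → ℝ, Continuous g ∧ (∀ y, 0 ≤ g y) ∧
      (P₀[|{ω | 0 < N ω}]).map (Decompounding.compoundSum N Y)
        = volume.withDensity (fun y => ENNReal.ofReal (g y)) ∧
      ∀ x : ℝ,
        (∀ n : ℕ, 1 ≤ n → MemLp (Decompounding.estimator lam w h M X n x) 2 P) ∧
        (fun n : ℕ => Var[Decompounding.estimator lam w h M X n x; P]
            - 1 / ((n : ℝ) * h n) * ((Real.exp lam - 1) ^ 2 / lam ^ 2) * g x
              * ∫ u : ℝ, (w u) ^ 2)
          =o[atTop] (fun n : ℕ => 1 / ((n : ℝ) * h n)) := by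
  have hfc := hF.continuous hβ
  have hfi := hmodel.integrable_density hfc
  have hφ := hF.integrable_charFn' hβ hfi
  obtain ⟨K, hK⟩ := Decompounding.exists_abs_le_of_integrable_charFn hfc hfi hφ
  obtain ⟨hprob, ⟨g, hg, hg0, hgK, hμ⟩, hle, hcomp⟩ :=
    Decompounding.exists_density_nonzero hmodel hlam hfc hK _ rfl
  have hYprob : IsProbabilityMeasure (volume.withDensity fun y => ENNReal.ofReal (f y)) := by
    rw [← hmodel.law_Y 0]
    exact Measure.isProbabilityMeasure_map (hmodel.measurable_Y 0).aemeasurable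
  have hs : Decompounding.CompoundSetting lam f w
      ((P₀[|{ω | 0 < N ω}]).map (Decompounding.compoundSum N Y)) :=
    { lam_pos := hlam
      integrable_w := hW.integrable
      integral_w := hW.kernel.integral_eq_one
      charFn_w_eq_zero := fun s hs => hW.charFn_eq_zero hs
      integrable_f := hfi
      integrable_charFn_f := hφ
      norm_charFn_f_le := fun t => by
        rw [← Decompounding.charFun_withDensity hfc hmodel.density_nonneg]
        exact norm_charFun_le_one t
      charFn_f_zero := by
        rw [← Decompounding.charFun_withDensity hfc hmodel.density_nonneg]
        simp
      norm_charFun_le := hle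
      compound := hcomp }
  have hp : ENNReal.ofReal (1 - Real.exp (-lam)) ≠ 0 := by
    have : Real.exp (-lam) < 1 := Real.exp_lt_one_iff.2 (by linarith)
    simpa using this
  have hlaw : ∀ i, ∀ C, MeasurableSet C → P (X i ⁻¹' (C \ {0})) =
      ENNReal.ofReal (1 - Real.exp (-lam)) *
        (P₀[|{ω | 0 < N ω}]).map (Decompounding.compoundSum N Y) C := fun i C hC => by
    rw [← Measure.map_apply (hXm i) (hC.diff (MeasurableSet.singleton 0)), hXlaw,
      Decompounding.map_compoundSum_diff_zero hmodel hlam hμ hC]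
  have hZ := Decompounding.measurable_nonzeroObs hXm
  have hZlaw := Decompounding.map_nonzeroObs hXm hXindep hlaw hp
  have hZind := Decompounding.iIndepFun_nonzeroObs hXm hXindep hlaw hp
  refine ⟨g, hg, hg0, hμ, fun x => ⟨fun n hn => Decompounding.memLp_fHat hZ hs hH hM hn x, ?_⟩⟩
  have hlim := Decompounding.tendsto_variance_fHat hZ hZind hZlaw hs hH hM hg hg0 hgK hμ x
  refine (isLittleO_iff_tendsto' ?_).2 ?_
  · filter_upwards [eventually_ge_atTop 1] with n hn h0
    have := hH.pos hn
    have hn0 : (0 : ℝ) < n := by exact_mod_cast hn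
    exact absurd h0 (by positivity)
  · have := hlim.sub_const ((Real.exp lam - 1) ^ 2 / lam ^ 2 * g x * ∫ u, w u ^ 2)
    rw [sub_self] at this
    refine this.congr' ?_
    filter_upwards [eventually_ge_atTop 1] with n hn
    have := hH.pos hn
    have hn0 : (0 : ℝ) < n := by exact_mod_cast hn
    change _ = (Var[fun ω => Decompounding.fHat lam w (h n) (M n) n
      (fun k => Decompounding.nonzeroObs X k ω) x; P] - _) / _
    field_simp
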